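/- **Setting.** For $\mathcal X\in\mathbb R^{n\times\cdots\times n}$ ($d$ modes) let $\|\mathcal X\|_2$ be the entrywise Euclidean norm, $X_{[j]}\in\mathbb R^{n\times n^{d-1}}$ the mode-$j$ unfolding (columns are the mode-$j$ fibers), $\times_j$ the mode-$j$ product with a matrix, and $[\![\mathcal G,U_1,\dots,U_d]\!]=\mathcal G\times_1U_1\cdots\times_dU_d$. Let $\mathrm{opt}_r(\mathcal X)=\inf\|\mathcal X-[\![\mathcal G,U_1,\dots,U_d]\!]\|_2$ over $\mathcal G\in\mathbb R^{r\times\cdots\times r}$, $U_j\in\mathbb R^{n\times r}$ (the error of an optimal rank-$(r,\dots,r)$ Tucker approximation). *Measurements.* Given matrices $\Omega_{(j,i)}\in\mathbb R^{m\times n}$ ($i\ne j$), invertible $\Omega_{(j,j)}\in\mathbb R^{n\times n}$ and $\Phi_j\in\mathbb R^{m_c\times n}$, the leave-one-out measurements are $B_j=\Omega_{(j,j)}X_{[j]}\big(\bigotimes_{i\ne j}\Omega_{(j,i)}\big)^T\in\mathbb R^{n\times m^{d-1}}$, $j=1,\dots,d$, and the core measurements are $\mathcal B_c=\mathcal X\times_1\Phi_1\cdots\times_d\Phi_d$.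 The total number of scalar linear measurements is $ndm^{d-1}+m_c^d$. *Recovery algorithm.* Input: $B_j$, $\mathcal B_c$, $\Omega_{(j,j)}$, $\Phi_j$, $r$ (and not $\mathcal X$). (i) For each $j$, solve $\Omega_{(j,j)}F_j=B_j$ and let $Q_j\in\mathbb R^{n\times r}$ consist of $r$ leading left singular vectors of $F_j$; if $\Omega_{(j,j)}$ is the identity no system is solved. (ii) Set $\mathcal H\leftarrow\mathcal B_c$; for $j=1,\dots,d$ unfold $\mathcal H$ along mode $j$ to a matrix $H$, solve $\Phi_jQ_jH_{\rm new}=H$ in the least squares sense (by the pseudo-inverse), and fold $H_{\rm new}$ back, so that the length of mode $j$ changes from $m_c$ to $r$. Output: $\mathcal H,Q_1,\dots,Q_d$; put $\mathcal X_1=[\![\mathcal H,Q_1,\dots,Q_d]\!]$. Singular value decompositions (SVDs) come from an arbitrary exact SVD routine depending Borel measurably on its input. *Running time.* One step for each real arithmetic operation, comparison with zero, and stored table entry, and $\gamma\,pq\min(p,q)$ steps for an SVD of a $p\times q$ matrix, where $\gamma$ is any constant; linear and least squares systems are solved through an SVD. **Theorem.** For every $K\ge0$ there are a constant $C>0$ depending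 only on $K$ and sketching dimensions $m,m_c$, which are functions of $(d,n,r,\epsilon,\delta)$ (and $K$), such that for all integers $d\ge2$, $r\ge1$ and all $\epsilon\in(0,1)$, $\delta\in(0,\frac13)$ the following hold. Write $L=\frac{Crd^2}{\epsilon^2}\ln\!\big(\frac{dn^d}{\delta}\big)$. 1. Let $n\ge r$. Then $r\le m\le L$, $r\le m_c\le L$, and the number of linear measurements satisfies $$ndm^{d-1}+m_c^d\le\Big[nd+\frac{Crd^2}{\epsilon^2}\ln\Big(\frac{dn^d}{\delta}\Big)\Big]\Big(\frac{Crd^2}{\epsilon^2}\ln\Big(\frac{dn^d}{\delta}\Big)\Big)^{d-1}.$$ Let the entries of all the matrices $\sqrt m\,\Omega_{(j,i)}$ ($i\neq j$) and $\sqrt{m_c}\,\Phi_j$ be mutually independent random variables $\xi$ (with possibly different laws) that have mean $0$, variance $1$ and are sub-gaussian with parameter $K$: $\mathbb E e^{t\xi}\le e^{Kt^2/2}$ for all $t\in\mathbb R$ (for $K=1$, e.g. standard normal, so that $C$ is absolute). Let the $\Omega_{(j,j)}$ be arbitrary fixed invertible matrices. Then for every tensor $\mathcal X$ the factors $Q_1,\dots,Q_d$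 always have orthonormal columns, and with probability at least $1-\delta$ $$\|\mathcal X-\mathcal X_1\|_2\le(1+e^\epsilon)\sqrt{\frac{d(1+\epsilon)}{1-\epsilon}}\;\mathrm{opt}_r(\mathcal X).$$ 2. For fixed $d,r,\epsilon,\delta$ and $\gamma$, the worst-case running time of the recovery algorithm with these $m,m_c$ (over all inputs $B_j,\mathcal B_c,\Phi_j$ and all SVD routines) is $o(n^d)$ as $n\to\infty$, if all $\Omega_{(j,j)}$ are the identity; for $d\ge4$ this also holds for arbitrary dense matrices $\Omega_{(j,j)}$. -/

import Mathlib

open MeasureTheory ProbabilityTheory Asymptotics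
open scoped NNReal ENNReal Matrix

noncomputable section

/-! ## Tensors, unfoldings, modewise products, Tucker approximation -/

/-- Real `d`-mode tensors whose `i`-th side has length `s i`. -/
abbrev Tensor {d : ℕ} (s : Fin d → ℕ) : Type := (∀ i, Fin (s i)) → ℝ

/-- The standard (entrywise Euclidean) tensor norm. -/
def tensorNorm {d : ℕ} {s : Fin d → ℕ} (T : Tensor s) : ℝ := Real.sqrt (∑ x, T x ^ 2)

/-- The column indices of the mode-`k` unfolding: the multi-indices of all modes but `k`. -/
abbrev Cols {d : ℕ} (s : Fin d → ℕ) (k : Fin d) : Type := ∀ j : {j : Fin d // j ≠ k}, Fin (s j)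

/-- The mode-`k` unfolding: its columns are the mode-`k` fibers. -/
def unfold {d : ℕ} {s : Fin d → ℕ} (k : Fin d) (T : Tensor s) : Matrix (Fin (s k)) (Cols s k) ℝ :=
  fun a c => T ((Equiv.piSplitAt k (fun j => Fin (s j))).symm (a, c))

/-- `T ×₁ M₁ ×₂ M₂ ⋯ ×_d M_d`, the modewise product with one matrix in every mode. -/
def modewiseProd {d : ℕ} {s t : Fin d → ℕ} (T : Tensor s)
    (M : ∀ i, Matrix (Fin (t i)) (Fin (s i)) ℝ) : Tensor t :=
  fun y => ∑ x, (∏ i, M i (y i) (x i)) * T x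

/-- A core of side `r` with one `n × r` factor matrix for each of the `d` modes. -/
structure TuckerFactors (d n r : ℕ) where
  core : Tensor (fun _ : Fin d => r)
  factor : Fin d → Matrix (Fin n) (Fin r) ℝ

/-- The tensor `⟦G, U₁, …, U_d⟧ = G ×₁ U₁ ⋯ ×_d U_d`. -/
def TuckerFactors.toTensor {d n r : ℕ} (F : TuckerFactors d n r) : Tensor (fun _ : Fin d => n) :=
  modewiseProd F.core F.factor

/-- All factor matrices have orthonormal columns. -/
def TuckerFactors.Orthonormal {d n r : ℕ} (F : TuckerFactors d n r) : Prop :=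
  ∀ i, (F.factor i)ᵀ * F.factor i = 1

/-- The error of an optimal rank-`(r, …, r)` Tucker approximation of `X`. -/
def optTuckerError {d n : ℕ} (r : ℕ) (X : Tensor (fun _ : Fin d => n)) : ℝ :=
  ⨅ F : TuckerFactors d n r, tensorNorm (X - F.toTensor)

/-! ## Measurements -/

/-- The square matrix applied to the uncompressed mode: either no matrix at all (the identity),
or a stored dense matrix. -/
abbrev ModeSensing (n : ℕ) : Type := Option (Matrix (Fin n) (Fin n) ℝ)

/-- The matrix that a `ModeSensing` stands for. -/
def ModeSensing.toMatrix {n : ℕ} (W : ModeSensing n) : Matrix (Fin n) (Fin n) ℝ := W.getD 1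

/-- The Kronecker product `⨂_{j ≠ k} Ω_j`, as a matrix from the columns of the mode-`k` unfolding of
a tensor of side `n` to those of a tensor of side `m`. -/
def kronOthers {d n m : ℕ} (k : Fin d) (W : {j : Fin d // j ≠ k} → Matrix (Fin m) (Fin n) ℝ) :
    Matrix (Cols (fun _ => m) k) (Cols (fun _ => n) k) ℝ :=
  fun c c' => ∏ j, W j (c j) (c' j)

/-- Mode-`k` leave-one-out measurements `B_k = Ω_{(k,k)} X_{[k]} Ω_{-k}ᵀ` with Kronecker structured
`Ω_{-k}`. -/
def leaveOneOut {d n m : ℕ} (k : Fin d) (D : Matrix (Fin n) (Fin n) ℝ)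
    (W : {j : Fin d // j ≠ k} → Matrix (Fin m) (Fin n) ℝ) (X : Tensor (fun _ : Fin d => n)) :
    Matrix (Fin n) (Cols (fun _ => m) k) ℝ :=
  D * unfold k X * (kronOthers k W)ᵀ

/-- Core measurements `X ×₁ Φ₁ ⋯ ×_d Φ_d`. -/
def coreMeasurement {d n mc : ℕ} (Φ : Fin d → Matrix (Fin mc) (Fin n) ℝ)
    (X : Tensor (fun _ : Fin d => n)) : Tensor (fun _ : Fin d => mc) :=
  modewiseProd X Φ

/-- One index for each scalar linear measurement: the entries of `B_1, …, B_d` and of the core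
measurement tensor. -/
abbrev MeasurementIndex (d n m mc : ℕ) : Type :=
  (Σ k : Fin d, Fin n × Cols (fun _ => m) k) ⊕ (Fin d → Fin mc)

/-- The total number of linear measurements. -/
def numMeasurements (d n m mc : ℕ) : ℕ := Fintype.card (MeasurementIndex d n m mc)

/-- One index for each random entry of the measurement ensemble: the entries of the
`m × n` matrices `Ω_{(k,j)}`, `j ≠ k`, and of the `mc × n` matrices `Φ_k`. -/
abbrev EnsembleIndex (d n m mc : ℕ) : Type :=
  ((Σ k : Fin d, {j : Fin d // j ≠ k}) × Fin m × Fin n) ⊕ (Fin d × Fin mc × Fin n)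

/-- The matrices `Ω_{(k,j)}`: the raw random entries, divided by `√m`. -/
def ensembleΩ {d n m mc : ℕ} (ω : EnsembleIndex d n m mc → ℝ) (k : Fin d)
    (j : {j : Fin d // j ≠ k}) : Matrix (Fin m) (Fin n) ℝ :=
  fun a b => ω (Sum.inl (⟨k, j⟩, a, b)) / Real.sqrt m

/-- The matrices `Φ_k`: the raw random entries, divided by `√mc`. -/
def ensembleΦ {d n m mc : ℕ} (ω : EnsembleIndex d n m mc → ℝ) (k : Fin d) :
    Matrix (Fin mc) (Fin n) ℝ :=
  fun a b => ω (Sum.inr (k, a, b)) / Real.sqrt mc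

/-- A law on `ℝ` with mean zero, variance one, sub-gaussian with parameter `K`
(for `K = 1`, e.g. the standard normal law or a fair random sign). -/
structure IsStdSubgaussian (K : ℝ≥0) (ν : Measure ℝ) : Prop where
  mean_zero : ∫ x, x ∂ν = 0
  var_one : ∫ x, x ^ 2 ∂ν = 1
  subgaussian : HasSubgaussianMGF (fun x : ℝ => x) K ν

/-! ## A step-counting model for exact real arithmetic

A computation carries its result and the number of steps spent. Each arithmetic operation,
each comparison with zero and each table entry written costs one step; re-indexing (such as
transposing or reshaping a stored table) is free. The only other primitive is the singular value
decomposition. -/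

/-- A result together with the number of steps spent on it. -/
structure Timed (α : Type) where
  val : α
  steps : ℕ

namespace Timed

instance : Monad Timed where
  pure a := ⟨a, 0⟩
  bind x f := ⟨(f x.val).val, x.steps + (f x.val).steps⟩

/-- One addition. -/
def add (a b : ℝ) : Timed ℝ := ⟨a + b, 1⟩

/-- One multiplication. -/
def mul (a b : ℝ) : Timed ℝ := ⟨a * b, 1⟩

/-- One division. -/
def div (a b : ℝ) : Timed ℝ := ⟨a / b, 1⟩

open Classical in
/-- One comparison with zero. -/
def isZero (a : ℝ) : Timed Bool := ⟨decide (a = 0), 1⟩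

/-- One table entry written. -/
def store (a : ℝ) : Timed ℝ := ⟨a, 1⟩

/-- Run the computations `f i` one after the other and collect their results. -/
def forEach {ι : Type} [Fintype ι] {β : ι → Type} (f : ∀ i, Timed (β i)) : Timed (∀ i, β i) :=
  ⟨fun i => (f i).val, ∑ i, (f i).steps⟩

/-- Compute and store the entries of a matrix. -/
def tabulate {ι κ : Type} [Fintype ι] [Fintype κ] (f : ι → κ → Timed ℝ) :
    Timed (Matrix ι κ ℝ) :=
  forEach fun i => forEach fun j => do
    let a ← f i j
    store a

/-- Inner product by successive multiplications and additions. -/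
def dot {p : ℕ} (u v : Fin p → ℝ) : Timed ℝ :=
  Fin.foldl p (fun acc k => do
    let s ← acc
    let t ← mul (u k) (v k)
    add s t) (pure 0)

/-- Schoolbook matrix multiplication. -/
def matMul {ι κ : Type} [Fintype ι] [Fintype κ] {p : ℕ} (A : Matrix ι (Fin p) ℝ)
    (B : Matrix (Fin p) κ ℝ) : Timed (Matrix ι κ ℝ) :=
  tabulate fun i j => dot (fun k => A i k) (fun k => B k j)

end Timed

/-- A thin singular value decomposition `A = U diag(σ) Vᵀ`, with the singular values in
non-increasing order. -/
structure ThinSVD (p q : ℕ) where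
  U : Matrix (Fin p) (Fin (min p q)) ℝ
  σ : Fin (min p q) → ℝ
  V : Matrix (Fin q) (Fin (min p q)) ℝ

/-- `D` is a thin singular value decomposition of `A`. -/
structure ThinSVD.IsSVDOf {p q : ℕ} (D : ThinSVD p q) (A : Matrix (Fin p) (Fin q) ℝ) : Prop where
  U_orthonormal : D.Uᵀ * D.U = 1
  V_orthonormal : D.Vᵀ * D.V = 1
  σ_nonneg : ∀ k, 0 ≤ D.σ k
  σ_antitone : Antitone D.σ
  eq : A = D.U * Matrix.diagonal D.σ * D.Vᵀ

/-- A routine that computes a singular value decomposition of every real matrix. Singular vectors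
are not unique; which ones are returned is up to the routine, as long as they depend measurably on
the matrix. -/
structure SVDRoutine where
  run : ∀ {p q : ℕ}, Matrix (Fin p) (Fin q) ℝ → ThinSVD p q
  isSVDOf : ∀ {p q : ℕ} (A : Matrix (Fin p) (Fin q) ℝ), (run A).IsSVDOf A
  measurable_U : ∀ (p q : ℕ) (i : Fin p) (k : Fin (min p q)),
    Measurable fun a : Fin p → Fin q → ℝ => (run (Matrix.of a)).U i k
  measurable_σ : ∀ (p q : ℕ) (k : Fin (min p q)),
    Measurable fun a : Fin p → Fin q → ℝ => (run (Matrix.of a)).σ k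
  measurable_V : ∀ (p q : ℕ) (j : Fin q) (k : Fin (min p q)),
    Measurable fun a : Fin p → Fin q → ℝ => (run (Matrix.of a)).V j k

/-- Call the routine on a `p × q` matrix, at the usual cost `γ · p q min(p, q)`. -/
def Timed.svd (γ : ℕ) (S : SVDRoutine) {p q : ℕ} (A : Matrix (Fin p) (Fin q) ℝ) :
    Timed (ThinSVD p q) :=
  ⟨S.run A, γ * (p * q * min p q)⟩

/-- Solve `A Z = Y` for `Z` in the least squares sense, by applying the pseudo-inverse
`V diag(σ)⁺ Uᵀ` of `A` to `Y`. -/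
def Timed.solve (γ : ℕ) (S : SVDRoutine) {p q : ℕ} {κ : Type} [Fintype κ]
    (A : Matrix (Fin p) (Fin q) ℝ) (Y : Matrix (Fin p) κ ℝ) : Timed (Matrix (Fin q) κ ℝ) := do
  let D ← Timed.svd γ S A
  let W ← Timed.matMul D.Uᵀ Y
  let Z ← Timed.tabulate fun i j => do
    let b ← Timed.isZero (D.σ i)
    if b then pure 0 else Timed.div (W i j) (D.σ i)
  Timed.matMul D.V Z

/-! ## The one-pass recovery algorithm -/

/-- Factor recovery in one mode: solve `Ω F = B` for `F` (if `Ω` is the identity, `F` is a copy of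
`B`) and keep the `r` leading left singular vectors of `F`. If `F` has fewer than `r` rows or
columns, the missing vectors are replaced by zero. -/
def recoverFactor (γ : ℕ) (S : SVDRoutine) {n : ℕ} {κ : Type} [Fintype κ] (r : ℕ)
    (W : ModeSensing n) (B : Matrix (Fin n) κ ℝ) : Timed (Matrix (Fin n) (Fin r) ℝ) := do
  let F ← match W with
    | none => Timed.tabulate fun i j => pure (B i j)
    | some D => Timed.solve γ S D B
  let E ← Timed.svd γ S (F.submatrix id (Fintype.equivFin κ).symm)
  Timed.tabulate fun i k =>
    pure (if h : (k : ℕ) < min n (Fintype.card κ) then E.U i ⟨k, h⟩ else 0)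

/-- The side lengths of the partially solved core after `k` modes have been treated: `r` in the
first `k` modes and `mc` in the others. -/
def stageSides (d r mc k : ℕ) : Fin d → ℕ := fun i => if (i : ℕ) < k then r else mc

theorem stageSides_zero (d r mc : ℕ) (i : Fin d) : stageSides d r mc 0 i = mc := by
  simp [stageSides]

theorem stageSides_last (d r mc : ℕ) (i : Fin d) : stageSides d r mc d i = r := by
  simp [stageSides]

theorem stageSides_self (d r mc : ℕ) (k : Fin d) : stageSides d r mc k k = mc := by
  simp [stageSides]

theorem stageSides_succ_self (d r mc : ℕ) (k : Fin d) : stageSides d r mc (k + 1) k = r := by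
  simp [stageSides]

theorem stageSides_succ_of_ne (d r mc : ℕ) (k j : Fin d) (h : j ≠ k) :
    stageSides d r mc (k + 1) j = stageSides d r mc k j := by
  have h' : (j : ℕ) ≠ k := fun e => h (Fin.ext e)
  have : (j : ℕ) < k + 1 ↔ (j : ℕ) < k := by omega
  simp [stageSides, this]

/-- One iteration of core recovery: unfold along mode `k`, solve `Φ_k Q_k H_new = H` in the least
squares sense, and fold `H_new` back into a tensor whose mode `k` has length `r`. -/
def coreStep (γ : ℕ) (S : SVDRoutine) {d n r mc : ℕ} (Φ : Fin d → Matrix (Fin mc) (Fin n) ℝ)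
    (Q : Fin d → Matrix (Fin n) (Fin r) ℝ) (k : Fin d) (T : Tensor (stageSides d r mc k)) :
    Timed (Tensor (stageSides d r mc (k + 1))) := do
  let P ← Timed.matMul (Φ k) (Q k)
  let H := (unfold k T).submatrix (Fin.cast (stageSides_self d r mc k).symm) id
  let Hnew ← Timed.solve γ S P H
  pure fun y => Hnew (Fin.cast (stageSides_succ_self d r mc k) (y k))
    fun j => Fin.cast (stageSides_succ_of_ne d r mc k j j.2) (y j)

/-- The first `k` iterations of core recovery, starting from the core measurements. -/
def coreLoop (γ : ℕ) (S : SVDRoutine) {d n r mc : ℕ} (Φ : Fin d → Matrix (Fin mc) (Fin n) ℝ)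
    (Q : Fin d → Matrix (Fin n) (Fin r) ℝ) (Bc : Tensor (fun _ : Fin d => mc)) :
    (k : ℕ) → k ≤ d → Timed (Tensor (stageSides d r mc k))
  | 0, _ => pure fun y => Bc fun i => Fin.cast (stageSides_zero d r mc i) (y i)
  | k + 1, hk => do
    let T ← coreLoop γ S Φ Q Bc k (Nat.le_of_succ_le hk)
    coreStep γ S Φ Q ⟨k, hk⟩ T

/-- One-pass HOSVD recovery from leave-one-out and core measurements. The input consists of the
measurements, the matrices applied to the uncompressed modes and the core measurement matrices; the
measured tensor itself is not accessed. -/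
def onePassRecovery (γ : ℕ) (S : SVDRoutine) {d n m mc : ℕ} (r : ℕ)
    (W : Fin d → ModeSensing n) (Φ : Fin d → Matrix (Fin mc) (Fin n) ℝ)
    (B : ∀ k : Fin d, Matrix (Fin n) (Cols (fun _ => m) k) ℝ) (Bc : Tensor (fun _ : Fin d => mc)) :
    Timed (TuckerFactors d n r) := do
  let Q ← Timed.forEach fun k => recoverFactor γ S r (W k) (B k)
  let H ← coreLoop γ S Φ Q Bc d le_rfl
  pure ⟨fun y => H fun i => Fin.cast (stageSides_last d r mc i).symm (y i), Q⟩

/-- The output of the recovery algorithm on the measurements of `X` taken with the ensemble whose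
raw random entries are `ω`. -/
def sketchAndRecover (γ : ℕ) (S : SVDRoutine) {d n m mc : ℕ} (r : ℕ) (W : Fin d → ModeSensing n)
    (ω : EnsembleIndex d n m mc → ℝ) (X : Tensor (fun _ : Fin d => n)) : TuckerFactors d n r :=
  (onePassRecovery γ S r W (ensembleΦ ω)
    (fun k => leaveOneOut k (W k).toMatrix (ensembleΩ ω k) X)
    (coreMeasurement (ensembleΦ ω) X)).val

/-! ## The sketching dimension and the measurement budget -/

/-- `C r d² ε⁻² ln(d nᵈ / δ)`. -/
def sketchBound (C : ℝ) (r d n : ℕ) (ε δ : ℝ) : ℝ :=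
  C * r * d ^ 2 / ε ^ 2 * Real.log (d * n ^ d / δ)

/-- `[n d + L] Lᵈ⁻¹` with `L = C r d² ε⁻² ln(d nᵈ / δ)`. -/
def measurementBudget (C : ℝ) (r d n : ℕ) (ε δ : ℝ) : ℝ :=
  (n * d + sketchBound C r d n ε δ) * sketchBound C r d n ε δ ^ (d - 1)

end

/-! The proof has a deterministic side, which finds out on how few vectors a sketch must be nearly
isometric, and a probabilistic side, which secures these vectors by a union bound.

Factors. Since `Ω_{(j,j)}` is inverted exactly, `Q_j` consists of leading left singular vectors of
`A Sᵀ`, where `A` is the mode-`j` unfolding of `X` and `S` the Kronecker product of the other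
sketches. Suppose that `S` preserves the inner products of the right singular vectors of `A` up to
`θ/√r`, and squared lengths in the span of the `r` leading ones up to a relative error `θ`. Then
projecting `A` onto the range of `Q_j` costs, in square, at most `(1+θ)/(1-5θ)` times the tail of
the squared singular values (`frobSq_sub_proj_le_of_gramErr`). By Eckart–Young this tail is at most
`opt_r²`, because unfoldings of Tucker tensors have rank at most `r`. There are at most `n` right
singular vectors, so order `n²` test vectors and a grid of `(32r+1)^r` points suffice. A Kronecker
sketch is applied mode by mode, each factor acting as a Johnson–Lindenstrauss map in the Frobenius
norm on a matrix independent of it. Distortions `θ/(2d)` in the modes compound to at most `θ`, and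
with `θ/√r` in place of `θ` this produces the dimension `r d²/ε²` times a logarithm.

Core. Given the factors, the output is `X` multiplied in each mode by the oblique projection `P_i =
Q_i (Φ_i Q_i)⁺ Φ_i`. Let `E` be the error of the orthogonal projection `Q_i Q_iᵀ` in all modes. Its
square is at most the sum of the `d` single-mode errors, hence at most `d(1+ε)/(1-ε) opt_r²`. As
`P_i` fixes the range of `Q_i`, the recovery error equals `E - E ×₁ P₁ ⋯ ×_d P_d`. When `P_k` is
applied, the factor `Q_k` and the tensor `E ×₁ P₁ ⋯ ×_{k-1} P_{k-1}` do not involve `Φ_k` and can be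
frozen, and then `P_k` expands the norm by at most `1 + ε/d` (`measure_core_bad_le`). The `d` steps
together give `e^ε`, and the triangle inequality gives `1 + e^ε`.

Time. Both sketching dimensions are `O(log n)`, so everything costs `n` times a power of `log n`,
except the decomposition of dense `n × n` matrices, which costs order `n³` and hence requires `d ≥
4`. -/

noncomputable section

/-! ## Independence on finite product spaces -/

theorem exists_eq_comp_restrict_of_dependsOn {ι : Type} {α : Type*} [MeasurableSpace α]
    {f : (ι → ℝ) → α} (hf : Measurable f) (S : Finset ι) (hS : DependsOn f (S : Set ι)) :
    ∃ g : (S → ℝ) → α, Measurable g ∧ ∀ ω, f ω = g fun i => ω i := by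
  classical
  -- Filling in 0 outside `S` is harmless: `f` does not read these coordinates.
  refine ⟨fun y => f fun i => if h : i ∈ S then y ⟨i, h⟩ else 0, ?_, fun ω => ?_⟩
  · refine hf.comp (measurable_pi_lambda _ fun i => ?_)
    by_cases h : i ∈ S
    · simpa [h] using measurable_pi_apply _
    · simp [h]
  · refine hS fun i hi => ?_
    have : i ∈ S := hi
    simp [this]

/-- Coordinates of a product measure are independent, so functions reading disjoint sets of them are
too. Every independence claim below reduces to checking which random entries a quantity reads. -/
theorem indepFun_of_dependsOn {ι : Type} [Fintype ι] (ν : ι → Measure ℝ)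
    [∀ i, IsProbabilityMeasure (ν i)] {α β : Type*} [MeasurableSpace α] [MeasurableSpace β]
    {f : (ι → ℝ) → α} {h : (ι → ℝ) → β} (hf : Measurable f) (hh : Measurable h) {S T : Set ι}
    (hS : DependsOn f S) (hT : DependsOn h T) (hST : Disjoint S T) :
    IndepFun f h (Measure.pi ν) := by
  classical
  obtain ⟨f', hf', hff'⟩ := exists_eq_comp_restrict_of_dependsOn hf S.toFinset (by simpa using hS)
  obtain ⟨h', hh', hhh'⟩ := exists_eq_comp_restrict_of_dependsOn hh T.toFinset (by simpa using hT)
  have hind : iIndepFun (fun i (ω : ι → ℝ) => ω i) (Measure.pi ν) :=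
    iIndepFun_pi (X := fun _ x => x) fun _ => aemeasurable_id
  have := hind.indepFun_finset S.toFinset T.toFinset (by simpa using hST)
    (fun i => measurable_pi_apply i)
  have := this.comp hf' hh'
  rwa [show f = f' ∘ fun ω (i : S.toFinset) => ω i from funext hff',
    show h = h' ∘ fun ω (i : T.toFinset) => ω i from funext hhh']

/-- If a bad event has probability at most `p` for every frozen value of `f`, it has probability at
most `p` for the random value of an `f` that depends on other coordinates. -/
theorem measure_bad_le_of_dependsOn {ι : Type} [Fintype ι] (ν : ι → Measure ℝ)
    [∀ i, IsProbabilityMeasure (ν i)] {α β : Type*} [MeasurableSpace α] [MeasurableSpace β]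
    {f : (ι → ℝ) → α} {h : (ι → ℝ) → β} (hf : Measurable f) (hh : Measurable h) {S T : Set ι}
    (hS : DependsOn f S) (hT : DependsOn h T) (hST : Disjoint S T) {B : Set (α × β)}
    (hB : MeasurableSet B) {p : ℝ≥0∞} (hp : ∀ a, Measure.pi ν {ω | (a, h ω) ∈ B} ≤ p) :
    Measure.pi ν {ω | (f ω, h ω) ∈ B} ≤ p := by
  have hind := indepFun_of_dependsOn ν hf hh hS hT hST
  rw [indepFun_iff_map_prod_eq_prod_map_map hf.aemeasurable hh.aemeasurable] at hind
  have h1 : Measure.pi ν {ω | (f ω, h ω) ∈ B} = Measure.map (fun ω => (f ω, h ω)) (Measure.pi ν) B :=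
    (Measure.map_apply (hf.prodMk hh) hB).symm
  have := Measure.isProbabilityMeasure_map hf.aemeasurable (μ := Measure.pi ν)
  rw [h1, hind, Measure.prod_apply hB]
  calc _ ≤ ∫⁻ _, p ∂(Measure.map f (Measure.pi ν)) := by
        refine lintegral_mono fun a => ?_
        rw [Measure.map_apply hh (measurable_prodMk_left hB)]
        exact hp a
    _ = p := by simp

/-- Induction: the product over `s` reads only the union of the `S b`, which is disjoint from `S a`.
It serves to multiply the moment generating functions of the rows of a random matrix. -/
theorem integral_prod_of_dependsOn {ι : Type} [Fintype ι] (ν : ι → Measure ℝ)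
    [∀ i, IsProbabilityMeasure (ν i)] {τ : Type} (s : Finset τ) (f : τ → (ι → ℝ) → ℝ)
    (hf : ∀ a, Measurable (f a)) (S : τ → Set ι) (hS : ∀ a, DependsOn (f a) (S a))
    (hd : Pairwise fun a b => Disjoint (S a) (S b)) (hint : ∀ a, Integrable (f a) (Measure.pi ν)) :
    Integrable (fun ω => ∏ a ∈ s, f a ω) (Measure.pi ν) ∧
      ∫ ω, ∏ a ∈ s, f a ω ∂(Measure.pi ν) = ∏ a ∈ s, ∫ ω, f a ω ∂(Measure.pi ν) := by
  classical
  induction s using Finset.induction_on with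
  | empty => simp
  | insert a s ha ih =>
    have hind : IndepFun (f a) (fun ω => ∏ b ∈ s, f b ω) (Measure.pi ν) := by
      refine indepFun_of_dependsOn ν (hf a) (Finset.measurable_prod _ fun b _ => hf b) (hS a)
        (T := ⋃ b ∈ s, S b) ?_ ?_
      · intro x y hxy
        refine Finset.prod_congr rfl fun b hb => hS b fun i hi => hxy i ?_
        simp only [Set.mem_iUnion]
        exact ⟨b, hb, hi⟩
      · simp only [Set.disjoint_iUnion_right]
        exact fun b hb => hd fun e => ha (e ▸ hb)
    simp only [Finset.prod_insert ha]
    refine ⟨hind.integrable_mul (hint a) ih.1, ?_⟩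
    rw [hind.integral_fun_mul_eq_mul_integral (hf a).aestronglyMeasurable ih.1.aestronglyMeasurable,
      ih.2]

/-! ## Moment generating function of the square of a sub-gaussian variable -/

/-- Linearize the square by an auxiliary standard normal `g`: `exp (l z²)` is the mean of `exp (a z
g)` when `a² = 2l`. After Tonelli the sub-gaussian bound applies for each fixed `g` and leaves `exp
(K l g²)`, integrable for small `l`. -/
theorem exists_lintegral_exp_sq_le (K : ℝ≥0) : ∃ l : ℝ, 0 < l ∧ ∃ M : ℝ, 0 ≤ M ∧
    ∀ {Ω : Type} [MeasurableSpace Ω] (μ : Measure Ω) [IsProbabilityMeasure μ] (Z : Ω → ℝ),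
      Measurable Z → HasSubgaussianMGF Z K μ →
      ∫⁻ ω, ENNReal.ofReal (Real.exp (l * Z ω ^ 2)) ∂μ ≤ ENNReal.ofReal M := by
  obtain ⟨C, hC, hint⟩ := IsGaussian.exists_integrable_exp_sq (gaussianReal 0 1)
  simp only [Real.norm_eq_abs, sq_abs] at hint
  have hK : (0 : ℝ) < K + 1 := by positivity
  -- `C` comes from Fernique's theorem. Dividing by `K + 1` gives `K l ≤ C` and also covers `K = 0`.
  refine ⟨C / (K + 1), by positivity, ∫ x, Real.exp (C * x ^ 2) ∂gaussianReal 0 1,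
    integral_nonneg fun x => (Real.exp_pos _).le, ?_⟩
  intro Ω _ μ _ Z hZ hsub
  set l := C / (K + 1) with hl
  have hl0 : 0 < l := by positivity
  set a := Real.sqrt (2 * l) with ha
  have ha2 : a ^ 2 = 2 * l := Real.sq_sqrt (by positivity)
  have h1 : ∀ z : ℝ, ENNReal.ofReal (Real.exp (l * z ^ 2))
      = ∫⁻ g, ENNReal.ofReal (Real.exp (a * z * g)) ∂gaussianReal 0 1 := by
    intro z
    rw [← ofReal_integral_eq_lintegral_ofReal (integrable_exp_mul_gaussianReal (a * z))
      (Filter.Eventually.of_forall fun _ => (Real.exp_pos _).le)]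
    have := congrFun (mgf_id_gaussianReal (μ := 0) (v := 1)) (a * z)
    simp only [mgf, id] at this
    rw [this]
    congr 2
    simp only [NNReal.coe_one, mul_pow, ha2]
    ring
  calc ∫⁻ ω, ENNReal.ofReal (Real.exp (l * Z ω ^ 2)) ∂μ
      = ∫⁻ ω, ∫⁻ g, ENNReal.ofReal (Real.exp (a * Z ω * g)) ∂gaussianReal 0 1 ∂μ := by
        simp_rw [h1]
    _ = ∫⁻ g, ∫⁻ ω, ENNReal.ofReal (Real.exp (a * Z ω * g)) ∂μ ∂gaussianReal 0 1 := by
        refine lintegral_lintegral_swap ?_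
        refine Measurable.aemeasurable ?_
        unfold Function.uncurry
        fun_prop
    _ ≤ ∫⁻ g, ENNReal.ofReal (Real.exp (C * g ^ 2)) ∂gaussianReal 0 1 := by
        refine lintegral_mono fun g => ?_
        have e : ∀ ω, a * Z ω * g = a * g * Z ω := fun ω => by ring
        simp_rw [e]
        rw [← ofReal_integral_eq_lintegral_ofReal (hsub.integrable_exp_mul (a * g))
          (Filter.Eventually.of_forall fun _ => (Real.exp_pos _).le)]
        refine ENNReal.ofReal_le_ofReal ((hsub.mgf_le (a * g)).trans (Real.exp_le_exp.2 ?_))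
        rw [mul_pow, ha2]
        have : (K : ℝ) * l ≤ C := by
          rw [hl, ← mul_div_assoc, div_le_iff₀ hK]
          nlinarith
        nlinarith [sq_nonneg g]
    _ = _ := by
        rw [← ofReal_integral_eq_lintegral_ofReal hint
          (Filter.Eventually.of_forall fun _ => (Real.exp_pos _).le)]

/-- Second-order Taylor remainder for both signs of `u`. For a centred variable the linear term
integrates to zero, and a bound quadratic in the parameter remains. -/
theorem exp_le_one_add_add_sq_mul_exp_abs (u : ℝ) :
    Real.exp u ≤ 1 + u + u ^ 2 * Real.exp |u| := by
  have h := Complex.norm_exp_sub_sum_le_norm_mul_exp (u : ℂ) 2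
  have e : Complex.exp u - ∑ m ∈ Finset.range 2, (u : ℂ) ^ m / (m.factorial : ℂ)
      = ((Real.exp u - (1 + u) : ℝ) : ℂ) := by
    simp [Finset.sum_range_succ]
  rw [e, Complex.norm_real, Complex.norm_real, Real.norm_eq_abs, Real.norm_eq_abs, sq_abs] at h
  linarith [le_abs_self (Real.exp u - (1 + u))]

/-- The square of a standardized sub-gaussian variable is sub-exponential. -/
theorem exists_integral_exp_sq_sub_one_le (K : ℝ≥0) : ∃ c : ℝ, 0 < c ∧ ∃ C : ℝ, 0 < C ∧
    ∀ {Ω : Type} [MeasurableSpace Ω] (μ : Measure Ω) [IsProbabilityMeasure μ] (Z : Ω → ℝ),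
      Measurable Z → HasSubgaussianMGF Z K μ → ∫ ω, Z ω ^ 2 ∂μ = 1 → ∀ s : ℝ, |s| ≤ c →
      Integrable (fun ω => Real.exp (s * (Z ω ^ 2 - 1))) μ ∧
        ∫ ω, Real.exp (s * (Z ω ^ 2 - 1)) ∂μ ≤ Real.exp (C * s ^ 2) := by
  obtain ⟨l, hl, M, hM, hmain⟩ := exists_lintegral_exp_sq_le K
  refine ⟨l / 2, by positivity, 8 / l ^ 2 * Real.exp l * M + 1, by positivity, ?_⟩
  intro Ω _ μ _ Z hZ hsub hvar s hs
  have hfin := hmain μ Z hZ hsub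
  have hI : Integrable (fun ω => Real.exp (l * Z ω ^ 2)) μ := by
    refine ⟨by fun_prop, ?_⟩
    rw [hasFiniteIntegral_iff_ofReal (Filter.Eventually.of_forall fun _ => (Real.exp_pos _).le)]
    exact hfin.trans_lt ENNReal.ofReal_lt_top
  have hIM : ∫ ω, Real.exp (l * Z ω ^ 2) ∂μ ≤ M := by
    rw [← ENNReal.ofReal_le_ofReal_iff hM, ofReal_integral_eq_lintegral_ofReal hI
      (Filter.Eventually.of_forall fun _ => (Real.exp_pos _).le)]
    exact hfin
  have hZ2 : Integrable (fun ω => Z ω ^ 2) μ := (hsub.memLp 2).integrable_sq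
  have hint : Integrable (fun ω => Real.exp (s * (Z ω ^ 2 - 1))) μ := by
    refine (hI.const_mul (Real.exp l)).mono' (by fun_prop) (Filter.Eventually.of_forall fun ω => ?_)
    rw [Real.norm_eq_abs, abs_of_pos (Real.exp_pos _), ← Real.exp_add]
    refine Real.exp_le_exp.2 ?_
    have := abs_le.1 hs
    nlinarith [sq_nonneg (Z ω)]
  refine ⟨hint, ?_⟩
  -- With `v = l/2 (Z² + 1)`, the quadratic factor is at most a multiple of `s² exp v`, and `exp |u|
  -- ≤ exp v` because `|s| ≤ l/2`. The product of the two exponentials is `exp l` times the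
  -- integrable `exp (l Z²)`.
  have hpt : ∀ ω, Real.exp (s * (Z ω ^ 2 - 1))
      ≤ 1 + s * (Z ω ^ 2 - 1) + s ^ 2 * (8 / l ^ 2 * Real.exp l) * Real.exp (l * Z ω ^ 2) := by
    intro ω
    refine (exp_le_one_add_add_sq_mul_exp_abs _).trans ?_
    have hu : |s * (Z ω ^ 2 - 1)| ≤ l / 2 * (Z ω ^ 2 + 1) := by
      rw [abs_mul]
      refine mul_le_mul hs ?_ (abs_nonneg _) (by positivity)
      rw [abs_le]
      constructor <;> nlinarith [sq_nonneg (Z ω)]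
    set v := l / 2 * (Z ω ^ 2 + 1) with hv
    have hv0 : 0 ≤ v := by positivity
    have hquad : v ^ 2 / 2 ≤ Real.exp v := by
      have := Real.quadratic_le_exp_of_nonneg hv0
      linarith
    have hsq : (s * (Z ω ^ 2 - 1)) ^ 2 ≤ s ^ 2 * (8 / l ^ 2 * Real.exp v) := by
      have h1 : (Z ω ^ 2 - 1) ^ 2 ≤ 8 / l ^ 2 * (v ^ 2 / 2) := by
        have : 8 / l ^ 2 * (v ^ 2 / 2) = (Z ω ^ 2 + 1) ^ 2 := by
          rw [hv]; field_simp; ring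
        rw [this]
        nlinarith [sq_nonneg (Z ω)]
      rw [mul_pow]
      refine mul_le_mul_of_nonneg_left (h1.trans ?_) (sq_nonneg s)
      exact mul_le_mul_of_nonneg_left hquad (by positivity)
    have hexp : Real.exp |s * (Z ω ^ 2 - 1)| ≤ Real.exp v := Real.exp_le_exp.2 hu
    have : (s * (Z ω ^ 2 - 1)) ^ 2 * Real.exp |s * (Z ω ^ 2 - 1)|
        ≤ s ^ 2 * (8 / l ^ 2 * Real.exp v) * Real.exp v :=
      mul_le_mul hsq hexp (Real.exp_pos _).le (by positivity)
    have hvv : Real.exp v * Real.exp v = Real.exp l * Real.exp (l * Z ω ^ 2) := by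
      rw [← Real.exp_add, ← Real.exp_add]; congr 1; rw [hv]; ring
    calc _ ≤ 1 + s * (Z ω ^ 2 - 1) + s ^ 2 * (8 / l ^ 2 * Real.exp v) * Real.exp v := by linarith
      _ = 1 + s * (Z ω ^ 2 - 1) + s ^ 2 * (8 / l ^ 2) * (Real.exp v * Real.exp v) := by ring
      _ = _ := by rw [hvv]; ring
  have hlin : Integrable (fun ω => s * (Z ω ^ 2 - 1)) μ := (hZ2.sub (integrable_const 1)).const_mul s
  have hlin1 : Integrable (fun ω => 1 + s * (Z ω ^ 2 - 1)) μ := (integrable_const 1).add hlin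
  have hq := hI.const_mul (s ^ 2 * (8 / l ^ 2 * Real.exp l))
  -- The term linear in `s` drops out because the second moment is 1.
  calc ∫ ω, Real.exp (s * (Z ω ^ 2 - 1)) ∂μ
      ≤ ∫ ω, (1 + s * (Z ω ^ 2 - 1)
          + s ^ 2 * (8 / l ^ 2 * Real.exp l) * Real.exp (l * Z ω ^ 2)) ∂μ :=
        integral_mono hint (hlin1.add hq) hpt
    _ = 1 + s ^ 2 * (8 / l ^ 2 * Real.exp l) * ∫ ω, Real.exp (l * Z ω ^ 2) ∂μ := by
        rw [integral_add hlin1 hq, integral_add (integrable_const 1) hlin, integral_const_mul,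
          integral_const_mul, integral_sub hZ2 (integrable_const 1), hvar]
        simp
    _ ≤ 1 + s ^ 2 * (8 / l ^ 2 * Real.exp l) * M := by
        have : 0 ≤ s ^ 2 * (8 / l ^ 2 * Real.exp l) := by positivity
        have := mul_le_mul_of_nonneg_left hIM this
        linarith
    _ ≤ (8 / l ^ 2 * Real.exp l * M + 1) * s ^ 2 + 1 := by nlinarith [sq_nonneg s]
    _ ≤ _ := Real.add_one_le_exp _


/-! ## The squared Frobenius norm -/

/-- The squared Frobenius norm. -/
def frobSq {ι κ : Type} [Fintype ι] [Fintype κ] (A : Matrix ι κ ℝ) : ℝ := ∑ i, ∑ j, A i j ^ 2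

section frobSq

variable {ι κ τ : Type} [Fintype ι] [Fintype κ] [Fintype τ]

theorem frobSq_nonneg (A : Matrix ι κ ℝ) : 0 ≤ frobSq A :=
  Finset.sum_nonneg fun _ _ => Finset.sum_nonneg fun _ _ => sq_nonneg _

theorem frobSq_transpose (A : Matrix ι κ ℝ) : frobSq Aᵀ = frobSq A := by
  simp only [frobSq, Matrix.transpose_apply]
  exact Finset.sum_comm

theorem frobSq_eq_trace (A : Matrix ι κ ℝ) : frobSq A = (A * Aᵀ).trace := by
  simp [frobSq, Matrix.trace, Matrix.mul_apply, sq]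

theorem frobSq_eq_zero {A : Matrix ι κ ℝ} : frobSq A = 0 ↔ A = 0 := by
  constructor
  · intro h
    ext i j
    have h1 := (Finset.sum_eq_zero_iff_of_nonneg
      (fun i _ => Finset.sum_nonneg fun j _ => sq_nonneg (A i j))).1 h i (Finset.mem_univ i)
    have h2 := (Finset.sum_eq_zero_iff_of_nonneg (fun j _ => sq_nonneg (A i j))).1 h1 j
      (Finset.mem_univ j)
    simpa using h2
  · rintro rfl
    simp [frobSq]

theorem frobSq_submatrix {ι' κ' : Type} [Fintype ι'] [Fintype κ'] (A : Matrix ι κ ℝ) (e : ι' ≃ ι)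
    (f : κ' ≃ κ) : frobSq (A.submatrix e f) = frobSq A := by
  simp only [frobSq, Matrix.submatrix_apply]
  rw [← e.sum_comp]
  exact Finset.sum_congr rfl fun i _ => f.sum_comp fun j => A (e i) j ^ 2

end frobSq

/-! ## The Johnson–Lindenstrauss property of one sub-gaussian matrix -/

/-- The `m × n` matrix that reads its entries from the coordinates `e (a, b)`, divided by `√m`. -/
def coordMatrix {I : Type} {m n : ℕ} (e : Fin m × Fin n → I) (ω : I → ℝ) :
    Matrix (Fin m) (Fin n) ℝ :=
  fun a b => ω (e (a, b)) / Real.sqrt m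

section JL

variable {I : Type} [Fintype I] (ν : I → Measure ℝ) [∀ i, IsProbabilityMeasure (ν i)]

theorem integral_coord {f : ℝ → ℝ} (hf : Measurable f) (i : I) :
    ∫ ω, f (ω i) ∂(Measure.pi ν) = ∫ x, f x ∂(ν i) := by
  have := (measurePreserving_eval ν i)
  rw [← this.map_eq, integral_map this.measurable.aemeasurable hf.aestronglyMeasurable]

variable {K : ℝ≥0} (hν : ∀ i, IsStdSubgaussian K (ν i)) {n : ℕ} {e : Fin n → I}
  (he : Function.Injective e) {y : Fin n → ℝ} (hy : ∑ b, y b ^ 2 = 1)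

include hν in
theorem hasSubgaussianMGF_coord (i : I) :
    HasSubgaussianMGF (fun ω : I → ℝ => ω i) K (Measure.pi ν) := by
  have h := (measurePreserving_eval ν i)
  have h2 := (hν i).subgaussian
  rw [← h.map_eq] at h2
  exact HasSubgaussianMGF.of_map h.measurable.aemeasurable h2

include he in
theorem iIndepFun_coord_mul :
    iIndepFun (fun b (ω : I → ℝ) => y b * ω (e b)) (Measure.pi ν) := by
  have hind : iIndepFun (fun i (ω : I → ℝ) => ω i) (Measure.pi ν) :=
    iIndepFun_pi (X := fun _ x => x) fun _ => aemeasurable_id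
  exact (hind.precomp he).comp (fun b x => y b * x) fun b => measurable_const_mul _

include hν he hy in
-- The parameters of independent summands add with weights `y b ^ 2`, which sum to 1, so `K` does
-- not deteriorate with `n`.
theorem hasSubgaussianMGF_linearForm :
    HasSubgaussianMGF (fun ω : I → ℝ => ∑ b, y b * ω (e b)) K (Measure.pi ν) := by
  have h := HasSubgaussianMGF.sum_of_iIndepFun (iIndepFun_coord_mul ν he (y := y))
    (s := Finset.univ) fun b _ => (hasSubgaussianMGF_coord ν hν (e b)).const_mul (y b)
  convert h
  ext
  rw [NNReal.coe_sum]
  calc (K : ℝ) = ∑ b, y b ^ 2 * K := by rw [← Finset.sum_mul, hy, one_mul]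
    _ = _ := Finset.sum_congr rfl fun b _ => rfl

include hν he hy in
-- The second moment is the variance of a sum of independent centred variables. A row applied to a
-- unit vector is thus again standardized sub-gaussian.
theorem integral_linearForm_sq :
    ∫ ω, (∑ b, y b * ω (e b)) ^ 2 ∂(Measure.pi ν) = 1 := by
  have hmem : ∀ i, MemLp (fun ω : I → ℝ => ω i) 2 (Measure.pi ν) :=
    fun i => by exact_mod_cast (hasSubgaussianMGF_coord ν hν i).memLp 2
  have hmem' : ∀ b, MemLp (fun ω : I → ℝ => y b * ω (e b)) 2 (Measure.pi ν) :=
    fun b => (hmem (e b)).const_mul (y b)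
  have hmean : ∀ i, ∫ ω, ω i ∂(Measure.pi ν) = 0 := fun i =>
    (integral_coord ν measurable_id i).trans (hν i).mean_zero
  have hsq : ∀ i, ∫ ω, ω i ^ 2 ∂(Measure.pi ν) = 1 := fun i =>
    (integral_coord ν (f := fun x => x ^ 2) (by fun_prop) i).trans (hν i).var_one
  have hvar := IndepFun.variance_sum (X := fun b (ω : I → ℝ) => y b * ω (e b))
    (s := Finset.univ) (fun b _ => hmem' b)
    (fun b _ b' _ hb => (iIndepFun_coord_mul ν he (y := y)).indepFun hb)
  have hm0 : ∀ b, ∫ ω, y b * ω (e b) ∂(Measure.pi ν) = 0 := fun b => by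
    rw [integral_const_mul, hmean, mul_zero]
  have e1 : ∀ b, Var[fun ω : I → ℝ => y b * ω (e b); Measure.pi ν] = y b ^ 2 := fun b => by
    rw [variance_of_integral_eq_zero (hmem' b).aemeasurable (hm0 b)]
    simp only [mul_pow]
    rw [integral_const_mul, hsq, mul_one]
  simp only [e1, hy] at hvar
  rw [variance_of_integral_eq_zero] at hvar
  · rw [← hvar]
    refine integral_congr_ae (Filter.Eventually.of_forall fun ω => ?_)
    simp [Finset.sum_apply]
  · exact (memLp_finsetSum' _ fun b _ => hmem' b).aemeasurable
  · simp only [Finset.sum_apply]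
    rw [integral_finsetSum _ fun b _ => (hmem' b).integrable (by norm_num)]
    simp [hm0]

end JL

/-- The rows read disjoint entries, so the sub-exponential bound for one row is raised to the power
`m`. -/
theorem exists_mgf_rows_le (K : ℝ≥0) : ∃ c : ℝ, 0 < c ∧ ∃ C : ℝ, 0 < C ∧
    ∀ {I : Type} [Fintype I] (ν : I → Measure ℝ) [∀ i, IsProbabilityMeasure (ν i)],
      (∀ i, IsStdSubgaussian K (ν i)) → ∀ {m n : ℕ} {e : Fin m × Fin n → I},
      Function.Injective e → ∀ {y : Fin n → ℝ}, ∑ b, y b ^ 2 = 1 → ∀ s : ℝ, |s| ≤ c →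
      Integrable (fun ω => Real.exp (s * ∑ a, ((∑ b, y b * ω (e (a, b))) ^ 2 - 1)))
        (Measure.pi ν) ∧
      ∫ ω, Real.exp (s * ∑ a, ((∑ b, y b * ω (e (a, b))) ^ 2 - 1)) ∂(Measure.pi ν)
        ≤ Real.exp (m * (C * s ^ 2)) := by
  obtain ⟨c, hc, C, hC, h⟩ := exists_integral_exp_sq_sub_one_le K
  refine ⟨c, hc, C, hC, ?_⟩
  intro I _ ν _ hν m n e he y hy s hs
  have hinj : ∀ a : Fin m, Function.Injective fun b => e (a, b) := fun a b b' hb => by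
    simpa using he hb
  have hone := fun a => h (Measure.pi ν) (fun ω => ∑ b, y b * ω (e (a, b))) (by fun_prop)
    (hasSubgaussianMGF_linearForm ν hν (hinj a) hy) (integral_linearForm_sq ν hν (hinj a) hy) s hs
  have hprod := integral_prod_of_dependsOn ν Finset.univ
    (fun (a : Fin m) ω => Real.exp (s * ((∑ b, y b * ω (e (a, b))) ^ 2 - 1)))
    (fun a => by fun_prop) (fun a => Set.range fun b => e (a, b))
    (fun a x x' hx => by
      have : ∀ b, x (e (a, b)) = x' (e (a, b)) := fun b => hx _ ⟨b, rfl⟩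
      simp only [this])
    (fun a a' ha => by
      refine Set.disjoint_left.2 ?_
      rintro _ ⟨b, rfl⟩ ⟨b', hb'⟩
      exact ha (by simpa using (congrArg Prod.fst (he hb')).symm))
    (fun a => (hone a).1)
  simp only [← Real.exp_sum, ← Finset.mul_sum] at hprod
  refine ⟨hprod.1, hprod.2.le.trans ?_⟩
  calc _ ≤ ∏ _a : Fin m, Real.exp (C * s ^ 2) :=
        Finset.prod_le_prod (fun a _ => integral_nonneg fun _ => (Real.exp_pos _).le)
          fun a _ => (hone a).2
    _ = _ := by rw [Finset.prod_const, Finset.card_univ, Fintype.card_fin, ← Real.exp_nat_mul]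

/-- The same bound for a convex combination of columns, by Jensen's inequality. -/
theorem exists_mgf_columns_le (K : ℝ≥0) : ∃ c : ℝ, 0 < c ∧ ∃ C : ℝ, 0 < C ∧
    ∀ {I : Type} [Fintype I] (ν : I → Measure ℝ) [∀ i, IsProbabilityMeasure (ν i)],
      (∀ i, IsStdSubgaussian K (ν i)) → ∀ {m n : ℕ} {e : Fin m × Fin n → I},
      Function.Injective e → ∀ {κ : Type} (t : Finset κ) (w : κ → ℝ) (y : Fin n → κ → ℝ),
      (∀ k ∈ t, 0 ≤ w k) → ∑ k ∈ t, w k = 1 → (∀ k ∈ t, ∑ b, y b k ^ 2 = 1) →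
      ∀ s : ℝ, |s| ≤ c →
      Integrable (fun ω => Real.exp (s * ∑ k ∈ t, w k *
        ∑ a, ((∑ b, y b k * ω (e (a, b))) ^ 2 - 1))) (Measure.pi ν) ∧
      mgf (fun ω => ∑ k ∈ t, w k * ∑ a, ((∑ b, y b k * ω (e (a, b))) ^ 2 - 1)) (Measure.pi ν) s
        ≤ Real.exp (m * (C * s ^ 2)) := by
  obtain ⟨c, hc, C, hC, h⟩ := exists_mgf_rows_le K
  refine ⟨c, hc, C, hC, ?_⟩
  intro I _ ν _ hν m n e he κ t w y hw hw1 hy s hs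
  -- The columns share the random rows and are dependent. Convexity of `exp` replaces them by an
  -- average, so their number never enters.
  have hpt : ∀ ω : I → ℝ, Real.exp (s * ∑ k ∈ t, w k * ∑ a, ((∑ b, y b k * ω (e (a, b))) ^ 2 - 1))
      ≤ ∑ k ∈ t, w k * Real.exp (s * ∑ a, ((∑ b, y b k * ω (e (a, b))) ^ 2 - 1)) := by
    intro ω
    have := convexOn_exp.map_sum_le hw hw1
      (p := fun k => s * ∑ a, ((∑ b, y b k * ω (e (a, b))) ^ 2 - 1)) (fun _ _ => Set.mem_univ _)
    simp only [smul_eq_mul] at this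
    refine le_of_eq_of_le (congrArg Real.exp ?_) this
    rw [Finset.mul_sum]
    exact Finset.sum_congr rfl fun k _ => by ring
  have hI : Integrable (fun ω : I → ℝ =>
      ∑ k ∈ t, w k * Real.exp (s * ∑ a, ((∑ b, y b k * ω (e (a, b))) ^ 2 - 1))) (Measure.pi ν) :=
    integrable_finsetSum _ fun k hk => (h ν hν he (hy k hk) s hs).1.const_mul _
  have hI' : Integrable (fun ω => Real.exp (s * ∑ k ∈ t, w k *
        ∑ a, ((∑ b, y b k * ω (e (a, b))) ^ 2 - 1))) (Measure.pi ν) := by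
    refine hI.mono' (Measurable.aestronglyMeasurable (by fun_prop)) ?_
    exact Filter.Eventually.of_forall fun ω => by
      rw [Real.norm_eq_abs, abs_of_pos (Real.exp_pos _)]; exact hpt ω
  refine ⟨hI', (integral_mono hI' hI hpt).trans ?_⟩
  rw [integral_finsetSum _ fun k hk => (h ν hν he (hy k hk) s hs).1.const_mul _]
  calc _ ≤ ∑ k ∈ t, w k * Real.exp (m * (C * s ^ 2)) := by
        refine Finset.sum_le_sum fun k hk => ?_
        rw [integral_const_mul]
        exact mul_le_mul_of_nonneg_left (h ν hν he (hy k hk) s hs).2 (hw k hk)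
    _ = _ := by rw [← Finset.sum_mul, hw1, one_mul]

/-- **Johnson–Lindenstrauss** for a matrix with independent standardized sub-gaussian entries. -/
theorem exists_measure_frobSq_distortion_le (K : ℝ≥0) : ∃ c : ℝ, 0 < c ∧
    ∀ {I : Type} [Fintype I] (ν : I → Measure ℝ) [∀ i, IsProbabilityMeasure (ν i)],
      (∀ i, IsStdSubgaussian K (ν i)) → ∀ {m n : ℕ} {e : Fin m × Fin n → I}, 0 < m →
      Function.Injective e → ∀ {κ : Type} [Fintype κ] (Y : Matrix (Fin n) κ ℝ) (η : ℝ),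
      0 < η → η ≤ 1 →
      Measure.pi ν {ω | η * frobSq Y < |frobSq (coordMatrix e ω * Y) - frobSq Y|}
        ≤ ENNReal.ofReal (2 * Real.exp (-(c * m * η ^ 2))) := by
  obtain ⟨c, hc, C, hC, h⟩ := exists_mgf_columns_le K
  -- The Chernoff parameter will be `s₀ η`. The first entry keeps it in the range of the mgf bound,
  -- and the second makes `C s²` at most half of the gain `s η`.
  set s₀ := min c (1 / (2 * C)) with hs₀
  have hs₀pos : 0 < s₀ := lt_min hc (by positivity)
  have hs₀C : C * s₀ ≤ 1 / 2 := by
    have : s₀ ≤ 1 / (2 * C) := min_le_right _ _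
    calc C * s₀ ≤ C * (1 / (2 * C)) := by gcongr
      _ = 1 / 2 := by field_simp
  refine ⟨s₀ / 2, by positivity, ?_⟩
  intro I _ ν _ hν m n e hm he κ _ Y η hη hη1
  classical
  have hm' : (0 : ℝ) < m := by exact_mod_cast hm
  rcases (frobSq_nonneg Y).eq_or_lt with h0 | hpos
  · have : Y = 0 := frobSq_eq_zero.1 h0.symm
    subst this
    simp [frobSq]
  set q : κ → ℝ := fun k => ∑ b, Y b k ^ 2 with hq
  have hq0 : ∀ k, 0 ≤ q k := fun k => Finset.sum_nonneg fun _ _ => sq_nonneg _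
  have hqsum : ∑ k, q k = frobSq Y := Finset.sum_comm
  -- Columns are normalized and weighted by their share of the squared norm; zero columns cannot be
  -- normalized, and contribute nothing.
  set t := Finset.univ.filter fun k => q k ≠ 0 with ht
  set w : κ → ℝ := fun k => q k / frobSq Y with hw
  set y : Fin n → κ → ℝ := fun b k => Y b k / Real.sqrt (q k) with hy
  have htsum : ∑ k ∈ t, q k = frobSq Y := by
    rw [← hqsum, ht]; exact Finset.sum_filter_ne_zero _
  have hwsum : ∑ k ∈ t, w k = 1 := by
    rw [hw, ← Finset.sum_div, htsum, div_self hpos.ne']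
  have hynorm : ∀ k ∈ t, ∑ b, y b k ^ 2 = 1 := by
    intro k hk
    have hk : q k ≠ 0 := (Finset.mem_filter.1 hk).2
    simp only [hy, div_pow, Real.sq_sqrt (hq0 k)]
    rw [← Finset.sum_div]
    exact div_self hk
  set V : (I → ℝ) → ℝ := fun ω =>
    ∑ k ∈ t, w k * ∑ a, ((∑ b, y b k * ω (e (a, b))) ^ 2 - 1) with hV
  have hVeq : ∀ ω, frobSq (coordMatrix e ω * Y) - frobSq Y = frobSq Y / m * V ω := by
    intro ω
    have h1 : frobSq (coordMatrix e ω * Y) = ∑ k ∈ t, ∑ a, (∑ b, Y b k * ω (e (a, b))) ^ 2 / m := by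
      have : frobSq (coordMatrix e ω * Y) = ∑ k, ∑ a, (∑ b, Y b k * ω (e (a, b))) ^ 2 / m := by
        rw [← frobSq_transpose]
        refine Finset.sum_congr rfl fun k _ => Finset.sum_congr rfl fun a _ => ?_
        simp only [Matrix.transpose_apply, Matrix.mul_apply, coordMatrix]
        have : ∀ b, ω (e (a, b)) / Real.sqrt m * Y b k = Y b k * ω (e (a, b)) / Real.sqrt m :=
          fun b => by ring
        simp only [this]
        rw [← Finset.sum_div, div_pow, Real.sq_sqrt hm'.le]
      rw [this]
      symm
      refine Finset.sum_subset (Finset.subset_univ _) fun k _ hk => ?_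
      have hk : q k = 0 := by simpa [ht] using hk
      have hz : ∀ b, Y b k = 0 := fun b => by
        have := (Finset.sum_eq_zero_iff_of_nonneg (fun b _ => sq_nonneg (Y b k))).1 hk b
          (Finset.mem_univ b)
        simpa using this
      simp [hz]
    rw [h1, hV]
    simp only
    rw [← htsum, ← Finset.sum_sub_distrib, htsum, Finset.mul_sum]
    refine Finset.sum_congr rfl fun k hk => ?_
    have hk0 : q k ≠ 0 := (Finset.mem_filter.1 hk).2
    have h2 : ∀ a, (∑ b, y b k * ω (e (a, b))) ^ 2 = (∑ b, Y b k * ω (e (a, b))) ^ 2 / q k := by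
      intro a
      have : ∀ b, y b k * ω (e (a, b)) = Y b k * ω (e (a, b)) / Real.sqrt (q k) := fun b => by
        simp only [hy]; ring
      simp only [this]
      rw [← Finset.sum_div, div_pow, Real.sq_sqrt (hq0 k)]
    simp only [h2, Finset.sum_sub_distrib, ← Finset.sum_div]
    simp only [hw, Finset.sum_const, Finset.card_univ, Fintype.card_fin, nsmul_eq_mul, mul_one]
    field_simp
  set s := s₀ * η with hs
  have hspos : 0 < s := by positivity
  have hsc : |s| ≤ c := by
    rw [abs_of_pos hspos]
    calc s₀ * η ≤ s₀ * 1 := by gcongr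
      _ ≤ c := by rw [mul_one]; exact min_le_left _ _
  have hsc' : |-s| ≤ c := by rwa [abs_neg]
  have hw0 : ∀ k ∈ t, 0 ≤ w k := fun k _ => div_nonneg (hq0 k) hpos.le
  obtain ⟨i1, b1⟩ := h ν hν he t w y hw0 hwsum hynorm s hsc
  obtain ⟨i2, b2⟩ := h ν hν he t w y hw0 hwsum hynorm (-s) hsc'
  have hfin : ∀ u : ℝ, u = Real.exp (m * (C * s ^ 2)) →
      Real.exp (-s * (m * η)) * u ≤ Real.exp (-(s₀ / 2 * m * η ^ 2)) := by
    rintro u rfl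
    rw [← Real.exp_add]
    refine Real.exp_le_exp.2 ?_
    rw [hs]
    have : (m : ℝ) * (s₀ * η ^ 2) * (C * s₀) ≤ m * (s₀ * η ^ 2) * (1 / 2) := by gcongr
    nlinarith
  have t1 : (Measure.pi ν).real {ω | m * η ≤ V ω} ≤ Real.exp (-(s₀ / 2 * m * η ^ 2)) :=
    (measure_ge_le_exp_mul_mgf (m * η) hspos.le i1).trans
      ((mul_le_mul_of_nonneg_left b1 (Real.exp_pos _).le).trans (hfin _ rfl))
  have t2 : (Measure.pi ν).real {ω | V ω ≤ -(m * η)} ≤ Real.exp (-(s₀ / 2 * m * η ^ 2)) := by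
    have := measure_le_le_exp_mul_mgf (-(m * η)) (neg_nonpos.2 hspos.le) i2
    refine this.trans ((mul_le_mul_of_nonneg_left b2 (Real.exp_pos _).le).trans ?_)
    rw [show - -s * -(↑m * η) = -s * (m * η) by ring, neg_sq]
    exact hfin _ rfl
  have hsub : {ω | η * frobSq Y < |frobSq (coordMatrix e ω * Y) - frobSq Y|}
      ⊆ {ω | m * η ≤ V ω} ∪ {ω | V ω ≤ -(m * η)} := by
    intro ω hω
    simp only [Set.mem_ofPred_eq, hVeq, abs_mul, abs_of_pos (div_pos hpos hm')] at hω
    have hlt : m * η < |V ω| := by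
      have : frobSq Y / m * (m * η) < frobSq Y / m * |V ω| := by
        calc _ = η * frobSq Y := by field_simp
          _ < _ := hω
      exact lt_of_mul_lt_mul_left this (div_pos hpos hm').le
    rcases lt_abs.1 hlt with h | h
    · exact Or.inl h.le
    · exact Or.inr (by simp only [Set.mem_ofPred_eq]; linarith)
  refine (measure_mono hsub).trans ((measure_union_le _ _).trans ?_)
  rw [two_mul, ENNReal.ofReal_add (Real.exp_pos _).le (Real.exp_pos _).le]
  refine add_le_add ?_ ?_
  · rw [← ofReal_measureReal]; exact ENNReal.ofReal_le_ofReal t1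
  · rw [← ofReal_measureReal]; exact ENNReal.ofReal_le_ofReal t2


/-! ## Kronecker products of Johnson–Lindenstrauss matrices -/

/-- The Kronecker product of a family of `m × n` matrices. -/
def kron {ι : Type} [Fintype ι] {m n : ℕ} (W : ι → Matrix (Fin m) (Fin n) ℝ) :
    Matrix (ι → Fin m) (ι → Fin n) ℝ :=
  fun c c' => ∏ j, W j (c j) (c' j)

/-- Allows the modes to be numbered by `Fin k`, so that induction on the number of factors is
possible. -/
theorem frobSq_kron_mul_reindex {ι ι' κ : Type} [Fintype ι] [Fintype ι'] [Fintype κ]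
    [DecidableEq ι] [DecidableEq ι'] {m n : ℕ} (e : ι' ≃ ι) (W : ι → Matrix (Fin m) (Fin n) ℝ)
    (Y : Matrix (ι → Fin n) κ ℝ) :
    frobSq (kron (fun j => W (e j)) * Y.submatrix (e.arrowCongr (Equiv.refl (Fin n))) id)
      = frobSq (kron W * Y) := by
  have hk : kron (fun j => W (e j)) = (kron W).submatrix (e.arrowCongr (Equiv.refl (Fin m)))
      (e.arrowCongr (Equiv.refl (Fin n))) := by
    ext c c'
    simp only [kron, Matrix.submatrix_apply, Equiv.arrowCongr_apply, Equiv.coe_refl,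
      Function.comp_apply, id]
    rw [← e.prod_comp]
    simp
  rw [hk, Matrix.submatrix_mul_equiv]
  exact frobSq_submatrix _ _ (Equiv.refl κ)

/-- The factors after the first act with the index of mode 0 moved to the columns. `W 0` then
multiplies the result, whose columns carry all the remaining indices, so one factor is always a
plain matrix product. -/
theorem frobSq_kron_succ {k m n : ℕ} {κ : Type} [Fintype κ]
    (W : Fin (k + 1) → Matrix (Fin m) (Fin n) ℝ) (Y : Matrix (Fin (k + 1) → Fin n) κ ℝ) :
    frobSq (kron W * Y) = frobSq (W 0 * Matrix.of fun (a : Fin n) (cu : (Fin k → Fin m) × κ) =>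
      (kron (fun j : Fin k => W j.succ) * Matrix.of fun c (au : Fin n × κ) =>
        Y (Fin.cons au.1 c) au.2) cu.1 (a, cu.2)) := by
  have h1 : ∀ (i : Fin m) (c : Fin k → Fin m) (u : κ),
      (kron W * Y) (Fin.cons i c) u = ∑ a, W 0 i a *
        ∑ c', (∏ j : Fin k, W j.succ (c j) (c' j)) * Y (Fin.cons a c') u := by
    intro i c u
    simp only [Matrix.mul_apply, kron, Finset.mul_sum]
    rw [← (Fin.consEquiv fun _ => Fin n).sum_comp, Fintype.sum_prod_type]
    refine Finset.sum_congr rfl fun a _ => Finset.sum_congr rfl fun c' _ => ?_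
    simp only [Fin.consEquiv, Equiv.coe_fn_mk, Fin.prod_univ_succ, Fin.cons_zero, Fin.cons_succ]
    ring
  simp only [frobSq]
  rw [← (Fin.consEquiv fun _ => Fin m).sum_comp, Fintype.sum_prod_type]
  refine Finset.sum_congr rfl fun i _ => ?_
  rw [Fintype.sum_prod_type]
  refine Finset.sum_congr rfl fun c _ => Finset.sum_congr rfl fun u _ => ?_
  simp only [Fin.consEquiv, Equiv.coe_fn_mk, h1]
  simp [Matrix.mul_apply, kron]

theorem measurableSet_frobSq_distortion {m n : ℕ} {κ : Type} [Fintype κ] (η : ℝ) :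
    MeasurableSet {q : (Fin n → κ → ℝ) × (Fin m → Fin n → ℝ) |
      η * frobSq (Matrix.of q.1) < |frobSq (Matrix.of q.2 * Matrix.of q.1)
        - frobSq (Matrix.of q.1)|} := by
  refine measurableSet_lt ?_ ?_
  · unfold frobSq
    simp only [Matrix.of_apply]
    fun_prop
  · unfold frobSq
    simp only [Matrix.mul_apply, Matrix.of_apply]
    fun_prop

section

variable {I : Type} [Fintype I] (ν : I → Measure ℝ) [∀ i, IsProbabilityMeasure (ν i)]

/-- Induction on the number of factors. The matrix sketched by all factors but the first is
independent of `W 0`, so it may be frozen and the property of `W 0` applied to it. Distortions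
multiply and failure probabilities add. The growing number of columns costs nothing, since `_hJL` is
uniform in it. -/
theorem measure_frobSq_kron_distortion_le_pow {m n : ℕ} {η : ℝ} (hη0 : 0 ≤ η) (hη1 : η ≤ 1)
    {p : ℝ≥0∞} : ∀ (k : ℕ) (W : Fin k → (I → ℝ) → Matrix (Fin m) (Fin n) ℝ)
      (_hmeas : ∀ j a b, Measurable fun ω => W j ω a b) (S : Fin k → Set I)
      (_hS : ∀ j, DependsOn (W j) (S j)) (_hd : Pairwise fun i j => Disjoint (S i) (S j))
      (_hJL : ∀ j, ∀ {κ : Type} [Fintype κ] (Y : Matrix (Fin n) κ ℝ),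
        Measure.pi ν {ω | η * frobSq Y < |frobSq (W j ω * Y) - frobSq Y|} ≤ p)
      {κ : Type} [Fintype κ] (Y : Matrix (Fin k → Fin n) κ ℝ),
      Measure.pi ν {ω | ¬((1 - η) ^ k * frobSq Y ≤ frobSq (kron (fun j => W j ω) * Y) ∧
        frobSq (kron (fun j => W j ω) * Y) ≤ (1 + η) ^ k * frobSq Y)} ≤ k * p := by
  intro k
  induction k with
  | zero =>
    intro W _ S _ _ _ κ _ Y
    have : ∀ ω, frobSq (kron (fun j => W j ω) * Y) = frobSq Y := by
      intro ω
      simp only [frobSq, Fintype.sum_unique]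
      refine Finset.sum_congr rfl fun u _ => ?_
      rw [Matrix.mul_apply, Fintype.sum_unique]
      simp [kron]
    simp [this]
  | succ k ih =>
    intro W hmeas S hS hd hJL κ _ Y
    set Y₁ : Matrix (Fin k → Fin n) (Fin n × κ) ℝ :=
      Matrix.of fun c au => Y (Fin.cons au.1 c) au.2 with hY₁
    set G : (I → ℝ) → Fin n → (Fin k → Fin m) × κ → ℝ := fun ω a cu =>
      (kron (fun j : Fin k => W j.succ ω) * Y₁) cu.1 (a, cu.2) with hG
    have hfY : frobSq Y₁ = frobSq Y := by
      simp only [frobSq]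
      rw [← (Fin.consEquiv fun _ => Fin n).sum_comp, Fintype.sum_prod_type, Finset.sum_comm]
      rw [Fintype.sum_prod_type]
      refine Finset.sum_congr rfl fun a _ => ?_
      rw [Finset.sum_comm]
      rfl
    have hfG : ∀ ω, frobSq (Matrix.of (G ω)) = frobSq (kron (fun j : Fin k => W j.succ ω) * Y₁) := by
      intro ω
      simp only [frobSq, Fintype.sum_prod_type, hG, Matrix.of_apply]
      exact Finset.sum_comm
    have hf : ∀ ω, frobSq (kron (fun j => W j ω) * Y) = frobSq (W 0 ω * Matrix.of (G ω)) :=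
      fun ω => frobSq_kron_succ (fun j => W j ω) Y
    have h1 := ih (fun j => W j.succ) (fun j => hmeas j.succ) (fun j => S j.succ)
      (fun j => hS j.succ) (fun i j hij => hd fun e => hij (Fin.succ_injective _ e))
      (fun j => hJL j.succ) Y₁
    have h2 : Measure.pi ν {ω | (G ω, fun a b => W 0 ω a b) ∈
        {q : (Fin n → (Fin k → Fin m) × κ → ℝ) × (Fin m → Fin n → ℝ) |
        η * frobSq (Matrix.of q.1) < |frobSq (Matrix.of q.2 * Matrix.of q.1)
          - frobSq (Matrix.of q.1)|}} ≤ p := by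
      refine measure_bad_le_of_dependsOn ν (f := G) (h := fun ω a b => W 0 ω a b) ?_ ?_
        (S := ⋃ j : Fin k, S j.succ) (T := S 0) ?_ ?_ ?_ (measurableSet_frobSq_distortion η)
        fun Z => hJL 0 (Matrix.of Z)
      · refine measurable_pi_lambda _ fun a => measurable_pi_lambda _ fun cu => ?_
        simp only [hG, Matrix.mul_apply, kron]
        exact Finset.measurable_sum _ fun c _ =>
          (Finset.measurable_prod _ fun j _ => hmeas j.succ _ _).mul_const _
      · exact measurable_pi_lambda _ fun a => measurable_pi_lambda _ fun b => hmeas 0 a b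
      · intro x y hxy
        have : ∀ j : Fin k, W j.succ x = W j.succ y := fun j =>
          hS j.succ fun i hi => hxy i (Set.mem_iUnion.2 ⟨j, hi⟩)
        simp only [hG, this]
      · intro x y hxy
        simp only [hS 0 hxy]
      · simp only [Set.disjoint_iUnion_left]
        exact fun j => hd (Fin.succ_ne_zero j)
    refine (measure_mono fun ω hω => ?_).trans ((measure_union_le _ _).trans
      (add_le_add h1 h2)) |>.trans_eq ?_
    · by_contra hcon
      simp only [Set.mem_union, Set.mem_ofPred_eq, not_or, not_not, not_lt] at hcon
      obtain ⟨⟨l1, u1⟩, hc⟩ := hcon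
      apply hω
      change |frobSq (W 0 ω * Matrix.of (G ω)) - frobSq (Matrix.of (G ω))| ≤ _ at hc
      rw [← hf, hfG] at hc
      rw [hfY] at l1 u1
      obtain ⟨hc1, hc2⟩ := abs_le.1 hc
      constructor
      · have := mul_le_mul_of_nonneg_left l1 (sub_nonneg.2 hη1)
        rw [pow_succ]
        nlinarith
      · have := mul_le_mul_of_nonneg_left u1 (by linarith : 0 ≤ 1 + η)
        rw [pow_succ]
        nlinarith
    · push_cast
      ring

/-- If the distortions sum to at most `θ/2`, their compounding is linear: Bernoulli's inequality
from below, `exp (θ/2) ≤ 1 + θ` from above. -/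
theorem measure_frobSq_kron_distortion_le {ι : Type} [Fintype ι] [DecidableEq ι] {m n : ℕ}
    {η θ : ℝ} (hη0 : 0 ≤ η) (hηθ : Fintype.card ι * η ≤ θ / 2) (hη1 : η ≤ 1) (hθ : 0 ≤ θ)
    (hθ1 : θ ≤ 1) {p : ℝ≥0∞}
    (W : ι → (I → ℝ) → Matrix (Fin m) (Fin n) ℝ)
    (hmeas : ∀ j a b, Measurable fun ω => W j ω a b) (S : ι → Set I)
    (hS : ∀ j, DependsOn (W j) (S j)) (hd : Pairwise fun i j => Disjoint (S i) (S j))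
    (hJL : ∀ j, ∀ {κ : Type} [Fintype κ] (Y : Matrix (Fin n) κ ℝ),
        Measure.pi ν {ω | η * frobSq Y < |frobSq (W j ω * Y) - frobSq Y|} ≤ p)
    {κ : Type} [Fintype κ] (Y : Matrix (ι → Fin n) κ ℝ) :
    Measure.pi ν {ω | θ * frobSq Y < |frobSq (kron (fun j => W j ω) * Y) - frobSq Y|}
      ≤ Fintype.card ι * p := by
  set e : Fin (Fintype.card ι) ≃ ι := (Fintype.equivFin ι).symm
  refine (measure_mono fun ω hω => ?_).trans (measure_frobSq_kron_distortion_le_pow ν hη0 hη1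
    (Fintype.card ι) (fun j => W (e j)) (fun j => hmeas _) (fun j => S (e j)) (fun j => hS _)
    (fun i j hij => hd fun h => hij (e.injective h)) (fun j => hJL (e j))
    (Y.submatrix (e.arrowCongr (Equiv.refl (Fin n))) id))
  rintro ⟨h1, h2⟩
  have hY : frobSq (Y.submatrix (e.arrowCongr (Equiv.refl (Fin n))) id) = frobSq Y :=
    frobSq_submatrix Y _ (Equiv.refl κ)
  rw [frobSq_kron_mul_reindex e (fun j => W j ω) Y, hY] at h1 h2
  refine absurd (Set.mem_ofPred_eq ▸ hω) (not_lt.2 (abs_le.2 ⟨?_, ?_⟩))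
  · have hb : 1 - θ ≤ (1 - η) ^ Fintype.card ι := by
      have := one_add_mul_le_pow (a := -η) (by linarith) (Fintype.card ι)
      rw [← sub_eq_add_neg] at this
      linarith
    nlinarith [mul_le_mul_of_nonneg_right hb (frobSq_nonneg Y)]
  · have hb : (1 + η) ^ Fintype.card ι ≤ 1 + θ := by
      calc (1 + η) ^ Fintype.card ι ≤ (Real.exp η) ^ Fintype.card ι := by
            gcongr
            linarith [Real.add_one_le_exp η]
        _ = Real.exp (Fintype.card ι * η) := by rw [← Real.exp_nat_mul]
        _ ≤ Real.exp (θ / 2) := Real.exp_le_exp.2 hηθ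
        _ ≤ 1 + θ := by
            have := Real.abs_exp_sub_one_sub_id_le (x := θ / 2) (by rw [abs_le]; constructor <;> linarith)
            nlinarith [(abs_le.1 this).2]
    nlinarith [mul_le_mul_of_nonneg_right hb (frobSq_nonneg Y)]

end

/-! ## From quadratic forms on a grid to the whole space -/

/-- The points of a grid of mesh `1 / (16 r)` in the cube `[-1, 1]ʳ`. -/
def gridPoint {r : ℕ} (g : Fin r → Fin (32 * r + 1)) : Fin r → ℝ :=
  fun i => (g i : ℕ) / (16 * r : ℝ) - 1

theorem exists_gridPoint_close {r : ℕ} (hr : 0 < r) {x : Fin r → ℝ} (hx : x ⬝ᵥ x = 1) :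
    ∃ g : Fin r → Fin (32 * r + 1), (x - gridPoint g) ⬝ᵥ (x - gridPoint g) ≤ 1 / 256 := by
  have hr' : (1 : ℝ) ≤ r := by exact_mod_cast hr
  have hxi : ∀ i, |x i| ≤ 1 := by
    intro i
    rw [← sq_le_one_iff_abs_le_one, ← hx, sq]
    exact Finset.single_le_sum (f := fun i => x i * x i) (fun i _ => mul_self_nonneg _)
      (Finset.mem_univ i)
  have hnn : ∀ i, 0 ≤ 16 * r * (x i + 1) := fun i => by
    have := (abs_le.1 (hxi i)).1
    have : 0 ≤ x i + 1 := by linarith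
    positivity
  -- Rounding down loses at most `1/(16 r)` per coordinate, hence at most `r/(16 r)² ≤ 1/256` in
  -- squared length. Coordinates run over an interval of length 2, which gives `32 r + 1` grid
  -- values.
  refine ⟨fun i => ⟨⌊16 * r * (x i + 1)⌋₊, ?_⟩, ?_⟩
  · rw [Nat.lt_succ_iff]
    refine Nat.floor_le_of_le ?_
    push_cast
    nlinarith [(abs_le.1 (hxi i)).2]
  · calc _ ≤ ∑ _i : Fin r, (1 / (16 * r : ℝ)) ^ 2 := by
          refine Finset.sum_le_sum fun i _ => ?_
          rw [← sq, ← sq_abs]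
          refine pow_le_pow_left₀ (abs_nonneg _) ?_ 2
          simp only [gridPoint, Pi.sub_apply]
          have h1 := Nat.floor_le (hnn i)
          have h2 := Nat.lt_floor_add_one (16 * r * (x i + 1))
          rw [show x i - (((⌊16 * r * (x i + 1)⌋₊ : ℕ) : ℝ) / (16 * r : ℝ) - 1)
            = (16 * r * (x i + 1) - (⌊16 * r * (x i + 1)⌋₊ : ℕ)) / (16 * r) by field_simp; ring,
            abs_div, abs_of_pos (by positivity : (0 : ℝ) < 16 * r)]
          gcongr
          rw [abs_le]
          constructor <;> linarith
      _ ≤ 1 / 256 := by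
          rw [Finset.sum_const, Finset.card_univ, Fintype.card_fin, nsmul_eq_mul]
          have : (r : ℝ) * (1 / (16 * r)) ^ 2 = 1 / 256 * (1 / r) := by field_simp; norm_num
          rw [this]
          have : (1 : ℝ) / r ≤ 1 := by rw [div_le_one (by linarith)]; exact hr'
          linarith

/-- Net argument. Let `q` be the maximum of the form on the unit sphere, attained at `x`, and `y` a
grid point near `x`. The values at `x` and `y` differ by a bilinear term in `x - y` and `x + y`, a
small fraction of `q`. This gives `q ≤ 1.13 θ/2 + 0.165 q`, so `q ≤ θ`. -/
theorem abs_quadForm_le_of_grid {r : ℕ} {H : Matrix (Fin r) (Fin r) ℝ} (hH : Hᵀ = H) {θ : ℝ} (hθ : 0 ≤ θ)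
    (hgrid : ∀ g : Fin r → Fin (32 * r + 1),
      |gridPoint g ⬝ᵥ H *ᵥ gridPoint g| ≤ θ / 2 * (gridPoint g ⬝ᵥ gridPoint g))
    (u : Fin r → ℝ) : |u ⬝ᵥ H *ᵥ u| ≤ θ * (u ⬝ᵥ u) := by
  rcases Nat.eq_zero_or_pos r with rfl | hr
  · simp [dotProduct]
  have hsymm : ∀ a b : Fin r → ℝ, a ⬝ᵥ H *ᵥ b = b ⬝ᵥ H *ᵥ a := fun a b => by
    rw [Matrix.dotProduct_mulVec, ← Matrix.mulVec_transpose, hH, dotProduct_comm]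
  set sph : Set (Fin r → ℝ) := {x | x ⬝ᵥ x = 1} with hsph
  have hcont : Continuous fun x : Fin r → ℝ => x ⬝ᵥ x := by unfold dotProduct; fun_prop
  have hcomp : IsCompact sph := by
    refine Metric.isCompact_of_isClosed_isBounded (isClosed_eq hcont continuous_const) ?_
    refine (Metric.isBounded_closedBall (x := (0 : Fin r → ℝ)) (r := 1)).subset fun x hx => ?_
    rw [mem_closedBall_zero_iff, pi_norm_le_iff_of_nonneg zero_le_one]
    intro i
    rw [Real.norm_eq_abs, ← sq_le_one_iff_abs_le_one, ← (show x ⬝ᵥ x = 1 from hx), sq]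
    exact Finset.single_le_sum (f := fun i => x i * x i) (fun i _ => mul_self_nonneg _)
      (Finset.mem_univ i)
  have hne : sph.Nonempty := ⟨Pi.single ⟨0, hr⟩ 1, by simp [hsph]⟩
  obtain ⟨x, hx, hmax⟩ := hcomp.exists_isMaxOn hne (f := fun x => |x ⬝ᵥ H *ᵥ x|)
    (by unfold Matrix.mulVec dotProduct; fun_prop)
  set q := |x ⬝ᵥ H *ᵥ x| with hq
  have hq0 : 0 ≤ q := abs_nonneg _
  have hall : ∀ v : Fin r → ℝ, |v ⬝ᵥ H *ᵥ v| ≤ q * (v ⬝ᵥ v) := by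
    intro v
    rcases (show (0 : ℝ) ≤ v ⬝ᵥ v from
      Finset.sum_nonneg fun i _ => mul_self_nonneg (v i)).eq_or_lt with h0 | hpos
    · have : v = 0 := by rw [← dotProduct_self_eq_zero]; exact h0.symm
      simp [this]
    · set c := (Real.sqrt (v ⬝ᵥ v))⁻¹ with hc
      have hc2 : c * c = (v ⬝ᵥ v)⁻¹ := by
        rw [hc, ← mul_inv, Real.mul_self_sqrt hpos.le]
      have hmem : c • v ∈ sph := by
        simp only [hsph, Set.mem_ofPred_eq, smul_dotProduct, dotProduct_smul, smul_eq_mul]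
        rw [← mul_assoc, hc2, inv_mul_cancel₀ hpos.ne']
      have := hmax hmem
      simp only [Set.mem_ofPred_eq, Matrix.mulVec_smul, smul_dotProduct, dotProduct_smul,
        smul_eq_mul] at this
      rw [← mul_assoc, hc2, abs_mul, abs_of_pos (inv_pos.2 hpos)] at this
      rw [mul_comm]
      exact (inv_mul_le_iff₀ hpos).1 this
  -- Polarization together with the parallelogram law.
  have hbil : ∀ a b : Fin r → ℝ, |a ⬝ᵥ H *ᵥ b| ≤ q / 2 * (a ⬝ᵥ a + b ⬝ᵥ b) := by
    intro a b
    have h1 := abs_le.1 (hall (a + b))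
    have h2 := abs_le.1 (hall (a - b))
    simp only [Matrix.mulVec_add, Matrix.mulVec_sub, add_dotProduct, dotProduct_add,
      sub_dotProduct, dotProduct_sub, hsymm b a, dotProduct_comm b a] at h1 h2
    rw [abs_le]
    constructor <;> linarith
  obtain ⟨g, hg⟩ := exists_gridPoint_close hr hx
  set y := gridPoint g with hy
  set a := x - y with ha
  have hya : y = x - a := by rw [ha]; abel
  have hxx : x ⬝ᵥ x = 1 := hx
  have hxa : |x ⬝ᵥ a| ≤ 1 / 16 := by
    have h1 : 0 ≤ (x + (16 : ℝ) • a) ⬝ᵥ (x + (16 : ℝ) • a) :=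
      Finset.sum_nonneg fun i _ => mul_self_nonneg _
    have h2 : 0 ≤ (x - (16 : ℝ) • a) ⬝ᵥ (x - (16 : ℝ) • a) :=
      Finset.sum_nonneg fun i _ => mul_self_nonneg _
    simp only [add_dotProduct, dotProduct_add, sub_dotProduct, dotProduct_sub, smul_dotProduct,
      dotProduct_smul, smul_eq_mul, dotProduct_comm a x, hxx] at h1 h2
    rw [abs_le]
    constructor <;> linarith
  have hxa' := abs_le.1 hxa
  have hyy : y ⬝ᵥ y ≤ 1.13 := by
    rw [hya]
    simp only [sub_dotProduct, dotProduct_sub, dotProduct_comm a x, hxx]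
    norm_num
    linarith
  have hbb : (x + y) ⬝ᵥ (x + y) ≤ 4.26 := by
    rw [hya]
    simp only [add_dotProduct, dotProduct_add, sub_dotProduct, dotProduct_sub,
      dotProduct_comm a x, hxx]
    norm_num
    linarith
  -- The weights 4 and 1/4 balance the short vector `a` against the long `x + y`: `16/256 + 4.26/16
  -- ≤ 0.33`.
  have hcross := hbil ((4 : ℝ) • a) ((1 / 4 : ℝ) • (x + y))
  have hsplit : x ⬝ᵥ H *ᵥ x
      = y ⬝ᵥ H *ᵥ y + ((4 : ℝ) • a) ⬝ᵥ H *ᵥ ((1 / 4 : ℝ) • (x + y)) := by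
    rw [ha]
    simp only [Matrix.mulVec_smul, Matrix.mulVec_add, smul_dotProduct, dotProduct_smul,
      smul_eq_mul, sub_dotProduct, dotProduct_add, hsymm y x]
    ring
  have haa : ((4 : ℝ) • a) ⬝ᵥ ((4 : ℝ) • a) + ((1 / 4 : ℝ) • (x + y)) ⬝ᵥ ((1 / 4 : ℝ) • (x + y))
      ≤ 0.33 := by
    rw [smul_dotProduct, dotProduct_smul, smul_dotProduct, dotProduct_smul]
    simp only [smul_eq_mul]
    norm_num at hbb ⊢
    linarith
  have hgy := hgrid g
  rw [← hy] at hgy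
  have hyy0 : 0 ≤ y ⬝ᵥ y := Finset.sum_nonneg fun i _ => mul_self_nonneg _
  have hqθ : q ≤ θ := by
    have h1 : q ≤ θ / 2 * (y ⬝ᵥ y) + q / 2 * 0.33 := by
      calc q ≤ |y ⬝ᵥ H *ᵥ y| + |((4 : ℝ) • a) ⬝ᵥ H *ᵥ ((1 / 4 : ℝ) • (x + y))| := by
            rw [hq, hsplit]; exact abs_add_le _ _
        _ ≤ _ := add_le_add hgy
            (hcross.trans (mul_le_mul_of_nonneg_left haa (by linarith)))
    by_contra hlt
    push Not at hlt
    have := mul_le_mul_of_nonneg_left hyy (by linarith : 0 ≤ θ / 2)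
    norm_num at *
    linarith
  exact (hall u).trans (mul_le_mul_of_nonneg_right hqθ
    (Finset.sum_nonneg fun i _ => mul_self_nonneg _))


/-! ## More on the Frobenius norm -/

section

variable {ι κ τ : Type} [Fintype ι] [Fintype κ] [Fintype τ]

theorem frobSq_eq_trace' (A : Matrix ι κ ℝ) : frobSq A = (Aᵀ * A).trace := by
  rw [← frobSq_transpose, frobSq_eq_trace, Matrix.transpose_transpose]

theorem trace_mul_transpose_eq_sum (A B : Matrix ι κ ℝ) :
    (A * Bᵀ).trace = ∑ x : ι × κ, A x.1 x.2 * B x.1 x.2 := by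
  simp [Matrix.trace, Matrix.mul_apply, Fintype.sum_prod_type]

theorem trace_mul_transpose_sq_le (A B : Matrix ι κ ℝ) :
    (A * Bᵀ).trace ^ 2 ≤ frobSq A * frobSq B := by
  rw [trace_mul_transpose_eq_sum]
  refine (Finset.sum_mul_sq_le_sq_mul_sq _ _ _).trans_eq ?_
  simp [frobSq, Fintype.sum_prod_type]

theorem abs_trace_mul_transpose_le {A B : Matrix ι κ ℝ} {a b : ℝ} (ha : 0 ≤ a) (hb : 0 ≤ b)
    (hA : frobSq A ≤ a ^ 2) (hB : frobSq B ≤ b ^ 2) : |(A * Bᵀ).trace| ≤ a * b := by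
  refine abs_le_of_sq_le_sq ?_ (mul_nonneg ha hb)
  rw [mul_pow]
  exact (trace_mul_transpose_sq_le A B).trans
    (mul_le_mul hA hB (frobSq_nonneg B) (sq_nonneg a))

theorem frobSq_add (A B : Matrix ι κ ℝ) :
    frobSq (A + B) = frobSq A + 2 * (A * Bᵀ).trace + frobSq B := by
  simp only [frobSq, Matrix.trace, Matrix.diag, Matrix.mul_apply, Matrix.transpose_apply,
    Matrix.add_apply, Finset.mul_sum, ← Finset.sum_add_distrib]
  exact Finset.sum_congr rfl fun i _ => Finset.sum_congr rfl fun j _ => by ring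

theorem frobSq_add_le_of_pos (A B : Matrix ι κ ℝ) {t : ℝ} (ht : 0 < t) :
    frobSq (A + B) ≤ (1 + t) * frobSq A + (1 + t⁻¹) * frobSq B := by
  simp only [frobSq, Matrix.add_apply, Finset.mul_sum, ← Finset.sum_add_distrib]
  refine Finset.sum_le_sum fun i _ => Finset.sum_le_sum fun j _ => ?_
  have h := sq_nonneg (t * A i j - B i j)
  have : t⁻¹ * (t * A i j - B i j) ^ 2
      = t * A i j ^ 2 - 2 * A i j * B i j + t⁻¹ * B i j ^ 2 := by field_simp; ring
  nlinarith [mul_nonneg (inv_nonneg.2 ht.le) h]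

variable [DecidableEq τ]

theorem frobSq_orthonormal_mul {Q : Matrix ι τ ℝ} (hQ : Qᵀ * Q = 1) (Z : Matrix τ κ ℝ) :
    frobSq (Q * Z) = frobSq Z := by
  rw [frobSq_eq_trace', Matrix.transpose_mul, Matrix.mul_assoc, ← Matrix.mul_assoc Qᵀ, hQ,
    Matrix.one_mul, ← frobSq_eq_trace']

theorem frobSq_mul_orthonormal_transpose {Q : Matrix ι τ ℝ} (hQ : Qᵀ * Q = 1)
    (Z : Matrix κ τ ℝ) : frobSq (Z * Qᵀ) = frobSq Z := by
  rw [← frobSq_transpose, Matrix.transpose_mul, Matrix.transpose_transpose,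
    frobSq_orthonormal_mul hQ, frobSq_transpose]

omit [Fintype κ] in
theorem transpose_mul_sub_proj {Q : Matrix ι τ ℝ} (hQ : Qᵀ * Q = 1) (Z : Matrix ι κ ℝ) :
    Qᵀ * (Z - Q * (Qᵀ * Z)) = 0 := by
  rw [Matrix.mul_sub, ← Matrix.mul_assoc Qᵀ Q, hQ, Matrix.one_mul, sub_self]

omit [DecidableEq τ] in
theorem trace_mul_transpose_eq_zero {Q : Matrix ι τ ℝ} {X : Matrix ι κ ℝ} (hX : Qᵀ * X = 0)
    (W : Matrix τ κ ℝ) : (X * (Q * W)ᵀ).trace = 0 := by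
  rw [Matrix.transpose_mul, ← Matrix.mul_assoc, Matrix.trace_mul_comm, ← Matrix.mul_assoc, hX]
  simp

theorem frobSq_sub_proj {Q : Matrix ι τ ℝ} (hQ : Qᵀ * Q = 1) (Z : Matrix ι κ ℝ) :
    frobSq (Z - Q * (Qᵀ * Z)) = frobSq Z - frobSq (Qᵀ * Z) := by
  have h : frobSq Z = frobSq (Z - Q * (Qᵀ * Z)) + frobSq (Qᵀ * Z) := by
    conv_lhs => rw [← sub_add_cancel Z (Q * (Qᵀ * Z))]
    rw [frobSq_add, frobSq_orthonormal_mul hQ,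
      trace_mul_transpose_eq_zero (transpose_mul_sub_proj hQ _)]
    ring
  linarith

theorem frobSq_proj_le {Q : Matrix ι τ ℝ} (hQ : Qᵀ * Q = 1) (Z : Matrix ι κ ℝ) :
    frobSq (Qᵀ * Z) ≤ frobSq Z := by
  have := frobSq_sub_proj hQ Z
  linarith [frobSq_nonneg (Z - Q * (Qᵀ * Z))]

theorem frobSq_sub_mul_eq {Q : Matrix ι τ ℝ} (hQ : Qᵀ * Q = 1) (A : Matrix ι κ ℝ)
    (Z : Matrix τ κ ℝ) :
    frobSq (A - Q * Z) = frobSq (A - Q * (Qᵀ * A)) + frobSq (Qᵀ * A - Z) := by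
  rw [show A - Q * Z = (A - Q * (Qᵀ * A)) + Q * (Qᵀ * A - Z) by rw [Matrix.mul_sub]; abel]
  rw [frobSq_add, frobSq_orthonormal_mul hQ,
    trace_mul_transpose_eq_zero (transpose_mul_sub_proj hQ _)]
  ring

/-- Projection onto the range of `Q` gives the best approximation among the matrices `Q Z`. -/
theorem frobSq_sub_proj_le {Q : Matrix ι τ ℝ} (hQ : Qᵀ * Q = 1) (A : Matrix ι κ ℝ)
    (Z : Matrix τ κ ℝ) : frobSq (A - Q * (Qᵀ * A)) ≤ frobSq (A - Q * Z) := by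
  rw [frobSq_sub_mul_eq hQ A Z]
  linarith [frobSq_nonneg (Qᵀ * A - Z)]

end

/-! ## The Eckart–Young theorem -/

/-- The indices `r, …, p - 1`. -/
def tailIdx {p r : ℕ} (h : r ≤ p) (j : Fin (p - r)) : Fin p := ⟨r + j, by omega⟩

theorem sum_fin_eq_head_add_tail {p r : ℕ} (h : r ≤ p) {M : Type*} [AddCommMonoid M]
    (g : Fin p → M) :
    ∑ k, g k = ∑ k : Fin r, g (Fin.castLE h k) + ∑ j : Fin (p - r), g (tailIdx h j) := by
  obtain ⟨s, rfl⟩ := Nat.exists_eq_add_of_le h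
  rw [Fin.sum_univ_add]
  congr 1
  have hs : s = r + s - r := by omega
  rw [← (finCongr hs).sum_comp]
  rfl

section SVD

variable {n q r : ℕ} {A : Matrix (Fin n) (Fin q) ℝ} {D : ThinSVD n q}

theorem ThinSVD.IsSVDOf.frobSq_eq (h : D.IsSVDOf A) : frobSq A = ∑ k, D.σ k ^ 2 := by
  rw [h.eq, frobSq_mul_orthonormal_transpose h.V_orthonormal, frobSq_orthonormal_mul h.U_orthonormal]
  simp [frobSq, Matrix.diagonal_apply, ite_pow]

/-- The left side is a weighted sum of the squared singular values. The weights lie in `[0, 1]`,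
since each column of `D.U` is a unit vector, and sum to at most `r`, since `R` has at most `r`
orthonormal columns. For a decreasing sequence such a sum is largest with all weight on the first
`r` terms. -/
theorem ThinSVD.IsSVDOf.frobSq_mul_le (h : D.IsSVDOf A) (hr : r ≤ min n q) {κ : Type} [Fintype κ]
    [DecidableEq κ] {R : Matrix (Fin n) κ ℝ} (hR : Rᵀ * R = 1) (hκ : Fintype.card κ ≤ r) :
    frobSq (Rᵀ * A) ≤ ∑ k : Fin r, D.σ (Fin.castLE hr k) ^ 2 := by
  set w : Fin (min n q) → ℝ := fun k => ∑ i, (Rᵀ * D.U) i k ^ 2 with hw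
  have h1 : frobSq (Rᵀ * A) = ∑ k, D.σ k ^ 2 * w k := by
    rw [h.eq, ← Matrix.mul_assoc, frobSq_mul_orthonormal_transpose h.V_orthonormal,
      ← Matrix.mul_assoc, ← frobSq_transpose]
    refine Finset.sum_congr rfl fun k _ => ?_
    rw [hw, Finset.mul_sum]
    refine Finset.sum_congr rfl fun i _ => ?_
    rw [Matrix.transpose_apply, Matrix.mul_diagonal]
    ring
  have hw0 : ∀ k, 0 ≤ w k := fun k => Finset.sum_nonneg fun i _ => sq_nonneg _
  have hw1 : ∀ k, w k ≤ 1 := by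
    intro k
    have h2 := frobSq_proj_le hR (D.U.submatrix id (fun _ : Unit => k))
    have h3 : frobSq (D.U.submatrix id (fun _ : Unit => k)) = 1 := by
      have := congrFun (congrFun h.U_orthonormal k) k
      simp only [Matrix.mul_apply, Matrix.transpose_apply, Matrix.one_apply_eq] at this
      rw [← this]
      simp [frobSq, sq]
    have h4 : frobSq (Rᵀ * D.U.submatrix id (fun _ : Unit => k)) = w k := by
      simp [frobSq, hw, Matrix.mul_apply]
    linarith
  have hwsum : ∑ k, w k ≤ r := by
    have h2 := frobSq_proj_le h.U_orthonormal R
    have h3 : frobSq R = Fintype.card κ := by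
      rw [frobSq_eq_trace', hR, Matrix.trace_one]
    have h4 : frobSq (D.Uᵀ * R) = ∑ k, w k := by
      rw [← frobSq_transpose, Matrix.transpose_mul, Matrix.transpose_transpose, ← frobSq_transpose]
      rfl
    have : (Fintype.card κ : ℝ) ≤ r := by exact_mod_cast hκ
    linarith
  rcases Nat.eq_zero_or_pos r with rfl | hrpos
  · have : ∀ k, w k = 0 := by
      intro k
      refine le_antisymm ?_ (hw0 k)
      refine (Finset.single_le_sum (fun k _ => hw0 k) (Finset.mem_univ k)).trans ?_
      simpa using hwsum
    rw [h1]
    simp [this]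
  -- The `r`-th squared singular value is the pivot: weight missing in the head is worth at least
  -- `s`, weight in the tail at most `s`.
  set s := D.σ (Fin.castLE hr ⟨r - 1, by omega⟩) ^ 2 with hs
  have hhead : ∀ k : Fin r, s ≤ D.σ (Fin.castLE hr k) ^ 2 := fun k =>
    pow_le_pow_left₀ (h.σ_nonneg _) (h.σ_antitone (by
      rw [Fin.le_def]; simp only [Fin.val_castLE]; omega)) 2
  have htail : ∀ k : Fin (min n q - r), D.σ (tailIdx hr k) ^ 2 ≤ s := fun k =>
    pow_le_pow_left₀ (h.σ_nonneg _) (h.σ_antitone (by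
      rw [Fin.le_def]; simp only [Fin.val_castLE, tailIdx]; omega)) 2
  rw [h1, sum_fin_eq_head_add_tail hr]
  rw [sum_fin_eq_head_add_tail hr] at hwsum
  have e1 : ∑ k : Fin r, D.σ (Fin.castLE hr k) ^ 2 * w (Fin.castLE hr k)
      ≤ ∑ k : Fin r, D.σ (Fin.castLE hr k) ^ 2 - s * (r - ∑ k : Fin r, w (Fin.castLE hr k)) := by
    have : s * (r - ∑ k : Fin r, w (Fin.castLE hr k))
        = ∑ k : Fin r, s * (1 - w (Fin.castLE hr k)) := by
      rw [← Finset.mul_sum]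
      simp
    rw [this, ← Finset.sum_sub_distrib]
    refine Finset.sum_le_sum fun k _ => ?_
    nlinarith [mul_le_mul_of_nonneg_right (hhead k) (sub_nonneg.2 (hw1 (Fin.castLE hr k)))]
  have e2 : ∑ k : Fin (min n q - r), D.σ (tailIdx hr k) ^ 2 * w (tailIdx hr k)
      ≤ s * ∑ k : Fin (min n q - r), w (tailIdx hr k) := by
    rw [Finset.mul_sum]
    exact Finset.sum_le_sum fun k _ => mul_le_mul_of_nonneg_right (htail k) (hw0 _)
  have hs0 : 0 ≤ s := sq_nonneg _
  nlinarith

/-- The `r` leading left singular vectors. -/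
def ThinSVD.leadingU (D : ThinSVD n q) (hr : r ≤ min n q) : Matrix (Fin n) (Fin r) ℝ :=
  D.U.submatrix id (Fin.castLE hr)

/-- The sum of the squares of all but the `r` leading singular values. -/
def ThinSVD.tailSq (D : ThinSVD n q) (hr : r ≤ min n q) : ℝ :=
  ∑ j : Fin (min n q - r), D.σ (tailIdx hr j) ^ 2

theorem submatrix_gram_of_injective {ι κ α : Type} [Fintype ι] [DecidableEq κ] [DecidableEq α]
    {U : Matrix ι κ ℝ} (hU : Uᵀ * U = 1) {f : α → κ} (hf : Function.Injective f) :
    (U.submatrix id f)ᵀ * U.submatrix id f = 1 := by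
  have : (U.submatrix id f)ᵀ * U.submatrix id f = (Uᵀ * U).submatrix f f := by
    ext; simp [Matrix.mul_apply]
  rw [this, hU, Matrix.submatrix_one _ hf]

theorem submatrix_gram_of_disjoint {ι κ α β : Type} [Fintype ι] [DecidableEq κ]
    {U : Matrix ι κ ℝ} (hU : Uᵀ * U = 1) {f : α → κ} {g : β → κ} (hfg : ∀ a b, f a ≠ g b) :
    (U.submatrix id f)ᵀ * U.submatrix id g = 0 := by
  have : (U.submatrix id f)ᵀ * U.submatrix id g = (Uᵀ * U).submatrix f g := by
    ext; simp [Matrix.mul_apply]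
  rw [this, hU]
  ext a b
  simp [Matrix.one_apply_ne (hfg a b)]

theorem ThinSVD.IsSVDOf.leadingU_orthonormal (h : D.IsSVDOf A) (hr : r ≤ min n q) :
    (D.leadingU hr)ᵀ * D.leadingU hr = 1 :=
  submatrix_gram_of_injective h.U_orthonormal (Fin.castLE_injective hr)

theorem ThinSVD.IsSVDOf.eq_add (h : D.IsSVDOf A) (hr : r ≤ min n q) :
    A = D.leadingU hr * Matrix.diagonal (fun k => D.σ (Fin.castLE hr k)) *
          (D.V.submatrix id (Fin.castLE hr))ᵀ
        + D.U.submatrix id (tailIdx hr) * Matrix.diagonal (fun k => D.σ (tailIdx hr k)) *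
          (D.V.submatrix id (tailIdx hr))ᵀ := by
  conv_lhs => rw [h.eq]
  ext i j
  simp only [Matrix.add_apply, Matrix.mul_apply (M := _ * _), Matrix.mul_diagonal,
    Matrix.transpose_apply, Matrix.submatrix_apply, id, ThinSVD.leadingU]
  exact sum_fin_eq_head_add_tail hr _

theorem ThinSVD.IsSVDOf.tailSq_le (h : D.IsSVDOf A) (hr : r ≤ min n q) {κ : Type} [Fintype κ]
    [DecidableEq κ] {R : Matrix (Fin n) κ ℝ} (hR : Rᵀ * R = 1) (hκ : Fintype.card κ ≤ r) :
    D.tailSq hr ≤ frobSq (A - R * (Rᵀ * A)) := by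
  have h1 := h.frobSq_mul_le hr hR hκ
  have h2 := h.frobSq_eq
  rw [sum_fin_eq_head_add_tail hr] at h2
  rw [frobSq_sub_proj hR, ThinSVD.tailSq]
  linarith

theorem ThinSVD.IsSVDOf.frobSq_sub_leadingU (h : D.IsSVDOf A) (hr : r ≤ min n q) :
    frobSq (A - D.leadingU hr * ((D.leadingU hr)ᵀ * A)) = D.tailSq hr := by
  have h1 : A - D.leadingU hr * ((D.leadingU hr)ᵀ * A)
      = D.U.submatrix id (tailIdx hr) * Matrix.diagonal (fun k => D.σ (tailIdx hr k)) *
          (D.V.submatrix id (tailIdx hr))ᵀ := by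
    have horth : (D.leadingU hr)ᵀ * D.U.submatrix id (tailIdx hr) = 0 :=
      submatrix_gram_of_disjoint h.U_orthonormal fun a b => by
        simp only [ne_eq, Fin.ext_iff, Fin.val_castLE, tailIdx]; omega
    have : (D.leadingU hr)ᵀ * A = Matrix.diagonal (fun k => D.σ (Fin.castLE hr k)) *
          (D.V.submatrix id (Fin.castLE hr))ᵀ := by
      conv_lhs => rw [h.eq_add hr]
      rw [Matrix.mul_add, ← Matrix.mul_assoc, ← Matrix.mul_assoc, h.leadingU_orthonormal hr,
        ← Matrix.mul_assoc, ← Matrix.mul_assoc, horth]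
      simp
    rw [this]
    conv_lhs => rw [h.eq_add hr]
    rw [← Matrix.mul_assoc, add_sub_cancel_left]
  have hinj : Function.Injective (tailIdx hr) := fun a b hab => by
    simpa [tailIdx, Fin.ext_iff] using hab
  rw [h1, frobSq_mul_orthonormal_transpose (submatrix_gram_of_injective h.V_orthonormal hinj),
    frobSq_orthonormal_mul (submatrix_gram_of_injective h.U_orthonormal hinj)]
  simp [frobSq, Matrix.diagonal_apply, ite_pow, ThinSVD.tailSq]

/-- **Eckart–Young** in the Frobenius norm. -/
theorem ThinSVD.IsSVDOf.frobSq_sub_leadingU_le (h : D.IsSVDOf A) (hr : r ≤ min n q) {κ : Type}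
    [Fintype κ] [DecidableEq κ] {R : Matrix (Fin n) κ ℝ} (hR : Rᵀ * R = 1)
    (hκ : Fintype.card κ ≤ r) :
    frobSq (A - D.leadingU hr * ((D.leadingU hr)ᵀ * A)) ≤ frobSq (A - R * (Rᵀ * A)) := by
  rw [h.frobSq_sub_leadingU hr]
  exact h.tailSq_le hr hR hκ

/-- Eckart–Young for arbitrary factorizations through `ℝʳ`. -/
theorem ThinSVD.IsSVDOf.tailSq_le_of_factor (S : SVDRoutine) (h : D.IsSVDOf A)
    (hr : r ≤ min n q) (U : Matrix (Fin n) (Fin r) ℝ) (Z : Matrix (Fin r) (Fin q) ℝ) :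
    D.tailSq hr ≤ frobSq (A - U * Z) := by
  -- The left singular vectors of `U`, at most `r` of them, give an orthonormal family whose span
  -- contains the range of `U`, even if `U` is rank deficient.
  have hE := S.isSVDOf U
  refine (h.tailSq_le hr hE.U_orthonormal (by simp)).trans ?_
  conv_rhs => rw [hE.eq]
  rw [Matrix.mul_assoc, Matrix.mul_assoc]
  exact frobSq_sub_proj_le hE.U_orthonormal _ _

end SVD


/-! ## Distortion of inner products -/

/-- The distortion `⟨S vₐ, S u_b⟩ - ⟨vₐ, u_b⟩` of the inner products of the columns of `V` and
`U`. -/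
def gramErr {N M α β : Type} [Fintype N] [Fintype M] (S : Matrix M N ℝ)
    (V : Matrix N α ℝ) (U : Matrix N β ℝ) : Matrix α β ℝ :=
  (S * V)ᵀ * (S * U) - Vᵀ * U

section

variable {N M : Type} [Fintype N] [Fintype M]

theorem frobSq_replicateCol (S : Matrix M N ℝ) (y : N → ℝ) :
    frobSq (S * Matrix.replicateCol Unit y) = (S *ᵥ y) ⬝ᵥ (S *ᵥ y) := by
  simp [frobSq, Matrix.mul_apply, dotProduct, Matrix.mulVec, sq]

theorem frobSq_replicateCol' (y : N → ℝ) : frobSq (Matrix.replicateCol Unit y) = y ⬝ᵥ y := by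
  simp [frobSq, dotProduct, sq]

theorem abs_dotProduct_distortion_le (S : Matrix M N ℝ) {θ : ℝ} (v u : N → ℝ)
    (h1 : |(S *ᵥ (v + u)) ⬝ᵥ (S *ᵥ (v + u)) - (v + u) ⬝ᵥ (v + u)| ≤ θ * ((v + u) ⬝ᵥ (v + u)))
    (h2 : |(S *ᵥ (v - u)) ⬝ᵥ (S *ᵥ (v - u)) - (v - u) ⬝ᵥ (v - u)| ≤ θ * ((v - u) ⬝ᵥ (v - u))) :
    |(S *ᵥ v) ⬝ᵥ (S *ᵥ u) - v ⬝ᵥ u| ≤ θ / 2 * (v ⬝ᵥ v + u ⬝ᵥ u) := by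
  have h1 := abs_le.1 h1
  have h2 := abs_le.1 h2
  simp only [Matrix.mulVec_add, Matrix.mulVec_sub, add_dotProduct, dotProduct_add,
    sub_dotProduct, dotProduct_sub, dotProduct_comm (S *ᵥ u) (S *ᵥ v), dotProduct_comm u v] at h1 h2
  rw [abs_le]
  constructor <;> linarith

theorem gramErr_apply {α β : Type} (S : Matrix M N ℝ) (V : Matrix N α ℝ) (U : Matrix N β ℝ) (a : α)
    (b : β) : gramErr S V U a b
      = (S *ᵥ V.col a) ⬝ᵥ (S *ᵥ U.col b) - V.col a ⬝ᵥ U.col b := by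
  simp only [gramErr, Matrix.sub_apply, Matrix.mul_apply, Matrix.transpose_apply, dotProduct,
    Matrix.mulVec, Matrix.col]

theorem gramErr_submatrix {α β α' β' : Type} (S : Matrix M N ℝ) (V : Matrix N α ℝ)
    (U : Matrix N β ℝ) (f : α' → α) (g : β' → β) :
    gramErr S (V.submatrix id f) (U.submatrix id g) = (gramErr S V U).submatrix f g := by
  ext; simp [gramErr, Matrix.mul_apply]

theorem gramErr_transpose {α β : Type} (S : Matrix M N ℝ) (V : Matrix N α ℝ)
    (U : Matrix N β ℝ) : (gramErr S V U)ᵀ = gramErr S U V := by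
  simp [gramErr, Matrix.transpose_sub, Matrix.transpose_mul]

theorem dotProduct_gramErr_mulVec {α : Type} [Fintype α] (S : Matrix M N ℝ) (V : Matrix N α ℝ)
    (u : α → ℝ) : u ⬝ᵥ gramErr S V V *ᵥ u
      = (S *ᵥ (V *ᵥ u)) ⬝ᵥ (S *ᵥ (V *ᵥ u)) - (V *ᵥ u) ⬝ᵥ (V *ᵥ u) := by
  rw [gramErr, Matrix.sub_mulVec, dotProduct_sub, ← Matrix.mulVec_mulVec, ← Matrix.mulVec_mulVec,
    ← Matrix.mulVec_mulVec, Matrix.dotProduct_mulVec, Matrix.vecMul_transpose,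
    Matrix.dotProduct_mulVec u Vᵀ, Matrix.vecMul_transpose, ← Matrix.mulVec_mulVec]

variable {Ω : Type} [MeasurableSpace Ω] (μ : Measure Ω) {S : Ω → Matrix M N ℝ}

/-- By polarization an inner product is controlled by the squared lengths of `v + u` and `v - u`,
two test vectors per pair of columns. -/
theorem measure_gramErr_entry_le {θ : ℝ} {p : ℝ≥0∞}
    (h : ∀ y : N → ℝ, μ {ω | θ * (y ⬝ᵥ y) < |(S ω *ᵥ y) ⬝ᵥ (S ω *ᵥ y) - y ⬝ᵥ y|} ≤ p)
    (hθ : 0 ≤ θ) {α β : Type} [Fintype α] [Fintype β] (V : Matrix N α ℝ) (U : Matrix N β ℝ)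
    (hV : ∀ a, V.col a ⬝ᵥ V.col a ≤ 1) (hU : ∀ b, U.col b ⬝ᵥ U.col b ≤ 1) :
    μ {ω | ∃ a b, θ < |gramErr (S ω) V U a b|} ≤ 2 * (Fintype.card α * Fintype.card β) * p := by
  refine (measure_mono (t := ⋃ x : (α × β) × Bool,
    {ω | θ * ((V.col x.1.1 + (if x.2 then (1 : ℝ) else -1) • U.col x.1.2) ⬝ᵥ
        (V.col x.1.1 + (if x.2 then (1 : ℝ) else -1) • U.col x.1.2))
      < |(S ω *ᵥ (V.col x.1.1 + (if x.2 then (1 : ℝ) else -1) • U.col x.1.2)) ⬝ᵥ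
          (S ω *ᵥ (V.col x.1.1 + (if x.2 then (1 : ℝ) else -1) • U.col x.1.2))
        - (V.col x.1.1 + (if x.2 then (1 : ℝ) else -1) • U.col x.1.2) ⬝ᵥ
          (V.col x.1.1 + (if x.2 then (1 : ℝ) else -1) • U.col x.1.2)|}) ?_).trans
      ((measure_iUnion_fintype_le _ _).trans ((Finset.sum_le_sum fun x _ => h _).trans_eq ?_))
  · rintro ω ⟨a, b, hab⟩
    by_contra hcon
    simp only [Set.mem_iUnion, not_exists, Set.mem_ofPred_eq, not_lt] at hcon
    have h1 := hcon ((a, b), true)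
    have h2 := hcon ((a, b), false)
    simp only [if_true, one_smul, Bool.false_eq_true, if_false, neg_smul, ← sub_eq_add_neg] at h1 h2
    have h3 := abs_dotProduct_distortion_le (S ω) _ _ h1 h2
    rw [← gramErr_apply] at h3
    nlinarith [hV a, hU b]
  · simp only [Finset.sum_const, Finset.card_univ, Fintype.card_prod, Fintype.card_bool,
      nsmul_eq_mul]
    push_cast
    ring

/-- The grid argument is run at half the tolerance. Bounds on the single entries alone would lose a
factor `r` in the quadratic form. -/
theorem measure_gramErr_quadForm_le {θ : ℝ} {p : ℝ≥0∞}
    (h : ∀ y : N → ℝ, μ {ω | θ / 2 * (y ⬝ᵥ y) < |(S ω *ᵥ y) ⬝ᵥ (S ω *ᵥ y) - y ⬝ᵥ y|} ≤ p)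
    (hθ : 0 ≤ θ) {r : ℕ} (V : Matrix N (Fin r) ℝ) (hV : Vᵀ * V = 1) :
    μ {ω | ∃ u, θ * (u ⬝ᵥ u) < |u ⬝ᵥ gramErr (S ω) V V *ᵥ u|} ≤ (32 * r + 1) ^ r * p := by
  have hVu : ∀ u : Fin r → ℝ, (V *ᵥ u) ⬝ᵥ (V *ᵥ u) = u ⬝ᵥ u := fun u => by
    rw [Matrix.dotProduct_mulVec, ← Matrix.mulVec_transpose, Matrix.mulVec_mulVec, hV,
      Matrix.one_mulVec]
  refine (measure_mono (t := ⋃ g : Fin r → Fin (32 * r + 1),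
    {ω | θ / 2 * ((V *ᵥ gridPoint g) ⬝ᵥ (V *ᵥ gridPoint g))
      < |(S ω *ᵥ (V *ᵥ gridPoint g)) ⬝ᵥ (S ω *ᵥ (V *ᵥ gridPoint g))
        - (V *ᵥ gridPoint g) ⬝ᵥ (V *ᵥ gridPoint g)|}) ?_).trans
      ((measure_iUnion_fintype_le _ _).trans ((Finset.sum_le_sum fun x _ => h _).trans_eq ?_))
  · rintro ω ⟨u, hu⟩
    by_contra hcon
    simp only [Set.mem_iUnion, not_exists, Set.mem_ofPred_eq, not_lt] at hcon
    refine absurd hu (not_lt.2 (abs_quadForm_le_of_grid (gramErr_transpose _ _ _) hθ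
      (fun g => ?_) u))
    have := hcon g
    rwa [← dotProduct_gramErr_mulVec, hVu] at this
  · simp only [Finset.sum_const, Finset.card_univ, Fintype.card_fun, Fintype.card_fin,
      nsmul_eq_mul]
    push_cast
    ring

end

/-! ## Projection-cost preservation -/

section PCP

variable {n r : ℕ} {β κ M : Type} [Fintype β] [DecidableEq β] [Fintype κ] [Fintype M]

theorem trace_mul_mul_transpose_eq_sum {ι α : Type} [Fintype ι] [Fintype α] (Y : Matrix ι α ℝ)
    (H : Matrix α α ℝ) : (Y * H * Yᵀ).trace = ∑ i, Y i ⬝ᵥ H *ᵥ Y i := by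
  rw [Matrix.trace]
  refine Finset.sum_congr rfl fun i _ => ?_
  rw [Matrix.diag, Matrix.mul_assoc]
  simp only [dotProduct, Matrix.mulVec, Matrix.mul_apply, Matrix.transpose_apply]

theorem mul_transpose_mul_mul_transpose {ι α γ : Type} [Fintype ι] [Fintype α] [Fintype γ]
    (Y : Matrix ι α ℝ) (Z : Matrix M α ℝ) (Y' : Matrix ι γ ℝ) (Z' : Matrix M γ ℝ) :
    Y * Zᵀ * (Y' * Z'ᵀ)ᵀ = Y * (Zᵀ * Z') * Y'ᵀ := by
  rw [Matrix.transpose_mul, Matrix.transpose_transpose]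
  simp only [Matrix.mul_assoc]

theorem frobSq_mul_sketch_transpose {ι α : Type} [Fintype ι] [Fintype α] [DecidableEq α]
    (Y : Matrix ι α ℝ) (Z : Matrix M α ℝ) (H : Matrix α α ℝ) (h : Zᵀ * Z = 1 + H) :
    frobSq (Y * Zᵀ) = frobSq Y + (Y * H * Yᵀ).trace := by
  rw [frobSq_eq_trace, mul_transpose_mul_mul_transpose, h, Matrix.mul_add, Matrix.mul_one,
    Matrix.add_mul, Matrix.trace_add, ← frobSq_eq_trace]

set_option maxHeartbeats 1000000 in
/-- A sketch that nearly preserves the Gram matrix of the right singular vectors of `A`, and the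
squared norms of the vectors in the span of the leading ones, preserves low rank approximations. -/
theorem frobSq_sub_proj_le_of_gramErr (hr : 0 < r)
    {U₁ : Matrix (Fin n) (Fin r) ℝ} {U₂ : Matrix (Fin n) β ℝ} {s₁ : Fin r → ℝ} {s₂ : β → ℝ}
    {V₁ : Matrix κ (Fin r) ℝ} {V₂ : Matrix κ β ℝ} (hU₁ : U₁ᵀ * U₁ = 1) (hU₂ : U₂ᵀ * U₂ = 1)
    (hU₁₂ : U₁ᵀ * U₂ = 0) (hV₁ : V₁ᵀ * V₁ = 1) (hV₂ : V₂ᵀ * V₂ = 1) (hV₁₂ : V₁ᵀ * V₂ = 0)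
    {A : Matrix (Fin n) κ ℝ}
    (hA : A = U₁ * Matrix.diagonal s₁ * V₁ᵀ + U₂ * Matrix.diagonal s₂ * V₂ᵀ)
    {S : Matrix M κ ℝ} {θ θ₁ : ℝ} (hθ : 0 ≤ θ) (hθ₁ : 0 ≤ θ₁) (hθθ : Real.sqrt r * θ₁ ≤ θ)
    (h11 : ∀ u, |u ⬝ᵥ gramErr S V₁ V₁ *ᵥ u| ≤ θ * (u ⬝ᵥ u))
    (h12 : ∀ a b, |gramErr S V₁ V₂ a b| ≤ θ₁) (h22 : ∀ a b, |gramErr S V₂ V₂ a b| ≤ θ₁)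
    {Q : Matrix (Fin n) (Fin r) ℝ} (hQ : Qᵀ * Q = 1)
    (hτ : ∑ b, s₂ b ^ 2 ≤ frobSq (A - Q * (Qᵀ * A)))
    (hEY : frobSq (A * Sᵀ - Q * (Qᵀ * (A * Sᵀ)))
      ≤ frobSq (A * Sᵀ - U₁ * (U₁ᵀ * (A * Sᵀ)))) :
    (1 - 5 * θ) * frobSq (A - Q * (Qᵀ * A)) ≤ (1 + θ) * ∑ b, s₂ b ^ 2 := by
  set τ := ∑ b, s₂ b ^ 2 with hτdef
  have hτ0 : 0 ≤ τ := Finset.sum_nonneg fun _ _ => sq_nonneg _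
  have hr1 : 1 ≤ Real.sqrt r := by
    rw [Real.one_le_sqrt]; exact_mod_cast hr
  have hθ₁θ : θ₁ ≤ θ := le_trans (by nlinarith) hθθ
  set D₁ := Matrix.diagonal s₁
  set D₂ := Matrix.diagonal s₂ with hD₂
  set H₁₁ := gramErr S V₁ V₁ with hH₁₁
  set H₁₂ := gramErr S V₁ V₂ with hH₁₂
  set H₂₂ := gramErr S V₂ V₂ with hH₂₂
  have hD₂f : frobSq D₂ = τ := by
    simp [frobSq, hD₂, Matrix.diagonal_apply, ite_pow, hτdef]
  have hD₂t : D₂ᵀ = D₂ := Matrix.diagonal_transpose _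
  have g11 : (S * V₁)ᵀ * (S * V₁) = 1 + H₁₁ := by rw [hH₁₁, gramErr, hV₁]; abel
  have g12 : (S * V₁)ᵀ * (S * V₂) = H₁₂ := by rw [hH₁₂, gramErr, hV₁₂, sub_zero]
  have g22 : (S * V₂)ᵀ * (S * V₂) = 1 + H₂₂ := by rw [hH₂₂, gramErr, hV₂]; abel
  -- the two quantities controlled by the tail
  have hcore : frobSq (D₂ * H₂₂ * D₂) ≤ (θ₁ * τ) ^ 2 := by
    calc frobSq (D₂ * H₂₂ * D₂) = ∑ a, ∑ b, s₂ a ^ 2 * s₂ b ^ 2 * H₂₂ a b ^ 2 := by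
          refine Finset.sum_congr rfl fun a _ => Finset.sum_congr rfl fun b _ => ?_
          rw [hD₂, Matrix.mul_diagonal, Matrix.diagonal_mul]
          ring
      _ ≤ ∑ a, ∑ b, s₂ a ^ 2 * s₂ b ^ 2 * θ₁ ^ 2 := by
          refine Finset.sum_le_sum fun a _ => Finset.sum_le_sum fun b _ => ?_
          refine mul_le_mul_of_nonneg_left ?_ (by positivity)
          rw [← sq_abs]
          exact pow_le_pow_left₀ (abs_nonneg _) (h22 a b) 2
      _ = (θ₁ * τ) ^ 2 := by
          simp only [← Finset.sum_mul, ← Finset.mul_sum]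
          rw [← hτdef]; ring
  have hdiag : |(D₂ * H₂₂ * D₂).trace| ≤ θ₁ * τ := by
    calc |(D₂ * H₂₂ * D₂).trace| = |∑ b, s₂ b ^ 2 * H₂₂ b b| := by
          congr 1
          refine Finset.sum_congr rfl fun b _ => ?_
          rw [Matrix.diag, hD₂, Matrix.mul_diagonal, Matrix.diagonal_mul]
          ring
      _ ≤ ∑ b, s₂ b ^ 2 * θ₁ := by
          refine (Finset.abs_sum_le_sum_abs _ _).trans (Finset.sum_le_sum fun b _ => ?_)
          rw [abs_mul, abs_of_nonneg (sq_nonneg _)]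
          exact mul_le_mul_of_nonneg_left (h22 b b) (sq_nonneg _)
      _ = θ₁ * τ := by rw [← Finset.sum_mul, mul_comm]
  -- Summation over the `r` leading vectors produces the factor `r` that `θ₁`, of order `θ/√r`,
  -- compensates.
  have hmixed : frobSq (U₂ * (D₂ * H₁₂ᵀ)) ≤ (θ * Real.sqrt τ) ^ 2 := by
    rw [frobSq_orthonormal_mul hU₂]
    calc frobSq (D₂ * H₁₂ᵀ) = ∑ b, ∑ a, s₂ b ^ 2 * H₁₂ a b ^ 2 := by
          refine Finset.sum_congr rfl fun b _ => Finset.sum_congr rfl fun a _ => ?_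
          rw [hD₂, Matrix.diagonal_mul, Matrix.transpose_apply]
          ring
      _ ≤ ∑ b, ∑ _a : Fin r, s₂ b ^ 2 * θ₁ ^ 2 := by
          refine Finset.sum_le_sum fun b _ => Finset.sum_le_sum fun a _ => ?_
          refine mul_le_mul_of_nonneg_left ?_ (by positivity)
          rw [← sq_abs]
          exact pow_le_pow_left₀ (abs_nonneg _) (h12 a b) 2
      _ = (Real.sqrt r * θ₁) ^ 2 * τ := by
          simp only [Finset.sum_const, Finset.card_univ, Fintype.card_fin, nsmul_eq_mul,
            ← Finset.mul_sum, ← Finset.sum_mul]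
          rw [mul_pow, Real.sq_sqrt (Nat.cast_nonneg r), ← hτdef]
          ring
      _ ≤ θ ^ 2 * τ := by gcongr
      _ = _ := by rw [mul_pow, Real.sq_sqrt hτ0]
  -- the upper bound for the projection onto the leading singular vectors of `A`
  have hupper : frobSq (A * Sᵀ - U₁ * (U₁ᵀ * (A * Sᵀ))) ≤ (1 + θ) * τ := by
    -- Projection onto the range of `U₁` reproduces the leading part of `A * Sᵀ` exactly; only the
    -- sketched tail survives.
    have e1 : A * Sᵀ - U₁ * (U₁ᵀ * (A * Sᵀ)) = U₂ * (D₂ * (S * V₂)ᵀ) := by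
      have : U₁ᵀ * (A * Sᵀ) = D₁ * (S * V₁)ᵀ := by
        rw [hA, Matrix.add_mul, Matrix.mul_add]
        simp only [← Matrix.mul_assoc, hU₁, hU₁₂, Matrix.transpose_mul, Matrix.one_mul,
          Matrix.zero_mul, add_zero]
      rw [this, hA, Matrix.add_mul]
      simp only [Matrix.transpose_mul, Matrix.mul_assoc]
      abel
    rw [e1, frobSq_orthonormal_mul hU₂, frobSq_mul_sketch_transpose _ _ _ g22, hD₂f, hD₂t]
    have := (abs_le.1 hdiag).2
    nlinarith
  -- the lower bound for the projection onto the leading singular vectors of the sketch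
  set P : Matrix (Fin n) (Fin n) ℝ := 1 - Q * Qᵀ with hP
  have hPapp : ∀ {κ' : Type} (Z : Matrix (Fin n) κ' ℝ), Z - Q * (Qᵀ * Z) = P * Z := by
    intro κ' Z
    rw [hP, Matrix.sub_mul, Matrix.one_mul, Matrix.mul_assoc]
  have hPt : Pᵀ = P := by simp [hP, Matrix.transpose_sub, Matrix.transpose_mul]
  have hPP : P * P = P := by
    rw [← hPapp P]
    have : Qᵀ * P = 0 := by
      rw [hP, Matrix.mul_sub, ← Matrix.mul_assoc, hQ, Matrix.mul_one, Matrix.one_mul, sub_self]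
    rw [this, Matrix.mul_zero, sub_zero]
  set Y₁ := P * U₁ * D₁ with hY₁
  set Y₂ := P * U₂ * D₂ with hY₂
  have hPY₁ : P * Y₁ = Y₁ := by rw [hY₁, ← Matrix.mul_assoc, ← Matrix.mul_assoc, hPP]
  have hPA : frobSq (P * A) = frobSq Y₁ + frobSq Y₂ := by
    have : P * A = Y₁ * V₁ᵀ + Y₂ * V₂ᵀ := by
      rw [hA, Matrix.mul_add, hY₁, hY₂]; simp only [Matrix.mul_assoc]
    rw [this, frobSq_add, frobSq_mul_orthonormal_transpose hV₁,
      frobSq_mul_orthonormal_transpose hV₂, Matrix.transpose_mul, Matrix.transpose_transpose,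
      Matrix.mul_assoc, ← Matrix.mul_assoc V₁ᵀ, hV₁₂]
    simp
  have hPF : frobSq (P * (A * Sᵀ)) = frobSq Y₁ + (Y₁ * H₁₁ * Y₁ᵀ).trace
      + 2 * (Y₁ * H₁₂ * Y₂ᵀ).trace + (frobSq Y₂ + (Y₂ * H₂₂ * Y₂ᵀ).trace) := by
    have h1 : P * (A * Sᵀ) = Y₁ * (S * V₁)ᵀ + Y₂ * (S * V₂)ᵀ := by
      rw [hA, Matrix.add_mul, Matrix.mul_add, hY₁, hY₂]
      simp only [Matrix.mul_assoc, Matrix.transpose_mul]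
    rw [h1, frobSq_add, frobSq_mul_sketch_transpose Y₁ (S * V₁) H₁₁ g11,
      frobSq_mul_sketch_transpose Y₂ (S * V₂) H₂₂ g22, mul_transpose_mul_mul_transpose, g12]
  have hT1 : |(Y₁ * H₁₁ * Y₁ᵀ).trace| ≤ θ * frobSq Y₁ := by
    rw [trace_mul_mul_transpose_eq_sum, frobSq, Finset.mul_sum]
    refine (Finset.abs_sum_le_sum_abs _ _).trans (Finset.sum_le_sum fun i _ => ?_)
    refine (h11 (Y₁ i)).trans_eq ?_
    simp [dotProduct, sq]
  -- Because `P * Y₁ = Y₁`, the projection can be removed from the tail factor, to which `hmixed`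
  -- then applies.
  have hT2 : |(Y₁ * H₁₂ * Y₂ᵀ).trace| ≤ Real.sqrt (frobSq Y₁) * (θ * Real.sqrt τ) := by
    have : (Y₁ * H₁₂ * Y₂ᵀ).trace = (Y₁ * (U₂ * (D₂ * H₁₂ᵀ))ᵀ).trace := by
      rw [hY₂]
      simp only [Matrix.transpose_mul, Matrix.transpose_transpose, hPt]
      rw [← Matrix.mul_assoc, ← Matrix.mul_assoc, Matrix.trace_mul_comm, ← Matrix.mul_assoc,
        ← Matrix.mul_assoc, ← Matrix.mul_assoc, hPY₁]
      simp only [Matrix.mul_assoc]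
    rw [this]
    exact abs_trace_mul_transpose_le (Real.sqrt_nonneg _) (by positivity)
      (Real.sq_sqrt (frobSq_nonneg _)).ge hmixed
  -- The trace of `P B P` is the full trace minus the part seen by `Q Qᵀ`. The former is bounded by
  -- the diagonal of `H₂₂`, the latter by Cauchy–Schwarz and the Frobenius norm `√r` of `Q Qᵀ`.
  have hT3 : |(Y₂ * H₂₂ * Y₂ᵀ).trace| ≤ 2 * θ * τ := by
    set B := U₂ * (D₂ * H₂₂ * D₂) * U₂ᵀ with hB
    have h1 : (Y₂ * H₂₂ * Y₂ᵀ).trace = B.trace - (B * (Q * Qᵀ)ᵀ).trace := by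
      have : Y₂ * H₂₂ * Y₂ᵀ = P * (B * P) := by
        rw [hY₂, hB]
        simp only [Matrix.transpose_mul, hPt, hD₂t, Matrix.mul_assoc]
      rw [this, Matrix.trace_mul_comm, Matrix.mul_assoc, hPP, hP, Matrix.mul_sub, Matrix.mul_one,
        Matrix.trace_sub, Matrix.transpose_mul, Matrix.transpose_transpose]
    have h2 : B.trace = (D₂ * H₂₂ * D₂).trace := by
      rw [hB, Matrix.trace_mul_comm, ← Matrix.mul_assoc, hU₂, Matrix.one_mul]
    have h3 : |(B * (Q * Qᵀ)ᵀ).trace| ≤ θ₁ * τ * Real.sqrt r := by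
      refine abs_trace_mul_transpose_le (by positivity) (Real.sqrt_nonneg _) ?_ ?_
      · rw [hB, frobSq_mul_orthonormal_transpose hU₂, frobSq_orthonormal_mul hU₂]
        exact hcore
      · rw [frobSq_mul_orthonormal_transpose hQ, frobSq_eq_trace', hQ, Matrix.trace_one,
          Fintype.card_fin, Real.sq_sqrt (Nat.cast_nonneg r)]
    have h4 : θ₁ * τ * Real.sqrt r ≤ θ * τ := by nlinarith
    have h5 : θ₁ * τ ≤ θ * τ := by nlinarith
    rw [h1, h2]
    have := abs_sub (D₂ * H₂₂ * D₂).trace (B * (Q * Qᵀ)ᵀ).trace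
    linarith
  rw [hPapp] at hτ ⊢
  rw [hPapp] at hEY
  have hsq : Real.sqrt (frobSq Y₁) * Real.sqrt τ ≤ frobSq (P * A) := by
    have h1 : frobSq Y₁ ≤ frobSq (P * A) := by rw [hPA]; linarith [frobSq_nonneg Y₂]
    calc _ ≤ Real.sqrt (frobSq (P * A)) * Real.sqrt (frobSq (P * A)) := by gcongr
      _ = _ := Real.mul_self_sqrt (frobSq_nonneg _)
  -- The losses are `θ` from `hT1`, `2θ` from the doubled cross term and `2θ` from `hT3`, all
  -- relative to `frobSq (P * A)` because `τ` is at most that: `5θ` in total.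
  have h1 := (abs_le.1 hT1).1
  have h2 := (abs_le.1 hT2).1
  have h3 := (abs_le.1 hT3).1
  have h4 : θ * frobSq Y₁ ≤ θ * frobSq (P * A) := by
    rw [hPA]; nlinarith [frobSq_nonneg Y₂]
  have h5 : θ * (Real.sqrt (frobSq Y₁) * Real.sqrt τ) ≤ θ * frobSq (P * A) :=
    mul_le_mul_of_nonneg_left hsq hθ
  have h6 : θ * τ ≤ θ * frobSq (P * A) := mul_le_mul_of_nonneg_left hτ hθ
  have h7 := hEY.trans hupper
  rw [hPF] at h7
  linarith

end PCP

/-! ## Sketched least squares -/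

theorem le_gram_of_gramErr {n mc r : ℕ} {Φ : Matrix (Fin mc) (Fin n) ℝ}
    {Q : Matrix (Fin n) (Fin r) ℝ} (hQ : Qᵀ * Q = 1)
    (hG : ∀ u, |u ⬝ᵥ gramErr Φ Q Q *ᵥ u| ≤ 1 / 2 * (u ⬝ᵥ u)) (u : Fin r → ℝ) :
    1 / 2 * (u ⬝ᵥ u) ≤ u ⬝ᵥ ((Φ * Q)ᵀ * (Φ * Q)) *ᵥ u := by
  have h1 := (abs_le.1 (hG u)).1
  rw [gramErr, hQ, Matrix.sub_mulVec, dotProduct_sub, Matrix.one_mulVec] at h1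
  linarith

/-- A solution of the normal equations of a nearly isometric matrix is a left inverse. -/
theorem mul_eq_one_of_gramErr {n mc r : ℕ} {Φ : Matrix (Fin mc) (Fin n) ℝ}
    {Q : Matrix (Fin n) (Fin r) ℝ} (hQ : Qᵀ * Q = 1)
    (hG : ∀ u, |u ⬝ᵥ gramErr Φ Q Q *ᵥ u| ≤ 1 / 2 * (u ⬝ᵥ u))
    {N : Matrix (Fin r) (Fin mc) ℝ} (hN : (Φ * Q)ᵀ * (Φ * Q) * N = (Φ * Q)ᵀ) :
    N * (Φ * Q) = 1 := by
  set A := Φ * Q with hA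
  have hinj : ∀ {α : Type} (B : Matrix (Fin r) α ℝ), Aᵀ * A * B = 0 → B = 0 := by
    intro α B hB
    ext i a
    have h1 := le_gram_of_gramErr hQ hG (B.col a)
    have h2 : (Aᵀ * A) *ᵥ B.col a = 0 := by
      ext j
      exact congrFun (congrFun hB j) a
    rw [h2, dotProduct_zero] at h1
    have h3 : B.col a ⬝ᵥ B.col a = 0 := le_antisymm (by linarith)
      (Finset.sum_nonneg fun i _ => mul_self_nonneg _)
    exact congrFun (dotProduct_self_eq_zero.1 h3) i
  rw [← sub_eq_zero]
  refine hinj _ ?_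
  rw [Matrix.mul_sub, ← Matrix.mul_assoc, hN, Matrix.mul_one, sub_self]

/-- If `Φ` nearly preserves the inner products of the orthonormal columns of `Q`, and those with the
part of `Y` orthogonal to them, then least squares projection through `Φ` is nearly a
contraction on `Y`. -/
theorem frobSq_sketched_projection_le {n mc r : ℕ} {κ : Type} [Fintype κ]
    {Φ : Matrix (Fin mc) (Fin n) ℝ} {Q : Matrix (Fin n) (Fin r) ℝ} (hQ : Qᵀ * Q = 1)
    {N : Matrix (Fin r) (Fin mc) ℝ} (hN : (Φ * Q)ᵀ * (Φ * Q) * N = (Φ * Q)ᵀ)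
    (hG : ∀ u, |u ⬝ᵥ gramErr Φ Q Q *ᵥ u| ≤ 1 / 2 * (u ⬝ᵥ u)) {Y : Matrix (Fin n) κ ℝ} {t : ℝ}
    (ht : 0 < t) (hY : 4 * frobSq (gramErr Φ Q (Y - Q * (Qᵀ * Y))) ≤ t ^ 2 * frobSq Y) :
    frobSq (Q * N * Φ * Y) ≤ (1 + t) ^ 2 * frobSq Y := by
  set A := Φ * Q with hA
  set Z := Y - Q * (Qᵀ * Y) with hZ
  have hlow := le_gram_of_gramErr hQ hG
  have hNA : N * A = 1 := mul_eq_one_of_gramErr hQ hG hN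
  set W := N * (Φ * Z) with hW
  set G := gramErr Φ Q Z with hGdef
  have hQZ : Qᵀ * Z = 0 := transpose_mul_sub_proj hQ Y
  have hMW : Aᵀ * A * W = G := by
    rw [hW, ← Matrix.mul_assoc, hN, hGdef, gramErr, hQZ, sub_zero]
  -- `W` solves `AᵀA W = G` and `AᵀA` is at least `1/2`, so the norm of `W` is at most twice that of
  -- `G`.
  have hWG : frobSq W ≤ 4 * frobSq G := by
    have h1 : 1 / 2 * frobSq W ≤ (W * Gᵀ).trace := by
      have e1 : (W * Gᵀ).trace = ∑ a, W.col a ⬝ᵥ (Aᵀ * A) *ᵥ W.col a := by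
        rw [← hMW]
        rw [trace_mul_transpose_eq_sum, Fintype.sum_prod_type, Finset.sum_comm]
        rfl
      have e2 : frobSq W = ∑ a, W.col a ⬝ᵥ W.col a := by
        rw [← frobSq_transpose]
        simp only [frobSq, dotProduct, sq, Matrix.col, Matrix.transpose_apply]
      rw [e1, e2, Finset.mul_sum]
      exact Finset.sum_le_sum fun a _ => hlow _
    have h2 := trace_mul_transpose_sq_le W G
    have h3 := frobSq_nonneg W
    have h4 := frobSq_nonneg G
    rcases h3.eq_or_lt with h0 | hpos
    · rw [← h0]; positivity
    · have : (1 / 2 * frobSq W) ^ 2 ≤ frobSq W * frobSq G :=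
        (pow_le_pow_left₀ (by positivity) h1 2).trans h2
      nlinarith
  -- The part of `Y` in the range of `Q` passes unchanged, as `N` is a left inverse; `W` is the
  -- leakage from the orthogonal part.
  have hsplit : N * (Φ * Y) = Qᵀ * Y + W := by
    have : Y = Q * (Qᵀ * Y) + Z := by rw [hZ]; abel
    conv_lhs => rw [this]
    rw [Matrix.mul_add, Matrix.mul_add, ← Matrix.mul_assoc Φ Q, ← Matrix.mul_assoc N, hNA,
      Matrix.one_mul]
  rw [Matrix.mul_assoc, Matrix.mul_assoc, frobSq_orthonormal_mul hQ, hsplit]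
  -- Weight `t` in Young's inequality gives exactly `(1 + t) + (1 + t⁻¹) t² = (1 + t)²`.
  refine (frobSq_add_le_of_pos _ _ ht).trans ?_
  have h1 := frobSq_proj_le hQ Y
  have h2 : frobSq W ≤ t ^ 2 * frobSq Y := hWG.trans hY
  have h3 : (1 + t⁻¹) * frobSq W ≤ (1 + t⁻¹) * (t ^ 2 * frobSq Y) := by gcongr
  have h4 : (1 + t⁻¹) * (t ^ 2 * frobSq Y) = (t ^ 2 + t) * frobSq Y := by field_simp
  nlinarith [mul_le_mul_of_nonneg_left h1 (by linarith : 0 ≤ 1 + t)]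


/-! ## Modewise products -/

section Tensor

variable {d : ℕ}

theorem tensorNorm_nonneg {s : Fin d → ℕ} (T : Tensor s) : 0 ≤ tensorNorm T := Real.sqrt_nonneg _

theorem tensorNorm_sq {s : Fin d → ℕ} (T : Tensor s) (k : Fin d) :
    tensorNorm T ^ 2 = frobSq (unfold k T) := by
  rw [tensorNorm, Real.sq_sqrt (Finset.sum_nonneg fun _ _ => sq_nonneg _), frobSq,
    ← (Equiv.piSplitAt k (fun j => Fin (s j))).symm.sum_comp, Fintype.sum_prod_type]
  rfl

theorem tensorNorm_add_le {s : Fin d → ℕ} (T T' : Tensor s) :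
    tensorNorm (T + T') ≤ tensorNorm T + tensorNorm T' := by
  have h : ∀ T : Tensor s, tensorNorm T = ‖WithLp.toLp 2 T‖ := fun T => by
    simp [tensorNorm, EuclideanSpace.norm_eq]
  rw [h, h, h, WithLp.toLp_add]
  exact norm_add_le _ _

theorem tensorNorm_neg {s : Fin d → ℕ} (T : Tensor s) : tensorNorm (-T) = tensorNorm T := by
  simp [tensorNorm]

theorem unfold_sub {s : Fin d → ℕ} (k : Fin d) (T T' : Tensor s) :
    unfold k (T - T') = unfold k T - unfold k T' := rfl

theorem modewiseProd_sub {s t : Fin d → ℕ} (T T' : Tensor s)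
    (M : ∀ i, Matrix (Fin (t i)) (Fin (s i)) ℝ) :
    modewiseProd (T - T') M = modewiseProd T M - modewiseProd T' M := by
  ext y
  simp [modewiseProd, mul_sub, Finset.sum_sub_distrib]

theorem modewiseProd_modewiseProd {s t u : Fin d → ℕ} (T : Tensor s)
    (M : ∀ i, Matrix (Fin (t i)) (Fin (s i)) ℝ) (M' : ∀ i, Matrix (Fin (u i)) (Fin (t i)) ℝ) :
    modewiseProd (modewiseProd T M) M' = modewiseProd T fun i => M' i * M i := by
  ext y
  simp only [modewiseProd, Matrix.mul_apply, Finset.mul_sum]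
  rw [Finset.sum_comm]
  refine Finset.sum_congr rfl fun x _ => ?_
  rw [Finset.prod_univ_sum, Finset.sum_mul, Fintype.piFinset_univ]
  refine Finset.sum_congr rfl fun z _ => ?_
  rw [Finset.prod_mul_distrib]
  ring

theorem modewiseProd_one {s : Fin d → ℕ} (T : Tensor s) :
    modewiseProd T (fun i => (1 : Matrix (Fin (s i)) (Fin (s i)) ℝ)) = T := by
  ext y
  rw [modewiseProd, Finset.sum_eq_single y]
  · simp
  · intro x _ hx
    obtain ⟨i, hi⟩ := Function.ne_iff.1 hx
    rw [Finset.prod_eq_zero (i := i) (f := fun i =>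
      (1 : Matrix (Fin (s i)) (Fin (s i)) ℝ) (y i) (x i)) (Finset.mem_univ i)
      (Matrix.one_apply_ne hi.symm), zero_mul]
  · simp

theorem piSplitAt_symm_self {s : Fin d → ℕ} (k : Fin d) (a : Fin (s k)) (c : Cols s k) :
    (Equiv.piSplitAt k (fun j => Fin (s j))).symm (a, c) k = a := by
  simp [Equiv.piSplitAt]

theorem piSplitAt_symm_ne {s : Fin d → ℕ} (k : Fin d) (a : Fin (s k)) (c : Cols s k)
    (j : {j : Fin d // j ≠ k}) :
    (Equiv.piSplitAt k (fun j => Fin (s j))).symm (a, c) j = c j := by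
  simp [Equiv.piSplitAt, j.2]

theorem unfold_modewiseProd_apply {s t : Fin d → ℕ} (k : Fin d) (T : Tensor s)
    (M : ∀ i, Matrix (Fin (t i)) (Fin (s i)) ℝ) (a : Fin (t k)) (c : Cols t k) :
    unfold k (modewiseProd T M) a c
      = ∑ x, M k a (x k) * ((∏ j : {j : Fin d // j ≠ k}, M j (c j) (x j)) * T x) := by
  rw [unfold, modewiseProd]
  refine Finset.sum_congr rfl fun x _ => ?_
  rw [Fintype.prod_eq_mul_prod_subtype_ne _ k, piSplitAt_symm_self, mul_assoc]
  simp only [piSplitAt_symm_ne]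

/-- Applying one more matrix in mode `k` multiplies the mode-`k` unfolding by that matrix. -/
theorem unfold_modewiseProd_of_eq_mul {n : ℕ} (k : Fin d) (T : Tensor fun _ : Fin d => n)
    {M M' : Fin d → Matrix (Fin n) (Fin n) ℝ} {P : Matrix (Fin n) (Fin n) ℝ} (hk : M' k = P * M k)
    (hne : ∀ j, j ≠ k → M' j = M j) :
    unfold k (modewiseProd (t := fun _ => n) T M')
      = P * unfold k (modewiseProd (t := fun _ => n) T M) := by
  ext a c
  rw [unfold_modewiseProd_apply, Matrix.mul_apply]
  simp only [unfold_modewiseProd_apply, Finset.mul_sum]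
  rw [Finset.sum_comm]
  refine Finset.sum_congr rfl fun x _ => ?_
  rw [hk, Matrix.mul_apply, Finset.sum_mul]
  refine Finset.sum_congr rfl fun b _ => ?_
  rw [mul_assoc, Finset.prod_congr rfl fun (j : {j : Fin d // j ≠ k}) _ => by rw [hne j j.2]]

/-- The family that agrees with `M` in the first `k` modes and is the identity in the others. -/
def firstModes {n : ℕ} (M : Fin d → Matrix (Fin n) (Fin n) ℝ) (k : ℕ) :
    Fin d → Matrix (Fin n) (Fin n) ℝ := fun i => if (i : ℕ) < k then M i else 1

theorem unfold_modewiseProd_firstModes_succ {n : ℕ} (T : Tensor fun _ : Fin d => n)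
    (M : Fin d → Matrix (Fin n) (Fin n) ℝ) (k : Fin d) :
    unfold k (modewiseProd (t := fun _ => n) T (firstModes M (k + 1)))
      = M k * unfold k (modewiseProd (t := fun _ => n) T (firstModes M k)) := by
  refine unfold_modewiseProd_of_eq_mul k T ?_ fun j hj => ?_
  · simp [firstModes]
  · have h' : (j : ℕ) ≠ k := fun e => hj (Fin.ext e)
    have : (j : ℕ) < k + 1 ↔ (j : ℕ) < k := by omega
    simp [firstModes, this]

theorem modewiseProd_firstModes_zero {n : ℕ} (T : Tensor fun _ : Fin d => n)
    (M : Fin d → Matrix (Fin n) (Fin n) ℝ) :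
    modewiseProd (t := fun _ => n) T (firstModes M 0) = T := by
  have : firstModes M 0 = fun _ => 1 := by ext1; simp [firstModes]
  rw [this]
  exact modewiseProd_one T

theorem firstModes_last {n : ℕ} (M : Fin d → Matrix (Fin n) (Fin n) ℝ) : firstModes M d = M := by
  ext1 i
  simp [firstModes]

/-- The error of a higher-order orthogonal projection is at most the sum of the errors in the
single modes. -/
theorem tensorNorm_sub_modewiseProd_proj_sq_le {n r : ℕ} (X : Tensor fun _ : Fin d => n)
    {Q : Fin d → Matrix (Fin n) (Fin r) ℝ} (hQ : ∀ k, (Q k)ᵀ * Q k = 1) :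
    tensorNorm (X - modewiseProd (t := fun _ => n) X fun i => Q i * (Q i)ᵀ) ^ 2
      ≤ ∑ k, frobSq (unfold k X - Q k * ((Q k)ᵀ * unfold k X)) := by
  have key : ∀ k : ℕ, k ≤ d →
      tensorNorm (X - modewiseProd (t := fun _ => n) X (firstModes (fun i => Q i * (Q i)ᵀ) k)) ^ 2
        ≤ ∑ i : Fin d, if (i : ℕ) < k then frobSq (unfold i X - Q i * ((Q i)ᵀ * unfold i X))
          else 0 := by
    intro k
    induction k with
    | zero =>
      intro _
      rw [modewiseProd_firstModes_zero]
      simp [tensorNorm]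
    | succ k ih =>
      intro hk
      have ih := ih (by omega)
      set κ : Fin d := ⟨k, hk⟩
      set Z := modewiseProd (t := fun _ => n) X (firstModes (fun i => Q i * (Q i)ᵀ) k) with hZ
      have hstep := unfold_modewiseProd_firstModes_succ X (fun i => Q i * (Q i)ᵀ) κ
      have hval : (κ : ℕ) = k := rfl
      rw [hval, ← hZ] at hstep
      rw [tensorNorm_sq _ κ, unfold_sub, hstep, Matrix.mul_assoc]
      rw [tensorNorm_sq _ κ, unfold_sub] at ih
      -- Pythagoras in mode `κ`: the error splits into the single-mode error of `X` and the
      -- projection of `X - Z`, whose norm does not increase.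
      have h1 : frobSq (unfold κ X - Q κ * ((Q κ)ᵀ * unfold κ Z))
          ≤ frobSq (unfold κ X - Q κ * ((Q κ)ᵀ * unfold κ X)) + frobSq (unfold κ X - unfold κ Z) := by
        rw [frobSq_sub_mul_eq (hQ κ), ← Matrix.mul_sub]
        linarith [frobSq_proj_le (hQ κ) (unfold κ X - unfold κ Z)]
      refine h1.trans ?_
      have h2 : (∑ i : Fin d, if (i : ℕ) < k + 1 then
            frobSq (unfold i X - Q i * ((Q i)ᵀ * unfold i X)) else 0)
          = (∑ i : Fin d, if (i : ℕ) < k then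
            frobSq (unfold i X - Q i * ((Q i)ᵀ * unfold i X)) else 0)
            + frobSq (unfold κ X - Q κ * ((Q κ)ᵀ * unfold κ X)) := by
        have : frobSq (unfold κ X - Q κ * ((Q κ)ᵀ * unfold κ X)) = ∑ i : Fin d,
            if i = κ then frobSq (unfold i X - Q i * ((Q i)ᵀ * unfold i X)) else 0 := by simp
        rw [this, ← Finset.sum_add_distrib]
        refine Finset.sum_congr rfl fun i _ => ?_
        have hi : i = κ ↔ (i : ℕ) = k := Fin.ext_iff
        rcases lt_trichotomy (i : ℕ) k with h | h | h
        · simp [hi, h, h.ne, Nat.lt_succ_of_lt h]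
        · simp [hi, h]
        · simp [hi, h.ne', not_lt.2 h.le, not_lt.2 (Nat.succ_le_of_lt h)]
      rw [h2]
      linarith
  have := key d le_rfl
  rw [firstModes_last] at this
  simpa using this

/-- Columns of the unfolding lie in the range of one factor matrix. This links Tucker approximation
to Eckart–Young. -/
theorem unfold_toTensor {n r : ℕ} (F : TuckerFactors d n r) (k : Fin d) :
    ∃ Z : Matrix (Fin r) (Cols (fun _ : Fin d => n) k) ℝ, unfold k F.toTensor = F.factor k * Z := by
  refine ⟨Matrix.of fun b c => ∑ x, if x k = b then
    (∏ j : {j : Fin d // j ≠ k}, F.factor j (c j) (x j)) * F.core x else 0, ?_⟩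
  ext a c
  rw [TuckerFactors.toTensor, unfold_modewiseProd_apply]
  refine Eq.trans ?_ Matrix.mul_apply.symm
  simp only [Finset.mul_sum, Matrix.of_apply]
  rw [Finset.sum_comm]
  refine Finset.sum_congr rfl fun x _ => ?_
  simp

end Tensor

/-! ## Values computed by the algorithm -/

namespace Timed

@[simp] theorem val_bind {α β : Type} (x : Timed α) (f : α → Timed β) :
    (x >>= f).val = (f x.val).val := rfl

@[simp] theorem val_pure {α : Type} (a : α) : (pure a : Timed α).val = a := rfl

@[simp] theorem steps_bind {α β : Type} (x : Timed α) (f : α → Timed β) :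
    (x >>= f).steps = x.steps + (f x.val).steps := rfl

@[simp] theorem steps_pure {α : Type} (a : α) : (pure a : Timed α).steps = 0 := rfl

theorem val_tabulate {ι κ : Type} [Fintype ι] [Fintype κ] (f : ι → κ → Timed ℝ) :
    (tabulate f).val = fun i j => (f i j).val := rfl

theorem steps_tabulate {ι κ : Type} [Fintype ι] [Fintype κ] (f : ι → κ → Timed ℝ) :
    (tabulate f).steps = ∑ i, ∑ j, ((f i j).steps + 1) := rfl

theorem dot_val_steps {p : ℕ} (u v : Fin p → ℝ) :
    (dot u v).val = ∑ k, u k * v k ∧ (dot u v).steps = 2 * p := by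
  induction p with
  | zero => exact ⟨by simp [dot], by simp [dot]⟩
  | succ p ih =>
    have h := ih (fun k => u k.castSucc) (fun k => v k.castSucc)
    have e : dot u v = (do
        let s ← dot (fun k => u k.castSucc) (fun k => v k.castSucc)
        let t ← mul (u (Fin.last p)) (v (Fin.last p))
        add s t) := by
      simp only [dot, Fin.foldl_succ_last]
    rw [e]
    constructor
    · rw [Fin.sum_univ_castSucc, ← h.1]; rfl
    · simp only [steps_bind, h.2, mul, add]; ring

theorem val_matMul {ι κ : Type} [Fintype ι] [Fintype κ] {p : ℕ} (A : Matrix ι (Fin p) ℝ)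
    (B : Matrix (Fin p) κ ℝ) : (matMul A B).val = A * B := by
  ext i j
  exact (dot_val_steps _ _).1

theorem steps_matMul {ι κ : Type} [Fintype ι] [Fintype κ] {p : ℕ} (A : Matrix ι (Fin p) ℝ)
    (B : Matrix (Fin p) κ ℝ) :
    (matMul A B).steps = Fintype.card ι * (Fintype.card κ * (2 * p + 1)) := by
  rw [matMul, steps_tabulate]
  simp [dot_val_steps]

end Timed

/-- The pseudo-inverse read off from a singular value decomposition. -/
def ThinSVD.pinv {p q : ℕ} (D : ThinSVD p q) : Matrix (Fin q) (Fin p) ℝ :=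
  D.V * (Matrix.diagonal (fun k => (D.σ k)⁻¹) * D.Uᵀ)

/-- The normal equations are the only algebraic property of the pseudo-inverse that the error
analysis uses. -/
theorem ThinSVD.IsSVDOf.gram_mul_pinv {p q : ℕ} {A : Matrix (Fin p) (Fin q) ℝ} {D : ThinSVD p q}
    (h : D.IsSVDOf A) : Aᵀ * A * D.pinv = Aᵀ := by
  have hA : Aᵀ = D.V * (Matrix.diagonal D.σ * D.Uᵀ) := by
    conv_lhs => rw [h.eq]
    simp only [Matrix.transpose_mul, Matrix.transpose_transpose, Matrix.diagonal_transpose]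
  have e1 : A * D.pinv
      = D.U * (Matrix.diagonal D.σ * (Matrix.diagonal (fun k => (D.σ k)⁻¹) * D.Uᵀ)) := by
    conv_lhs => rw [h.eq]
    rw [ThinSVD.pinv, Matrix.mul_assoc, ← Matrix.mul_assoc D.Vᵀ, h.V_orthonormal, Matrix.one_mul,
      Matrix.mul_assoc]
  rw [Matrix.mul_assoc, e1, hA, Matrix.mul_assoc, Matrix.mul_assoc, ← Matrix.mul_assoc D.Uᵀ D.U,
    h.U_orthonormal, Matrix.one_mul]
  congr 1
  simp only [← Matrix.mul_assoc, Matrix.diagonal_mul_diagonal]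
  congr 2
  ext k
  by_cases h0 : D.σ k = 0
  · simp [h0]
  · field_simp

theorem Timed.val_solve (γ : ℕ) (S : SVDRoutine) {p q : ℕ} {κ : Type} [Fintype κ]
    (A : Matrix (Fin p) (Fin q) ℝ) (Y : Matrix (Fin p) κ ℝ) :
    (Timed.solve γ S A Y).val = (S.run A).pinv * Y := by
  have hZ : ∀ (D : ThinSVD p q) (W : Matrix (Fin (min p q)) κ ℝ), (Timed.tabulate fun i j => (do
      let b ← Timed.isZero (D.σ i)
      if b then pure 0 else Timed.div (W i j) (D.σ i) : Timed ℝ)).val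
      = Matrix.diagonal (fun k => (D.σ k)⁻¹) * W := by
    intro D W
    ext i j
    rw [Matrix.diagonal_mul, Timed.val_tabulate]
    -- The branch returning 0 agrees with the convention `0⁻¹ = 0` in `ThinSVD.pinv`.
    by_cases h : D.σ i = 0
    · simp [Timed.isZero, h]
    · simp [Timed.isZero, h, Timed.div, div_eq_inv_mul]
  simp only [Timed.solve, Timed.val_bind, Timed.val_matMul, hZ, Timed.svd, ThinSVD.pinv,
    Matrix.mul_assoc]


/-! ## The output of the recovery algorithm -/

theorem ThinSVD.IsSVDOf.pinv_mul_self {n : ℕ} {A : Matrix (Fin n) (Fin n) ℝ} {D : ThinSVD n n}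
    (h : D.IsSVDOf A) (hA : IsUnit A) : D.pinv * A = 1 := by
  have hG : IsUnit (Aᵀ * A) := ((Matrix.isUnit_transpose A).2 hA).mul hA
  refine hG.mul_left_cancel ?_
  rw [← Matrix.mul_assoc, h.gram_mul_pinv, Matrix.mul_one]

/-- The matrix whose singular vectors are computed in factor recovery. -/
def solvedFactor (S : SVDRoutine) {n : ℕ} {κ : Type} (W : ModeSensing n)
    (B : Matrix (Fin n) κ ℝ) : Matrix (Fin n) κ ℝ :=
  match W with
  | none => B
  | some D => (S.run D).pinv * B

/-- The invertible matrix of the uncompressed mode cancels exactly, so it has no influence on the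
error. -/
theorem solvedFactor_mul (S : SVDRoutine) {n : ℕ} {κ : Type} {W : ModeSensing n}
    (hW : IsUnit W.toMatrix) (Z : Matrix (Fin n) κ ℝ) : solvedFactor S W (W.toMatrix * Z) = Z := by
  match W, hW with
  | none, _ => exact Matrix.one_mul Z
  | some D, hW =>
    change (S.run D).pinv * (D * Z) = Z
    rw [← Matrix.mul_assoc, (S.isSVDOf D).pinv_mul_self hW, Matrix.one_mul]

/-- Under `hr` enough singular vectors exist and the padding by zeros never occurs. -/
theorem val_recoverFactor (γ : ℕ) (S : SVDRoutine) {n r : ℕ} {κ : Type} [Fintype κ]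
    (W : ModeSensing n) (B : Matrix (Fin n) κ ℝ) (hr : r ≤ min n (Fintype.card κ)) :
    (recoverFactor γ S r W B).val
      = (S.run ((solvedFactor S W B).submatrix id (Fintype.equivFin κ).symm)).leadingU hr := by
  have hk : ∀ k : Fin r, (k : ℕ) < min n (Fintype.card κ) := fun k => lt_of_lt_of_le k.2 hr
  match W with
  | none =>
    ext i k
    simp only [recoverFactor, Timed.val_bind, Timed.val_tabulate, Timed.val_pure, Timed.svd, hk,
      dif_pos]
    rfl
  | some D =>
    ext i k
    simp only [recoverFactor, Timed.val_bind, Timed.val_tabulate, Timed.val_pure, Timed.svd, hk,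
      dif_pos, Timed.val_solve]
    rfl

theorem recoverFactor_orthonormal (γ : ℕ) (S : SVDRoutine) {n r : ℕ} {κ : Type} [Fintype κ]
    (W : ModeSensing n) (B : Matrix (Fin n) κ ℝ) (hr : r ≤ min n (Fintype.card κ)) :
    (recoverFactor γ S r W B).valᵀ * (recoverFactor γ S r W B).val = 1 := by
  rw [val_recoverFactor γ S W B hr]
  exact (S.isSVDOf _).leadingU_orthonormal hr

section Core

variable (γ : ℕ) (S : SVDRoutine) {d n r mc : ℕ} (Φ : Fin d → Matrix (Fin mc) (Fin n) ℝ)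
  (Q : Fin d → Matrix (Fin n) (Fin r) ℝ)

/-- The pseudo-inverse of `Φ_k Q_k`. -/
def corePinv (k : Fin d) : Matrix (Fin r) (Fin mc) ℝ := (S.run (Φ k * Q k)).pinv

/-- The matrix by which mode `i` of the measured tensor has been multiplied after `k` iterations of
core recovery. -/
def stageMatrix (k : ℕ) (i : Fin d) : Matrix (Fin (stageSides d r mc k i)) (Fin n) ℝ := fun a b =>
  if h : (i : ℕ) < k then (corePinv S Φ Q i * Φ i) (Fin.cast (by simp [stageSides, h]) a) b
  else Φ i (Fin.cast (by simp [stageSides, h]) a) b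

/-- Each least squares solve is multiplication by one matrix in one mode, and operations in
different modes commute. Hence the loop collapses to a single modewise product. -/
theorem val_coreLoop (X : Tensor fun _ : Fin d => n) : ∀ (k : ℕ) (hk : k ≤ d),
    (coreLoop γ S Φ Q (coreMeasurement Φ X) k hk).val = modewiseProd X (stageMatrix S Φ Q k) := by
  intro k
  induction k with
  | zero =>
    intro hk
    ext y
    simp only [coreLoop, Timed.val_pure, coreMeasurement, modewiseProd]
    refine Finset.sum_congr rfl fun x _ => ?_
    congr 1
  | succ k ih =>
    intro hk
    have ih := ih (Nat.le_of_succ_le hk)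
    set κ : Fin d := ⟨k, hk⟩ with hκ
    have hloop : (coreLoop γ S Φ Q (coreMeasurement Φ X) (k + 1) hk).val
        = (coreStep γ S Φ Q κ
            (coreLoop γ S Φ Q (coreMeasurement Φ X) k (Nat.le_of_succ_le hk)).val).val := rfl
    rw [hloop, ih]
    ext y
    simp only [coreStep, Timed.val_bind, Timed.val_pure, Timed.val_matMul, Timed.val_solve]
    rw [Matrix.mul_apply]
    simp only [Matrix.submatrix_apply, id, unfold_modewiseProd_apply, Finset.mul_sum]
    rw [Finset.sum_comm, modewiseProd]
    refine Finset.sum_congr rfl fun x _ => ?_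
    have hself : stageMatrix S Φ Q (k + 1) κ (y κ) (x κ)
        = (corePinv S Φ Q κ * Φ κ) (Fin.cast (stageSides_succ_self d r mc κ) (y κ)) (x κ) := by
      have : (κ : ℕ) < k + 1 := Nat.lt_succ_self k
      rw [stageMatrix, dif_pos this]
    have hself' : ∀ a, stageMatrix S Φ Q k κ (Fin.cast (stageSides_self d r mc κ).symm a) (x κ)
        = Φ κ a (x κ) := by
      intro a
      have : ¬ (κ : ℕ) < k := lt_irrefl k
      rw [stageMatrix, dif_neg this]
      rfl
    have hne : ∀ j : {j : Fin d // j ≠ κ}, stageMatrix S Φ Q (k + 1) j (y j) (x j)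
        = stageMatrix S Φ Q k j (Fin.cast (stageSides_succ_of_ne d r mc κ j j.2) (y j)) (x j) := by
      intro j
      have h' : ((j : Fin d) : ℕ) ≠ k := fun e => j.2 (Fin.ext e)
      by_cases h : ((j : Fin d) : ℕ) < k
      · have h2 : ((j : Fin d) : ℕ) < k + 1 := by omega
        rw [stageMatrix, stageMatrix, dif_pos h2, dif_pos h]
        rfl
      · have h2 : ¬ ((j : Fin d) : ℕ) < k + 1 := by omega
        rw [stageMatrix, stageMatrix, dif_neg h2, dif_neg h]
        rfl
    rw [Fintype.prod_eq_mul_prod_subtype_ne _ κ, hself, Matrix.mul_apply,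
      Finset.sum_mul, Finset.sum_mul]
    refine Finset.sum_congr rfl fun a _ => ?_
    rw [Finset.prod_congr rfl fun j _ => hne j]
    have := hself' a
    rw [← this]
    simp only [corePinv]
    ring

end Core

section Output

variable (γ : ℕ) (S : SVDRoutine) {d n m mc r : ℕ} (W : Fin d → ModeSensing n)
  (ω : EnsembleIndex d n m mc → ℝ) (X : Tensor (fun _ : Fin d => n))

theorem card_cols (d m : ℕ) (k : Fin d) : Fintype.card (Cols (fun _ => m) k) = m ^ (d - 1) := by
  rw [Fintype.card_pi]
  simp

/-- The recovered factor matrices, as a function of the random entries. -/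
def recoveredFactor (r : ℕ) (ω : EnsembleIndex d n m mc → ℝ) (k : Fin d) :
    Matrix (Fin n) (Fin r) ℝ :=
  (recoverFactor γ S r (W k) (leaveOneOut k (W k).toMatrix (ensembleΩ ω k) X)).val

theorem sketchAndRecover_factor (k : Fin d) :
    (sketchAndRecover γ S r W ω X).factor k = recoveredFactor γ S W X r ω k := rfl

theorem sketchAndRecover_toTensor :
    (sketchAndRecover γ S r W ω X).toTensor = modewiseProd (t := fun _ => n) X fun i =>
      recoveredFactor γ S W X r ω i *
        corePinv S (ensembleΦ ω) (recoveredFactor γ S W X r ω) i * ensembleΦ ω i := by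
  have h : (sketchAndRecover γ S r W ω X).core = modewiseProd (t := fun _ => r) X fun i =>
      corePinv S (ensembleΦ ω) (recoveredFactor γ S W X r ω) i * ensembleΦ ω i := by
    ext y
    change (coreLoop γ S (ensembleΦ ω) (recoveredFactor γ S W X r ω)
      (coreMeasurement (ensembleΦ ω) X) d le_rfl).val _ = _
    rw [val_coreLoop, modewiseProd, modewiseProd]
    refine Finset.sum_congr rfl fun x _ => ?_
    congr 1
    refine Finset.prod_congr rfl fun i _ => ?_
    rw [stageMatrix, dif_pos i.2]
    rfl
  rw [TuckerFactors.toTensor, h, modewiseProd_modewiseProd]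
  congr 1
  ext1 i
  rw [sketchAndRecover_factor, Matrix.mul_assoc]

end Output


/-! ## Running time -/

theorem Timed.steps_tabulate_le {ι κ : Type} [Fintype ι] [Fintype κ] {f : ι → κ → Timed ℝ} {c : ℕ}
    (h : ∀ i j, (f i j).steps ≤ c) :
    (Timed.tabulate f).steps ≤ Fintype.card ι * (Fintype.card κ * (c + 1)) := by
  rw [Timed.steps_tabulate]
  refine (Finset.sum_le_sum fun i _ => Finset.sum_le_sum fun j _ =>
    Nat.succ_le_succ (h i j)).trans_eq ?_
  simp

theorem Timed.steps_solve_le (γ : ℕ) (S : SVDRoutine) {p q : ℕ} {κ : Type} [Fintype κ]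
    (A : Matrix (Fin p) (Fin q) ℝ) (Y : Matrix (Fin p) κ ℝ) :
    (Timed.solve γ S A Y).steps ≤ γ * (p * q * q) + q * (Fintype.card κ * (2 * p + 1))
      + q * (Fintype.card κ * 3) + q * (Fintype.card κ * (2 * q + 1)) := by
  have hmin : min p q ≤ q := min_le_right _ _
  have hZ : ∀ (D : ThinSVD p q) (W : Matrix (Fin (min p q)) κ ℝ), (Timed.tabulate fun i j => (do
      let b ← Timed.isZero (D.σ i)
      if b then pure 0 else Timed.div (W i j) (D.σ i) : Timed ℝ)).steps
      ≤ min p q * (Fintype.card κ * 3) := by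
    intro D W
    refine (Timed.steps_tabulate_le (c := 2) fun i j => ?_).trans_eq (by simp)
    by_cases h : D.σ i = 0
    · simp [Timed.isZero, h]
    · simp [Timed.isZero, h, Timed.div]
  simp only [Timed.solve, Timed.steps_bind, Timed.steps_matMul, Fintype.card_fin]
  have h1 : (Timed.svd γ S A).steps ≤ γ * (p * q * q) := by
    change γ * (p * q * min p q) ≤ _
    gcongr
  have h2 := hZ (Timed.svd γ S A).val (Timed.matMul (Timed.svd γ S A).val.Uᵀ Y).val
  have h3 : min p q * (Fintype.card κ * 3) ≤ q * (Fintype.card κ * 3) := by gcongr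
  have h4 : min p q * (Fintype.card κ * (2 * p + 1)) ≤ q * (Fintype.card κ * (2 * p + 1)) := by
    gcongr
  have h5 : q * (Fintype.card κ * (2 * min p q + 1)) ≤ q * (Fintype.card κ * (2 * q + 1)) := by
    gcongr
  linarith

/-- `G` bounds the number of sketched columns. A decomposition of an `n × q` matrix costs at most
order `n q²`, so the cost is linear in `n`. -/
theorem steps_recoverFactor_none_le (γ : ℕ) (S : SVDRoutine) {n : ℕ} {κ : Type} [Fintype κ]
    (r : ℕ) (B : Matrix (Fin n) κ ℝ) {G : ℕ} (hκ : Fintype.card κ ≤ G) (hG : 1 ≤ G) :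
    (recoverFactor γ S r none B).steps ≤ (1 + γ + r) * ((n + 1) * G ^ 2) := by
  have h0 : (recoverFactor γ S r none B).steps = n * Fintype.card κ
      + (γ * (n * Fintype.card κ * min n (Fintype.card κ)) + n * r) := by
    simp only [recoverFactor, Timed.steps_bind, Timed.steps_tabulate, Timed.svd, Timed.steps_pure]
    simp
  have hmin : min n (Fintype.card κ) ≤ G := (min_le_right _ _).trans hκ
  have hGG : G ≤ G ^ 2 := by nlinarith
  rw [h0]
  have h1 : n * Fintype.card κ ≤ (n + 1) * G ^ 2 :=
    Nat.mul_le_mul (Nat.le_succ n) (hκ.trans hGG)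
  have h2 : n * Fintype.card κ * min n (Fintype.card κ) ≤ (n + 1) * G ^ 2 := by
    rw [mul_assoc, sq]
    exact Nat.mul_le_mul (Nat.le_succ n) (Nat.mul_le_mul hκ hmin)
  have h3 : n * r ≤ r * ((n + 1) * G ^ 2) := by
    rw [mul_comm]
    refine Nat.mul_le_mul_left r ?_
    nlinarith
  have h4 := Nat.mul_le_mul_left γ h2
  nlinarith

/-- A dense `n × n` system needs a decomposition of cost order `n³`, which dominates. -/
theorem steps_recoverFactor_le (γ : ℕ) (S : SVDRoutine) {n : ℕ} {κ : Type} [Fintype κ]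
    (r : ℕ) (W : ModeSensing n) (B : Matrix (Fin n) κ ℝ) {G : ℕ} (hκ : Fintype.card κ ≤ G)
    (hG : 1 ≤ G) :
    (recoverFactor γ S r W B).steps ≤ (8 + 2 * γ + r) * ((n + 1) ^ 3 * G ^ 2) := by
  have hGG : G ≤ G ^ 2 := by nlinarith
  have hn : n + 1 ≤ (n + 1) ^ 3 := Nat.le_self_pow (by norm_num) _
  match W with
  | none =>
    refine (steps_recoverFactor_none_le γ S r B hκ hG).trans ?_
    exact Nat.mul_le_mul (by omega) (Nat.mul_le_mul_right _ hn)
  | some D =>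
    have h0 : (recoverFactor γ S r (some D) B).steps = (Timed.solve γ S D B).steps
        + (γ * (n * Fintype.card κ * min n (Fintype.card κ)) + n * r) := by
      simp only [recoverFactor, Timed.steps_bind, Timed.steps_tabulate, Timed.svd,
        Timed.steps_pure]
      simp
    have hmin : min n (Fintype.card κ) ≤ G := (min_le_right _ _).trans hκ
    have hs := Timed.steps_solve_le γ S D B
    set q := Fintype.card κ with hq
    set N := (n + 1) ^ 3 * G ^ 2 with hN
    have hq2 : q ≤ G ^ 2 := hκ.trans hGG
    have hG2 : 1 ≤ G ^ 2 := hG.trans hGG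
    have k1 : n * n * n ≤ N := by
      calc n * n * n = n ^ 3 * 1 := by ring
        _ ≤ N := Nat.mul_le_mul (Nat.pow_le_pow_left (Nat.le_succ n) 3) hG2
    have k2 : n * (q * (2 * n + 1)) ≤ 2 * N := by
      calc n * (q * (2 * n + 1)) = n * (2 * n + 1) * q := by ring
        _ ≤ (2 * (n + 1) ^ 3) * G ^ 2 := Nat.mul_le_mul (by ring_nf; nlinarith) hq2
        _ = 2 * N := by rw [hN]; ring
    have k3 : n * (q * 3) ≤ 3 * N := by
      calc n * (q * 3) = 3 * (n * q) := by ring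
        _ ≤ 3 * N := Nat.mul_le_mul_left 3 (Nat.mul_le_mul ((Nat.le_succ n).trans hn) hq2)
    have k4 : n * q * min n q ≤ N := by
      rw [mul_assoc, hN, sq]
      exact Nat.mul_le_mul ((Nat.le_succ n).trans hn) (Nat.mul_le_mul hκ hmin)
    have k5 : n * r ≤ r * N := by
      rw [mul_comm]
      refine Nat.mul_le_mul_left r ?_
      calc n = n * 1 := (mul_one n).symm
        _ ≤ N := Nat.mul_le_mul ((Nat.le_succ n).trans hn) hG2
    have k6 := Nat.mul_le_mul_left γ k1
    have k7 := Nat.mul_le_mul_left γ k4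
    rw [h0]
    nlinarith

theorem stageSides_le {d r mc k : ℕ} (hr : r ≤ mc) (i : Fin d) : stageSides d r mc k i ≤ mc := by
  unfold stageSides
  split_ifs <;> omega

/-- `n` enters only through the product `Φ k * Q k`; the least squares problem itself has sides `mc`
and `r`. -/
theorem steps_coreStep_le (γ : ℕ) (S : SVDRoutine) {d n r mc : ℕ} (hr : r ≤ mc)
    (Φ : Fin d → Matrix (Fin mc) (Fin n) ℝ) (Q : Fin d → Matrix (Fin n) (Fin r) ℝ) (k : Fin d)
    (T : Tensor (stageSides d r mc k)) {G : ℕ} (hG : 1 ≤ G) (hmc : mc ≤ G)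
    (hmcd : mc ^ (d - 1) ≤ G) :
    (coreStep γ S Φ Q k T).steps ≤ (γ + 12) * ((n + 1) * G ^ 3) := by
  have hcard : Fintype.card (Cols (stageSides d r mc k) k) ≤ G := by
    rw [Fintype.card_pi]
    refine le_trans (Finset.prod_le_prod' (g := fun _ => mc) fun j _ => ?_) ?_
    · rw [Fintype.card_fin]; exact stageSides_le hr _
    · simpa using hmcd
  simp only [coreStep, Timed.steps_bind, Timed.steps_pure, Timed.steps_matMul, Fintype.card_fin]
  have hs := Timed.steps_solve_le γ S (Timed.matMul (Φ k) (Q k)).val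
    ((unfold k T).submatrix (Fin.cast (stageSides_self d r mc k).symm) id)
  set q := Fintype.card (Cols (stageSides d r mc k) k)
  have hr' : r ≤ G := hr.trans hmc
  set N := (n + 1) * G ^ 3 with hN
  have hGN : G ^ 3 ≤ N := Nat.le_mul_of_pos_left _ (Nat.succ_pos n)
  have k1 : mc * (r * (2 * n + 1)) ≤ 2 * N := by
    calc mc * (r * (2 * n + 1)) ≤ G * (G * (2 * (n + 1))) := by gcongr; omega
      _ = 2 * (n + 1) * (G ^ 2) := by ring
      _ ≤ 2 * (n + 1) * G ^ 3 := Nat.mul_le_mul_left _ (Nat.pow_le_pow_right hG (by norm_num))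
      _ = 2 * N := by rw [hN]; ring
  have k2 : mc * r * r ≤ N := by
    calc mc * r * r ≤ G * G * G := by gcongr
      _ = G ^ 3 := by ring
      _ ≤ N := hGN
  have k3 : ∀ x ≤ G, r * (q * (2 * x + 1)) ≤ 3 * N := by
    intro x hx
    calc r * (q * (2 * x + 1)) ≤ G * (G * (3 * G)) := by gcongr; omega
      _ = 3 * G ^ 3 := by ring
      _ ≤ 3 * N := Nat.mul_le_mul_left 3 hGN
  have k4 : r * (q * 3) ≤ 3 * N := by
    calc r * (q * 3) ≤ G * (G * (3 * G)) := by gcongr; omega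
      _ = 3 * G ^ 3 := by ring
      _ ≤ 3 * N := Nat.mul_le_mul_left 3 hGN
  have k5 := k3 mc hmc
  have k6 := k3 r hr'
  have k7 := Nat.mul_le_mul_left γ k2
  nlinarith

theorem steps_coreLoop_le (γ : ℕ) (S : SVDRoutine) {d n r mc : ℕ} (hr : r ≤ mc)
    (Φ : Fin d → Matrix (Fin mc) (Fin n) ℝ) (Q : Fin d → Matrix (Fin n) (Fin r) ℝ)
    (Bc : Tensor (fun _ : Fin d => mc)) {G : ℕ} (hG : 1 ≤ G) (hmc : mc ≤ G)
    (hmcd : mc ^ (d - 1) ≤ G) : ∀ (k : ℕ) (hk : k ≤ d),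
    (coreLoop γ S Φ Q Bc k hk).steps ≤ k * ((γ + 12) * ((n + 1) * G ^ 3)) := by
  intro k
  induction k with
  | zero => intro hk; simp [coreLoop]
  | succ k ih =>
    intro hk
    have h1 := ih (Nat.le_of_succ_le hk)
    have h2 := steps_coreStep_le γ S hr Φ Q ⟨k, hk⟩
      (coreLoop γ S Φ Q Bc k (Nat.le_of_succ_le hk)).val hG hmc hmcd
    have h3 : (coreLoop γ S Φ Q Bc (k + 1) hk).steps
        = (coreLoop γ S Φ Q Bc k (Nat.le_of_succ_le hk)).steps
          + (coreStep γ S Φ Q ⟨k, hk⟩ (coreLoop γ S Φ Q Bc k (Nat.le_of_succ_le hk)).val).steps :=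
      rfl
    rw [h3, Nat.succ_mul]
    exact Nat.add_le_add h1 h2

/-- The exponent `e` unifies the two cases: 1 suffices for identity matrices, 3 for dense ones. -/
theorem steps_onePassRecovery_le (γ : ℕ) (S : SVDRoutine) {d n m mc : ℕ} (r : ℕ) (hr : r ≤ mc)
    (W : Fin d → ModeSensing n) (Φ : Fin d → Matrix (Fin mc) (Fin n) ℝ)
    (B : ∀ k : Fin d, Matrix (Fin n) (Cols (fun _ => m) k) ℝ) (Bc : Tensor (fun _ : Fin d => mc))
    {G : ℕ} (hG : 1 ≤ G) (hm : m ^ (d - 1) ≤ G) (hmc : mc ≤ G) (hmcd : mc ^ (d - 1) ≤ G) {e : ℕ}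
    (he : 1 ≤ e) (hW : (∀ k, W k = none) ∨ 3 ≤ e) :
    (onePassRecovery γ S r W Φ B Bc).steps
      ≤ d * (3 * γ + r + 20) * ((n + 1) ^ e * G ^ 3) := by
  have h1 : ∀ k, (recoverFactor γ S r (W k) (B k)).steps
      ≤ (8 + 2 * γ + r) * ((n + 1) ^ e * G ^ 3) := by
    intro k
    have hcard : Fintype.card (Cols (fun _ => m) k) ≤ G := by rw [card_cols]; exact hm
    have hG3 : G ^ 2 ≤ G ^ 3 := Nat.pow_le_pow_right hG (by norm_num)
    rcases hW with hW | hW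
    · rw [hW k]
      refine (steps_recoverFactor_none_le γ S r (B k) hcard hG).trans ?_
      refine Nat.mul_le_mul (by omega) (Nat.mul_le_mul ?_ hG3)
      exact Nat.le_self_pow (by omega) _
    · refine (steps_recoverFactor_le γ S r (W k) (B k) hcard hG).trans ?_
      refine Nat.mul_le_mul_left _ (Nat.mul_le_mul ?_ hG3)
      exact Nat.pow_le_pow_right (Nat.succ_pos n) hW
  have h2 := steps_coreLoop_le γ S hr Φ (fun k => (recoverFactor γ S r (W k) (B k)).val) Bc hG hmc
    hmcd d le_rfl
  have h3 : (onePassRecovery γ S r W Φ B Bc).steps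
      = (∑ k, (recoverFactor γ S r (W k) (B k)).steps)
        + ((coreLoop γ S Φ (fun k => (recoverFactor γ S r (W k) (B k)).val) Bc d le_rfl).steps + 0) :=
    rfl
  have h4 : (n + 1) * G ^ 3 ≤ (n + 1) ^ e * G ^ 3 :=
    Nat.mul_le_mul_right _ (Nat.le_self_pow (by omega) _)
  have h5 := Finset.sum_le_sum fun k (_ : k ∈ Finset.univ) => h1 k
  rw [Finset.sum_const, Finset.card_univ, Fintype.card_fin, smul_eq_mul] at h5
  have h6 := Nat.mul_le_mul_left (d * (γ + 12)) h4
  rw [h3]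
  nlinarith

/-- The sketching dimension grows logarithmically in `n`. -/
theorem sketchBound_isBigO_log (C : ℝ) (r : ℕ) {d : ℕ} (hd : 0 < d) (ε : ℝ) {δ : ℝ} (hδ : 0 < δ) :
    (fun n : ℕ => sketchBound C r d n ε δ) =O[Filter.atTop] fun n : ℕ => Real.log n := by
  unfold sketchBound
  refine IsBigO.const_mul_left ?_ _
  have hconst : (fun _ : ℕ => Real.log (d / δ)) =O[Filter.atTop] fun n : ℕ => Real.log n :=
    ((isLittleO_const_left.2 (Or.inr (tendsto_norm_atTop_atTop.comp
      (Real.tendsto_log_atTop.comp tendsto_natCast_atTop_atTop))))).isBigO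
  have hmain : (fun n : ℕ => Real.log (d / δ) + d * Real.log n) =O[Filter.atTop]
      fun n : ℕ => Real.log n :=
    hconst.add ((isBigO_refl _ _).const_mul_left _)
  refine hmain.congr' ?_ Filter.EventuallyEq.rfl
  filter_upwards [Filter.eventually_ge_atTop 1] with n hn
  have hn' : (0 : ℝ) < n := by exact_mod_cast hn
  have hd' : (0 : ℝ) < d := by exact_mod_cast hd
  rw [mul_div_right_comm, Real.log_mul (by positivity) (by positivity), Real.log_pow]

/-- Since `e < d`, a whole factor `n` is left to absorb the power of `log n`. -/
theorem isLittleO_pow_of_isBigO_log {s : ℕ → ℕ}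
    (hs : (fun n => (s n : ℝ)) =O[Filter.atTop] fun n : ℕ => Real.log n) (b e A : ℕ) {d : ℕ}
    (hed : e < d) :
    (fun n : ℕ => ((A * ((n + 1) ^ e * ((s n + 1) ^ b) ^ 3) : ℕ) : ℝ)) =o[Filter.atTop]
      fun n : ℕ => (n : ℝ) ^ d := by
  have hlog : (fun n : ℕ => Real.log n ^ (b * 3)) =o[Filter.atTop] fun n : ℕ => (n : ℝ) :=
    (Real.isLittleO_pow_log_id_atTop (n := b * 3)).comp_tendsto tendsto_natCast_atTop_atTop
  have hone : (fun _ : ℕ => (1 : ℝ)) =O[Filter.atTop] fun n : ℕ => Real.log n :=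
    ((isLittleO_const_left.2 (Or.inr (tendsto_norm_atTop_atTop.comp
      (Real.tendsto_log_atTop.comp tendsto_natCast_atTop_atTop))))).isBigO
  have h1 : (fun n : ℕ => ((s n : ℝ) + 1) ^ (b * 3)) =o[Filter.atTop] fun n : ℕ => (n : ℝ) :=
    ((hs.add hone).pow _).trans_isLittleO hlog
  have h2 : (fun n : ℕ => ((n : ℝ) + 1) ^ e) =O[Filter.atTop] fun n : ℕ => (n : ℝ) ^ e := by
    refine IsBigO.pow ?_ e
    refine (isBigO_refl _ _).add (IsBigO.of_bound 1 ?_)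
    filter_upwards [Filter.eventually_ge_atTop 1] with n hn
    simpa using (by exact_mod_cast hn : (1 : ℝ) ≤ n)
  have h3 : (fun n : ℕ => (n : ℝ) ^ e * n) =O[Filter.atTop] fun n : ℕ => (n : ℝ) ^ d := by
    refine IsBigO.of_bound 1 ?_
    filter_upwards [Filter.eventually_ge_atTop 1] with n hn
    have : (1 : ℝ) ≤ n := by exact_mod_cast hn
    rw [← pow_succ, one_mul, Real.norm_of_nonneg (by positivity), Real.norm_of_nonneg (by positivity)]
    exact pow_le_pow_right₀ this hed
  have h4 := ((h2.mul_isLittleO h1).trans_isBigO h3).const_mul_left (A : ℝ)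
  refine h4.congr_left fun n => ?_
  push_cast
  rw [pow_mul]


/-! ## Measurability of matrix-valued maps -/

/-- All entries of a matrix-valued map are measurable. -/
def MeasurableEntries {Ω ι κ : Type} [MeasurableSpace Ω] (A : Ω → Matrix ι κ ℝ) : Prop :=
  ∀ i j, Measurable fun ω => A ω i j

namespace MeasurableEntries

variable {Ω ι κ τ : Type} [MeasurableSpace Ω]

theorem mul [Fintype κ] {A : Ω → Matrix ι κ ℝ} {B : Ω → Matrix κ τ ℝ} (hA : MeasurableEntries A)
    (hB : MeasurableEntries B) : MeasurableEntries fun ω => A ω * B ω := fun i j => by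
  simp only [Matrix.mul_apply]
  exact Finset.measurable_sum _ fun k _ => (hA i k).mul (hB k j)

theorem sub {A B : Ω → Matrix ι κ ℝ} (hA : MeasurableEntries A) (hB : MeasurableEntries B) :
    MeasurableEntries fun ω => A ω - B ω := fun i j => (hA i j).sub (hB i j)

theorem const (A : Matrix ι κ ℝ) : MeasurableEntries fun _ : Ω => A := fun _ _ => measurable_const

theorem transpose {A : Ω → Matrix ι κ ℝ} (hA : MeasurableEntries A) :
    MeasurableEntries fun ω => (A ω)ᵀ := fun i j => hA j i

theorem submatrix {ι' κ' : Type} {A : Ω → Matrix ι κ ℝ} (hA : MeasurableEntries A) (f : ι' → ι)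
    (g : κ' → κ) : MeasurableEntries fun ω => (A ω).submatrix f g := fun i j => hA (f i) (g j)

theorem frobSq [Fintype ι] [Fintype κ] {A : Ω → Matrix ι κ ℝ} (hA : MeasurableEntries A) :
    Measurable fun ω => frobSq (A ω) :=
  Finset.measurable_sum _ fun i _ => Finset.measurable_sum _ fun j _ => (hA i j).pow_const 2

theorem svd_U (S : SVDRoutine) {p q : ℕ} {A : Ω → Matrix (Fin p) (Fin q) ℝ}
    (hA : MeasurableEntries A) : MeasurableEntries fun ω => (S.run (A ω)).U := fun i k =>
  (S.measurable_U p q i k).comp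
    (measurable_pi_lambda _ fun i => measurable_pi_lambda _ fun j => hA i j)

theorem svd_pinv (S : SVDRoutine) {p q : ℕ} {A : Ω → Matrix (Fin p) (Fin q) ℝ}
    (hA : MeasurableEntries A) : MeasurableEntries fun ω => (S.run (A ω)).pinv := by
  have hA' : Measurable fun ω => (fun i j => A ω i j : Fin p → Fin q → ℝ) :=
    measurable_pi_lambda _ fun i => measurable_pi_lambda _ fun j => hA i j
  refine mul (fun i k => (S.measurable_V p q i k).comp hA') (mul (fun i k => ?_) (svd_U S hA).transpose)
  by_cases h : i = k
  · subst h
    simp only [Matrix.diagonal_apply_eq]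
    exact ((S.measurable_σ p q i).comp hA').inv
  · simp [Matrix.diagonal_apply_ne _ h]

end MeasurableEntries

/-! ## The number of bad events -/

/-- The elementary inequalities behind the choice of the sketching dimension. -/
theorem sketch_exponent_bounds {c C L t : ℝ} {r d : ℕ} {ε : ℝ} {s : ℕ} (hc : 0 < c)
    (hC : C = 6400 / c + 2) (hr : 1 ≤ r) (hd : 2 ≤ d) (hε : 0 < ε) (hε1 : ε < 1) (ht : 1 ≤ t)
    (hL : L = C * r * d ^ 2 / ε ^ 2 * t) (hs : s = ⌊L⌋₊) :
    (r : ℝ) ≤ s ∧ (s : ℝ) ≤ L ∧ 8 * t ≤ c * s * (ε / (100 * d ^ 2 * r) * ε) ∧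
      8 * (r * t) ≤ c * s * (ε / (400 * d ^ 2) * ε) := by
  have hr' : (1 : ℝ) ≤ r := by exact_mod_cast hr
  have hd' : (2 : ℝ) ≤ d := by exact_mod_cast hd
  -- Here `6400 = 8 · 400 · 2`, where 8 and 400 stand in the last bound and 2 is lost by the floor.
  -- The summand 2 gives `2 r ≤ L`, so the floor loses at most half and stays at least `r`.
  have hCc : 6400 / c ≤ C := by rw [hC]; linarith
  have hC2 : 2 ≤ C := by rw [hC]; have : 0 < 6400 / c := by positivity
                         linarith
  have hC0 : 0 < C := by linarith
  have hε2 : ε ^ 2 ≤ 1 := by nlinarith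
  have hbase : C * r ≤ L := by
    rw [hL]
    have h1 : C * r ≤ C * r * d ^ 2 := by
      have : (1 : ℝ) ≤ (d : ℝ) ^ 2 := by nlinarith
      exact le_mul_of_one_le_right (by positivity) this
    have h2 : C * r * d ^ 2 ≤ C * r * d ^ 2 / ε ^ 2 := by
      rw [le_div_iff₀ (by positivity)]
      exact mul_le_of_le_one_right (by positivity) hε2
    exact h1.trans (h2.trans (le_mul_of_one_le_right (by positivity) ht))
  have hL0 : 0 ≤ L := le_trans (by positivity) hbase
  have hL2 : 2 ≤ L := by nlinarith
  have hsL : (s : ℝ) ≤ L := by rw [hs]; exact Nat.floor_le hL0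
  have hLs : L / 2 ≤ s := by
    have := Nat.lt_floor_add_one L
    rw [← hs] at this
    linarith
  refine ⟨?_, hsL, ?_, ?_⟩
  · have : (r : ℝ) ≤ L / 2 := by nlinarith
    linarith
  · have h1 : c * (L / 2) * (ε / (100 * d ^ 2 * r) * ε) = c * C / 200 * t := by
      rw [hL]; field_simp; norm_num
    have h2 : 6400 ≤ c * C := by
      rw [div_le_iff₀ hc] at hCc
      linarith
    calc 8 * t ≤ c * C / 200 * t := by nlinarith
      _ = c * (L / 2) * (ε / (100 * d ^ 2 * r) * ε) := h1.symm
      _ ≤ _ := by gcongr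
  · have h1 : c * (L / 2) * (ε / (400 * d ^ 2) * ε) = c * C / 800 * (r * t) := by
      rw [hL]; field_simp; norm_num
    have h2 : 6400 ≤ c * C := by
      rw [div_le_iff₀ hc] at hCc
      linarith
    have h3 : 0 ≤ r * t := by positivity
    calc 8 * (r * t) ≤ c * C / 800 * (r * t) := by nlinarith
      _ = c * (L / 2) * (ε / (400 * d ^ 2) * ε) := h1.symm
      _ ≤ _ := by gcongr

/-- `T` stands for `d nᵈ / δ`, which dominates `n`, `r`, `d` and `d / δ`. The failure probability
`T⁻⁸` beats the `T²` pairs, and `T⁻⁸ʳ` beats the grid because `32 r + 1 ≤ T³`. Each part is at most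
`1/(4T)`, together `1/(2T) ≤ δ/(2d)`. -/
theorem union_count_le {T a : ℝ} {r d : ℕ} {δ : ℝ} (hT : 6 ≤ T) (hd : 0 < d) (hδ : 0 < δ)
    (hr : 1 ≤ r) (hrT : (r : ℝ) ≤ T) (hdT : d / δ ≤ T) (hdT' : (d : ℝ) ≤ T)
    (ha : a ≤ T ^ 2) :
    2 * a * (2 * d * Real.exp (-(8 * Real.log T)))
      + (32 * r + 1) ^ r * (2 * d * Real.exp (-(8 * (r * Real.log T)))) ≤ δ / (2 * d) := by
  have hT0 : 0 < T := by linarith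
  have hd' : (0 : ℝ) < d := by exact_mod_cast hd
  have hr' : (1 : ℝ) ≤ r := by exact_mod_cast hr
  have e1 : Real.exp (-(8 * Real.log T)) = (T ^ 8)⁻¹ := by
    rw [Real.exp_neg, show 8 * Real.log T = Real.log (T ^ 8) by rw [Real.log_pow]; norm_num,
      Real.exp_log (by positivity)]
  have e2 : Real.exp (-(8 * (r * Real.log T))) = ((T ^ 8) ^ r)⁻¹ := by
    rw [Real.exp_neg, show 8 * (r * Real.log T) = Real.log ((T ^ 8) ^ r) by
      rw [Real.log_pow, Real.log_pow]; push_cast; ring, Real.exp_log (by positivity)]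
  have hδd : 1 / (2 * T) ≤ δ / (2 * d) := by
    rw [div_le_div_iff₀ (by positivity) (by positivity)]
    rw [div_le_iff₀ hδ] at hdT
    linarith
  have hT36 : 36 ≤ T ^ 2 := by nlinarith
  have h1 : 2 * a * (2 * d * (T ^ 8)⁻¹) ≤ 1 / (4 * T) := by
    have : 2 * a * (2 * d * (T ^ 8)⁻¹) ≤ 2 * T ^ 2 * (2 * T * (T ^ 8)⁻¹) := by gcongr
    refine this.trans ?_
    rw [show 2 * T ^ 2 * (2 * T * (T ^ 8)⁻¹) = 4 / T ^ 5 by field_simp; norm_num,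
      div_le_div_iff₀ (by positivity) (by positivity)]
    nlinarith [pow_pos hT0 3, pow_pos hT0 5]
  have h2 : (32 * r + 1 : ℝ) ^ r * (2 * d * ((T ^ 8) ^ r)⁻¹) ≤ 1 / (4 * T) := by
    have h3 : (32 * r + 1 : ℝ) ≤ T ^ 3 := by nlinarith
    have h4 : (32 * r + 1 : ℝ) ^ r ≤ (T ^ 3) ^ r := by gcongr
    have h5 : (T ^ 3) ^ r * ((T ^ 8) ^ r)⁻¹ = ((T ^ 5)⁻¹) ^ r := by
      rw [← inv_pow, ← mul_pow]; congr 1; field_simp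
    have h6 : ((T ^ 5)⁻¹) ^ r ≤ (T ^ 5)⁻¹ := by
      refine pow_le_of_le_one (by positivity) ?_ (by omega)
      exact inv_le_one_of_one_le₀ (one_le_pow₀ (by linarith))
    calc _ ≤ (T ^ 3) ^ r * (2 * T * ((T ^ 8) ^ r)⁻¹) := by gcongr
      _ = 2 * T * ((T ^ 3) ^ r * ((T ^ 8) ^ r)⁻¹) := by ring
      _ ≤ 2 * T * (T ^ 5)⁻¹ := by rw [h5]; gcongr
      _ = 2 / T ^ 4 := by field_simp
      _ ≤ 1 / (4 * T) := by
          rw [div_le_div_iff₀ (by positivity) (by positivity)]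
          nlinarith [pow_pos hT0 2]
  rw [e1, e2]
  refine le_trans (add_le_add h1 h2) (le_trans (le_of_eq ?_) hδd)
  field_simp
  norm_num


/-! ## Factor recovery -/

/-- The coordinates read by `Ω_{(k,j)}`. -/
def idxΩ {d n m mc : ℕ} (k : Fin d) (j : {j : Fin d // j ≠ k}) (ab : Fin m × Fin n) :
    EnsembleIndex d n m mc := Sum.inl (⟨k, j⟩, ab.1, ab.2)

/-- The coordinates read by `Φ_k`. -/
def idxΦ {d n m mc : ℕ} (k : Fin d) (ab : Fin mc × Fin n) : EnsembleIndex d n m mc :=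
  Sum.inr (k, ab.1, ab.2)

theorem idxΩ_injective {d n m mc : ℕ} (k : Fin d) (j : {j : Fin d // j ≠ k}) :
    Function.Injective (idxΩ (n := n) (m := m) (mc := mc) k j) := by
  rintro ⟨a, b⟩ ⟨a', b'⟩ h
  simpa [idxΩ] using h

theorem idxΦ_injective {d n m mc : ℕ} (k : Fin d) :
    Function.Injective (idxΦ (n := n) (m := m) (mc := mc) k) := by
  rintro ⟨a, b⟩ ⟨a', b'⟩ h
  simpa [idxΦ] using h

theorem measurable_ensembleΩ {d n m mc : ℕ} (k : Fin d) (j : {j : Fin d // j ≠ k}) :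
    MeasurableEntries fun ω : EnsembleIndex d n m mc → ℝ => ensembleΩ ω k j :=
  fun _ _ => (measurable_pi_apply _).div_const _

theorem measurable_ensembleΦ {d n m mc : ℕ} (k : Fin d) :
    MeasurableEntries fun ω : EnsembleIndex d n m mc → ℝ => ensembleΦ ω k :=
  fun _ _ => (measurable_pi_apply _).div_const _

section Factor

variable {d n m mc : ℕ}

/-- Deterministic part of factor recovery. -/
theorem frobSq_sub_recoverFactor_le (γ : ℕ) (S : SVDRoutine) {κ κ' : Type} [Fintype κ] [Fintype κ']
    {r : ℕ} (hr0 : 0 < r) {W : ModeSensing n} (hW : IsUnit W.toMatrix) (A : Matrix (Fin n) κ ℝ)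
    (R : Matrix κ' κ ℝ) (hr : r ≤ min n (Fintype.card κ)) (hr' : r ≤ min n (Fintype.card κ'))
    {D : ThinSVD n (Fintype.card κ)} (hD : D.IsSVDOf (A.submatrix id (Fintype.equivFin κ).symm))
    {V : Matrix κ (Fin (min n (Fintype.card κ))) ℝ}
    (hV : V = D.V.submatrix (Fintype.equivFin κ) id)
    {θ θ₁ : ℝ} (hθ : 0 ≤ θ) (hθ₁ : 0 ≤ θ₁) (hθθ : Real.sqrt r * θ₁ ≤ θ)
    (hquad : ∀ u, |u ⬝ᵥ gramErr R (V.submatrix id (Fin.castLE hr)) (V.submatrix id (Fin.castLE hr))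
      *ᵥ u| ≤ θ * (u ⬝ᵥ u))
    (hent : ∀ a b, |gramErr R V V a b| ≤ θ₁) :
    (1 - 5 * θ) * frobSq (A - (recoverFactor γ S r W (W.toMatrix * A * Rᵀ)).val *
        ((recoverFactor γ S r W (W.toMatrix * A * Rᵀ)).valᵀ * A)) ≤ (1 + θ) * D.tailSq hr := by
  have hQ := recoverFactor_orthonormal γ S W (W.toMatrix * A * Rᵀ) hr'
  have hval := val_recoverFactor γ S W (W.toMatrix * A * Rᵀ) hr'
  -- Solving leaves `A * Rᵀ`, so `Q` spans its best rank-`r` approximation and Eckart–Young can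
  -- compare it with the leading singular vectors of `A`.
  rw [Matrix.mul_assoc, solvedFactor_mul S hW, ← Matrix.mul_assoc] at hval
  set Q := (recoverFactor γ S r W (W.toMatrix * A * Rᵀ)).val with hQdef
  have hVV : Vᵀ * V = 1 := by
    rw [hV, Matrix.transpose_submatrix, Matrix.submatrix_mul_equiv, hD.V_orthonormal,
      Matrix.submatrix_one _ Function.injective_id]
  have hinj : Function.Injective (tailIdx hr) := fun a b hab => by
    simpa [tailIdx, Fin.ext_iff] using hab
  have hdis : ∀ a b, Fin.castLE hr a ≠ tailIdx hr b := fun a b => by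
    simp only [ne_eq, Fin.ext_iff, Fin.val_castLE, tailIdx]; omega
  have hsub : ∀ {τ : Type} [Fintype τ] {q : ℕ} (e : Fin q ≃ τ) (F : Matrix (Fin n) τ ℝ)
      (P : Matrix (Fin n) (Fin r) ℝ),
      frobSq (F.submatrix id e - P * (Pᵀ * F.submatrix id e)) = frobSq (F - P * (Pᵀ * F)) := by
    intro τ _ q e F P
    rw [← frobSq_submatrix (F - P * (Pᵀ * F)) (Equiv.refl _) e]
    rfl
  have hA : A = D.leadingU hr * Matrix.diagonal (fun k => D.σ (Fin.castLE hr k)) *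
          (V.submatrix id (Fin.castLE hr))ᵀ
        + D.U.submatrix id (tailIdx hr) * Matrix.diagonal (fun k => D.σ (tailIdx hr k)) *
          (V.submatrix id (tailIdx hr))ᵀ := by
    have h1 : A = (A.submatrix id (Fintype.equivFin κ).symm).submatrix id (Fintype.equivFin κ) := by
      ext i j
      simp
    rw [h1, hD.eq_add hr, hV]
    rfl
  refine frobSq_sub_proj_le_of_gramErr hr0 (hD.leadingU_orthonormal hr)
    (submatrix_gram_of_injective hD.U_orthonormal hinj)
    (submatrix_gram_of_disjoint hD.U_orthonormal hdis)
    (submatrix_gram_of_injective hVV (Fin.castLE_injective hr))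
    (submatrix_gram_of_injective hVV hinj) (submatrix_gram_of_disjoint hVV hdis) hA hθ hθ₁ hθθ
    hquad (fun a b => ?_) (fun a b => ?_) hQ ?_ ?_
  · rw [gramErr_submatrix]; exact hent _ _
  · rw [gramErr_submatrix]; exact hent _ _
  · rw [← hsub (Fintype.equivFin κ).symm]
    exact hD.tailSq_le hr hQ (by simp)
  · rw [← hsub (Fintype.equivFin κ').symm, ← hsub (Fintype.equivFin κ').symm, hval]
    exact (S.isSVDOf _).frobSq_sub_leadingU_le hr' (hD.leadingU_orthonormal hr) (by simp)

variable {K : ℝ≥0} (ν : EnsembleIndex d n m mc → Measure ℝ) [∀ e, IsProbabilityMeasure (ν e)]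

/-- There are `d - 1` factors, so distortion `θ/(2d)` in each sums to at most `θ/2`. -/
theorem measure_kronOthers_distortion_le {p : ℝ≥0∞} {θ : ℝ} (hθ : 0 ≤ θ) (hθ1 : θ ≤ 1)
    (k : Fin d)
    (hJL : ∀ {e : Fin m × Fin n → EnsembleIndex d n m mc}, Function.Injective e →
      ∀ {κ : Type} [Fintype κ] (Y : Matrix (Fin n) κ ℝ),
      Measure.pi ν {ω | θ / (2 * d) * frobSq Y < |frobSq (coordMatrix e ω * Y) - frobSq Y|} ≤ p)
    (y : Cols (fun _ : Fin d => n) k → ℝ) :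
    Measure.pi ν {ω | θ * (y ⬝ᵥ y) < |(kronOthers k (ensembleΩ ω k) *ᵥ y) ⬝ᵥ
      (kronOthers k (ensembleΩ ω k) *ᵥ y) - y ⬝ᵥ y|} ≤ d * p := by
  have hd : 0 < d := k.pos
  have hd' : (0 : ℝ) < d := by exact_mod_cast hd
  have hcard : Fintype.card {j : Fin d // j ≠ k} = d - 1 := by simp
  have hle : ((d - 1 : ℕ) : ℝ) ≤ d := by exact_mod_cast Nat.sub_le d 1
  have h := measure_frobSq_kron_distortion_le ν (ι := {j : Fin d // j ≠ k}) (m := m) (n := n)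
    (η := θ / (2 * d)) (θ := θ) (p := p) (by positivity)
    (by
      rw [hcard]
      calc ((d - 1 : ℕ) : ℝ) * (θ / (2 * d)) ≤ d * (θ / (2 * d)) := by gcongr
        _ = θ / 2 := by field_simp)
    (by
      rw [div_le_one (by positivity)]
      have : (1 : ℝ) ≤ d := by exact_mod_cast hd
      linarith) hθ hθ1
    (fun j ω => ensembleΩ ω k j) (fun j => measurable_ensembleΩ k j)
    (fun j => Set.range (idxΩ k j))
    (fun j x y hxy => by
      ext a b
      simp only [ensembleΩ]
      rw [show x (Sum.inl (⟨k, j⟩, a, b)) = y (Sum.inl (⟨k, j⟩, a, b)) from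
        hxy _ ⟨(a, b), rfl⟩])
    (fun i j hij => by
      refine Set.disjoint_left.2 ?_
      rintro _ ⟨ab, rfl⟩ ⟨ab', h⟩
      simp only [idxΩ, Sum.inl.injEq, Prod.mk.injEq, Sigma.mk.injEq, heq_eq_eq, true_and] at h
      exact hij h.1.symm)
    (fun j => hJL (idxΩ_injective k j)) (Matrix.replicateCol Unit y)
  simp only [frobSq_replicateCol'] at h
  refine le_trans (le_of_eq ?_) (h.trans ?_)
  · simp only [← frobSq_replicateCol]
    rfl
  · gcongr
    rw [hcard]
    exact_mod_cast Nat.sub_le d 1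

end Factor


/-! ## Failure probabilities -/

/-- Eckart–Young bounds every competitor from below, so the infimum need not be attained. -/
theorem tailSq_le_optTuckerError_sq (S : SVDRoutine) {d n r : ℕ} (X : Tensor (fun _ : Fin d => n))
    (k : Fin d)
    {D : ThinSVD n (Fintype.card (Cols (fun _ : Fin d => n) k))}
    (hD : D.IsSVDOf ((unfold k X).submatrix id (Fintype.equivFin _).symm))
    (hr : r ≤ min n (Fintype.card (Cols (fun _ : Fin d => n) k))) :
    D.tailSq hr ≤ optTuckerError r X ^ 2 := by
  have h0 : 0 ≤ D.tailSq hr := Finset.sum_nonneg fun _ _ => sq_nonneg _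
  have : Nonempty (TuckerFactors d n r) := ⟨⟨0, 0⟩⟩
  have h1 : Real.sqrt (D.tailSq hr) ≤ optTuckerError r X := by
    refine le_ciInf fun F => ?_
    rw [Real.sqrt_le_left (tensorNorm_nonneg _), tensorNorm_sq _ k, unfold_sub]
    obtain ⟨Z, hZ⟩ := unfold_toTensor F k
    refine (hD.tailSq_le_of_factor S hr (F.factor k)
      (Z.submatrix id (Fintype.equivFin _).symm)).trans_eq ?_
    rw [hZ]
    exact frobSq_submatrix (unfold k X - F.factor k * Z) (Equiv.refl _)
      (Fintype.equivFin _).symm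
  calc D.tailSq hr = Real.sqrt (D.tailSq hr) ^ 2 := (Real.sq_sqrt h0).symm
    _ ≤ _ := pow_le_pow_left₀ (Real.sqrt_nonneg _) h1 2

theorem ratio_bounds {d n r : ℕ} {δ : ℝ} (hd : 2 ≤ d) (hr : 1 ≤ r) (hrn : r ≤ n) (hδ : 0 < δ)
    (hδ1 : δ < 1 / 3) :
    6 ≤ (d * n ^ d / δ : ℝ) ∧ (n : ℝ) ^ d ≤ d * n ^ d / δ ∧ (n : ℝ) ≤ d * n ^ d / δ ∧
      (d / δ : ℝ) ≤ d * n ^ d / δ ∧ (d : ℝ) ≤ d * n ^ d / δ := by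
  have hd' : (2 : ℝ) ≤ d := by exact_mod_cast hd
  have hn : (1 : ℝ) ≤ n := by exact_mod_cast hr.trans hrn
  have hnd : (1 : ℝ) ≤ (n : ℝ) ^ d := one_le_pow₀ hn
  have hnn : (n : ℝ) ≤ (n : ℝ) ^ d := le_self_pow₀ hn (by omega)
  have h1 : (n : ℝ) ^ d ≤ d * n ^ d / δ := by
    rw [le_div_iff₀ hδ]
    nlinarith
  refine ⟨?_, h1, hnn.trans h1, ?_, ?_⟩
  · rw [le_div_iff₀ hδ]
    nlinarith
  · gcongr
    nlinarith
  · rw [le_div_iff₀ hδ]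
    nlinarith

section

variable {d n m mc r : ℕ} (ν : EnsembleIndex d n m mc → Measure ℝ) [∀ e, IsProbabilityMeasure (ν e)]

/-- The Johnson–Lindenstrauss property of all blocks of coordinates, with constant `c`. -/
def JLBlocks (c : ℝ) : Prop :=
  ∀ {s : ℕ} {e : Fin s × Fin n → EnsembleIndex d n m mc}, 0 < s → Function.Injective e →
    ∀ {κ : Type} [Fintype κ] (Y : Matrix (Fin n) κ ℝ) (η : ℝ), 0 < η → η ≤ 1 →
    Measure.pi ν {ω | η * frobSq Y < |frobSq (coordMatrix e ω * Y) - frobSq Y|}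
      ≤ ENNReal.ofReal (2 * Real.exp (-(c * s * η ^ 2)))

variable {ν}

/-- The test vectors come from the right singular vectors of the unmeasured unfolding, which are
fixed before the sketch is drawn. They live in dimension `n^(d-1)`, but there are at most `n` of
them. -/
theorem measure_factor_bad_le {c : ℝ} (hJL : JLBlocks ν c) (hd : 2 ≤ d) (hr : 1 ≤ r)
    (hrn : r ≤ n) (hrm : r ≤ m) {ε δ : ℝ} (hε : 0 < ε) (hε1 : ε < 1) (hδ : 0 < δ) (hδ1 : δ < 1 / 3)
    (hm1 : 8 * Real.log (d * n ^ d / δ) ≤ c * m * (ε / (100 * d ^ 2 * r) * ε))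
    (hm2 : 8 * (r * Real.log (d * n ^ d / δ)) ≤ c * m * (ε / (400 * d ^ 2) * ε))
    (γ : ℕ) (S : SVDRoutine) {W : Fin d → ModeSensing n} (hW : ∀ k, IsUnit (W k).toMatrix)
    (X : Tensor (fun _ : Fin d => n)) (k : Fin d) :
    Measure.pi ν {ω | ¬ (1 - ε) * frobSq (unfold k X - recoveredFactor γ S W X r ω k *
        ((recoveredFactor γ S W X r ω k)ᵀ * unfold k X)) ≤ (1 + ε) * optTuckerError r X ^ 2}
      ≤ ENNReal.ofReal (δ / (2 * d)) := by
  obtain ⟨hT6, -, hnT, hdδT, hdT⟩ := ratio_bounds hd hr hrn hδ hδ1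
  set T : ℝ := d * n ^ d / δ with hTdef
  have hr' : (1 : ℝ) ≤ r := by exact_mod_cast hr
  have hd' : (2 : ℝ) ≤ d := by exact_mod_cast hd
  have hm0 : 0 < m := lt_of_lt_of_le hr hrm
  -- Chosen so that the loss `5θ` of projection-cost preservation is `ε`.
  set θ := ε / 5 with hθ
  have hθ0 : 0 < θ := by positivity
  set θ₁ := θ / Real.sqrt r with hθ₁
  have hsr : 1 ≤ Real.sqrt r := Real.one_le_sqrt.2 hr'
  have hsr0 : 0 < Real.sqrt r := by linarith
  have hθ₁0 : 0 < θ₁ := by positivity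
  have hθ₁θ : θ₁ ≤ θ := div_le_self hθ0.le hsr
  have hcard : ∀ s, Fintype.card (Cols (fun _ : Fin d => s) k) = s ^ (d - 1) := fun s =>
    card_cols d s k
  have hrle : ∀ s, r ≤ s → r ≤ min n (Fintype.card (Cols (fun _ : Fin d => s) k)) := by
    intro s hs
    rw [hcard]
    exact le_min hrn (hs.trans (Nat.le_self_pow (by omega) s))
  set D := S.run ((unfold k X).submatrix id (Fintype.equivFin _).symm) with hD
  have hDsvd := S.isSVDOf ((unfold k X).submatrix id (Fintype.equivFin _).symm)
  rw [← hD] at hDsvd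
  set V := D.V.submatrix (Fintype.equivFin (Cols (fun _ : Fin d => n) k)) id with hV
  have hVV : Vᵀ * V = 1 := by
    rw [hV, Matrix.transpose_submatrix, Matrix.submatrix_mul_equiv, hDsvd.V_orthonormal,
      Matrix.submatrix_one _ Function.injective_id]
  have hcol : ∀ a, V.col a ⬝ᵥ V.col a ≤ 1 := fun a => by
    have := congrFun (congrFun hVV a) a
    rw [Matrix.mul_apply', Matrix.one_apply_eq] at this
    exact this.le
  have hpoint : ∀ (t : ℝ), 0 < t → t ≤ 1 → ∀ y : Cols (fun _ : Fin d => n) k → ℝ,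
      Measure.pi ν {ω | t * (y ⬝ᵥ y) < |(kronOthers k (ensembleΩ ω k) *ᵥ y) ⬝ᵥ
        (kronOthers k (ensembleΩ ω k) *ᵥ y) - y ⬝ᵥ y|}
      ≤ ENNReal.ofReal (2 * d * Real.exp (-(c * m * (t / (2 * d)) ^ 2))) := by
    intro t ht ht1 y
    refine (measure_kronOthers_distortion_le ν ht.le ht1 k (fun he _ _ Y => hJL hm0 he Y _
      (by positivity) ?_) y).trans_eq ?_
    · rw [div_le_one (by positivity)]
      linarith
    · rw [← ENNReal.ofReal_natCast d, ← ENNReal.ofReal_mul (Nat.cast_nonneg d)]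
      congr 1
      ring
  have hent : Measure.pi ν {ω | ∃ a b, θ₁ < |gramErr (kronOthers k (ensembleΩ ω k)) V V a b|}
      ≤ ENNReal.ofReal (2 * (n : ℝ) ^ 2 * (2 * d * Real.exp (-(8 * Real.log T)))) := by
    refine (measure_gramErr_entry_le _ (hpoint θ₁ hθ₁0 (by linarith)) hθ₁0.le V V hcol hcol).trans ?_
    rw [Fintype.card_fin, ENNReal.ofReal_mul (p := 2 * (n : ℝ) ^ 2) (by positivity)]
    refine mul_le_mul' ?_ (ENNReal.ofReal_le_ofReal ?_)
    · rw [ENNReal.ofReal_mul (by norm_num), ENNReal.ofReal_pow (Nat.cast_nonneg n),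
        ENNReal.ofReal_natCast, ENNReal.ofReal_ofNat, sq]
      gcongr <;> exact min_le_left _ _
    -- The distortion per mode is `θ₁/(2d) = ε/(10 d √r)`, with square `ε²/(100 d² r)`.
    · refine mul_le_mul_of_nonneg_left (Real.exp_le_exp.2 (neg_le_neg (hm1.trans_eq ?_)))
        (by positivity)
      rw [hθ₁, hθ, div_pow, div_pow, Real.sq_sqrt (Nat.cast_nonneg r)]
      field_simp
      ring
  have hquad : Measure.pi ν {ω | ∃ u, θ * (u ⬝ᵥ u) < |u ⬝ᵥ gramErr (kronOthers k (ensembleΩ ω k))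
        (V.submatrix id (Fin.castLE (hrle n hrn))) (V.submatrix id (Fin.castLE (hrle n hrn))) *ᵥ u|}
      ≤ ENNReal.ofReal ((32 * r + 1) ^ r * (2 * d * Real.exp (-(8 * (r * Real.log T))))) := by
    refine (measure_gramErr_quadForm_le _ (hpoint (θ / 2) (by positivity) (by linarith)) hθ0.le _
      (submatrix_gram_of_injective hVV (Fin.castLE_injective _))).trans ?_
    rw [ENNReal.ofReal_mul (p := (32 * r + 1 : ℝ) ^ r) (by positivity)]
    refine mul_le_mul' (le_of_eq ?_) (ENNReal.ofReal_le_ofReal ?_)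
    · rw [ENNReal.ofReal_pow (by positivity), ENNReal.ofReal_add (by positivity) (by norm_num),
        ENNReal.ofReal_mul (by norm_num), ENNReal.ofReal_natCast, ENNReal.ofReal_ofNat,
        ENNReal.ofReal_one]
    -- On the grid the tolerance is `θ/2`, per mode `ε/(20 d)`, with square `ε²/(400 d²)`.
    · refine mul_le_mul_of_nonneg_left (Real.exp_le_exp.2 (neg_le_neg (hm2.trans_eq ?_)))
        (by positivity)
      rw [hθ]
      field_simp
      ring
  have hrT : (r : ℝ) ≤ T := le_trans (by exact_mod_cast hrn) hnT
  have hcount := union_count_le (a := (n : ℝ) ^ 2) hT6 (by omega) hδ hr hrT hdδT hdT (by gcongr)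
  refine (measure_mono fun ω hω => ?_).trans ((measure_union_le _ _).trans
    ((add_le_add hent hquad).trans ?_))
  · by_contra hcon
    simp only [Set.mem_union, Set.mem_ofPred_eq, not_or, not_exists, not_lt] at hcon
    refine hω ?_
    have h1 := frobSq_sub_recoverFactor_le γ S hr (hW k) (unfold k X)
      (kronOthers k (ensembleΩ ω k)) (hrle n hrn) (hrle m hrm) hDsvd hV hθ0.le hθ₁0.le
      (by rw [hθ₁]; field_simp; exact le_rfl) hcon.2 hcon.1
    have h2 := tailSq_le_optTuckerError_sq S X k hDsvd (hrle n hrn)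
    have h3 : 1 - 5 * θ = 1 - ε := by rw [hθ]; ring
    rw [h3] at h1
    refine h1.trans ?_
    have h4 : 1 + θ ≤ 1 + ε := by rw [hθ]; linarith
    exact mul_le_mul h4 h2 (Finset.sum_nonneg fun _ _ => sq_nonneg _) (by linarith)
  · rw [← ENNReal.ofReal_add (by positivity) (by positivity)]
    exact ENNReal.ofReal_le_ofReal hcount

end

/-! ## Core recovery -/

/-- Frozen input of one core recovery step: fixed `Q` and `Y`, random `Φ`. -/
theorem measure_core_bad_le_of_fixed {d n m mc r : ℕ} {ν : EnsembleIndex d n m mc → Measure ℝ}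
    [∀ e, IsProbabilityMeasure (ν e)] {c : ℝ} (hJL : JLBlocks ν c) (hc : 0 < c) (hd : 2 ≤ d)
    (hr : 1 ≤ r) (hrn : r ≤ n) (hrm : r ≤ mc) {ε δ : ℝ} (hε : 0 < ε) (hε1 : ε < 1) (hδ : 0 < δ)
    (hδ1 : δ < 1 / 3)
    (hm1 : 8 * Real.log (d * n ^ d / δ) ≤ c * mc * (ε / (100 * d ^ 2 * r) * ε))
    (hm2 : 8 * (r * Real.log (d * n ^ d / δ)) ≤ c * mc * (ε / (400 * d ^ 2) * ε))
    (S : SVDRoutine) (k : Fin d) {Q : Matrix (Fin n) (Fin r) ℝ} (hQ : Qᵀ * Q = 1)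
    (Y : Matrix (Fin n) (Cols (fun _ : Fin d => n) k) ℝ) :
    Measure.pi ν {ω | ¬ ((S.run (ensembleΦ ω k * Q)).pinv * (ensembleΦ ω k * Q) = 1 ∧
        frobSq (Q * (S.run (ensembleΦ ω k * Q)).pinv * ensembleΦ ω k * Y)
          ≤ (1 + ε / d) ^ 2 * frobSq Y)} ≤ ENNReal.ofReal (δ / (2 * d)) := by
  obtain ⟨hT6, hndT, hnT, hdδT, hdT⟩ := ratio_bounds hd hr hrn hδ hδ1
  set T : ℝ := d * n ^ d / δ with hTdef
  have hr' : (1 : ℝ) ≤ r := by exact_mod_cast hr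
  have hd' : (2 : ℝ) ≤ d := by exact_mod_cast hd
  have hm0 : 0 < mc := lt_of_lt_of_le hr hrm
  have hsr : 1 ≤ Real.sqrt r := Real.one_le_sqrt.2 hr'
  -- The expansion allowed in one mode, so that `d` modes compound to at most `exp ε`.
  set t := ε / d with ht
  have ht0 : 0 < t := by positivity
  -- Makes `4 r θ₁² = t²`, the leakage tolerated by `frobSq_sketched_projection_le`.
  set θ₁ := t / (2 * Real.sqrt r) with hθ₁
  have hθ₁0 : 0 < θ₁ := by positivity
  have ht1 : t ≤ 1 := by
    rw [ht, div_le_one (by positivity)]; linarith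
  have hθ₁1 : θ₁ ≤ 1 := (div_le_self ht0.le (by linarith)).trans ht1
  have hpoint : ∀ (η : ℝ), 0 < η → η ≤ 1 → ∀ y : Fin n → ℝ,
      Measure.pi ν {ω | η * (y ⬝ᵥ y) < |(ensembleΦ ω k *ᵥ y) ⬝ᵥ (ensembleΦ ω k *ᵥ y) - y ⬝ᵥ y|}
      ≤ ENNReal.ofReal (2 * Real.exp (-(c * mc * η ^ 2))) := by
    intro η hη hη1 y
    have := hJL hm0 (idxΦ_injective k) (Matrix.replicateCol Unit y) η hη hη1
    simp only [frobSq_replicateCol, frobSq_replicateCol'] at this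
    exact this
  set Z := Y - Q * (Qᵀ * Y) with hZ
  set q : Cols (fun _ : Fin d => n) k → ℝ := fun b => Z.col b ⬝ᵥ Z.col b with hq
  have hq0 : ∀ b, 0 ≤ q b := fun b => Finset.sum_nonneg fun _ _ => mul_self_nonneg _
  -- Normalized columns of `Z`. A zero column stays zero under division by zero, so the squared
  -- lengths are 1 or 0.
  set U : Matrix (Fin n) (Cols (fun _ : Fin d => n) k) ℝ :=
    Matrix.of fun i b => Z i b / Real.sqrt (q b) with hU
  have hUcol : ∀ b, U.col b ⬝ᵥ U.col b ≤ 1 := by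
    intro b
    have : U.col b ⬝ᵥ U.col b = q b / q b := by
      conv_rhs => rw [hq]
      simp only [dotProduct, hU, Matrix.col, Matrix.transpose_apply, Matrix.of_apply]
      rw [Finset.sum_div]
      refine Finset.sum_congr rfl fun i _ => ?_
      rw [div_mul_div_comm, Real.mul_self_sqrt (hq0 b)]
      rfl
    rw [this]
    exact div_self_le_one _
  have hQcol : ∀ a, Q.col a ⬝ᵥ Q.col a ≤ 1 := fun a => by
    have := congrFun (congrFun hQ a) a
    rw [Matrix.mul_apply', Matrix.one_apply_eq] at this
    exact this.le
  have hent : Measure.pi ν {ω | ∃ a b, θ₁ < |gramErr (ensembleΦ ω k) Q U a b|}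
      ≤ ENNReal.ofReal (2 * T * (2 * d * Real.exp (-(8 * Real.log T)))) := by
    refine (measure_gramErr_entry_le _ (hpoint θ₁ hθ₁0 hθ₁1) hθ₁0.le Q U hQcol hUcol).trans ?_
    rw [Fintype.card_fin, card_cols, ENNReal.ofReal_mul (p := 2 * T) (by positivity)]
    refine mul_le_mul' ?_ (ENNReal.ofReal_le_ofReal ?_)
    -- All `n^(d-1)` columns of the unfolding are tested here; together with the `r` columns of `Q`
    -- they form at most `nᵈ ≤ T` pairs.
    · have h1 : (r : ℝ) * n ^ (d - 1) ≤ T := by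
        refine le_trans ?_ hndT
        obtain ⟨e, rfl⟩ : ∃ e, d = e + 1 := ⟨d - 1, by omega⟩
        rw [Nat.add_sub_cancel, pow_succ, mul_comm]
        gcongr
      rw [ENNReal.ofReal_mul (by norm_num), ENNReal.ofReal_ofNat]
      gcongr
      calc ((r : ℝ≥0∞) * ((n ^ (d - 1) : ℕ) : ℝ≥0∞)) = ENNReal.ofReal ((r * n ^ (d - 1) : ℕ) : ℝ) := by
            rw [ENNReal.ofReal_natCast]; push_cast; rfl
        _ ≤ _ := ENNReal.ofReal_le_ofReal (by push_cast; exact h1)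
    · have h1 : 2 * Real.exp (-(c * mc * θ₁ ^ 2)) ≤ 2 * Real.exp (-(8 * Real.log T)) := by
        refine mul_le_mul_of_nonneg_left (Real.exp_le_exp.2 (neg_le_neg (hm1.trans ?_)))
          zero_le_two
        gcongr
        rw [hθ₁, ht, div_pow, div_pow, mul_pow, Real.sq_sqrt (Nat.cast_nonneg r),
          div_mul_eq_mul_div, div_div, ← sq]
        refine div_le_div_of_nonneg_left (by positivity) (by positivity) ?_
        have : 0 ≤ (d : ℝ) ^ 2 * r := by positivity
        linarith
      refine h1.trans ?_
      have := Real.exp_pos (-(8 * Real.log T))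
      nlinarith
  -- A constant tolerance suffices: it only has to make the Gram matrix of `Φ Q` well conditioned.
  have hquad : Measure.pi ν {ω | ∃ u, 1 / 2 * (u ⬝ᵥ u) < |u ⬝ᵥ gramErr (ensembleΦ ω k) Q Q *ᵥ u|}
      ≤ ENNReal.ofReal ((32 * r + 1) ^ r * (2 * d * Real.exp (-(8 * (r * Real.log T))))) := by
    refine (measure_gramErr_quadForm_le _ (hpoint (1 / 2 / 2) (by norm_num) (by norm_num))
      (by norm_num) Q hQ).trans ?_
    rw [ENNReal.ofReal_mul (p := (32 * r + 1 : ℝ) ^ r) (by positivity)]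
    refine mul_le_mul' (le_of_eq ?_) (ENNReal.ofReal_le_ofReal ?_)
    · rw [ENNReal.ofReal_pow (by positivity), ENNReal.ofReal_add (by positivity) (by norm_num),
        ENNReal.ofReal_mul (by norm_num), ENNReal.ofReal_natCast, ENNReal.ofReal_ofNat,
        ENNReal.ofReal_one]
    · have h1 : 2 * Real.exp (-(c * mc * (1 / 2 / 2) ^ 2)) ≤ 2 * Real.exp (-(8 * (r * Real.log T))) := by
        refine mul_le_mul_of_nonneg_left (Real.exp_le_exp.2 (neg_le_neg (hm2.trans ?_)))
          zero_le_two
        gcongr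
        rw [div_mul_eq_mul_div, div_le_iff₀ (by positivity)]
        nlinarith
      refine h1.trans ?_
      have := Real.exp_pos (-(8 * (r * Real.log T)))
      nlinarith
  have hrT : (r : ℝ) ≤ T := le_trans (by exact_mod_cast hrn) hnT
  have hcount := union_count_le (a := T) hT6 (by omega) hδ hr hrT hdδT hdT (by nlinarith)
  refine (measure_mono fun ω hω => ?_).trans ((measure_union_le _ _).trans
    ((add_le_add hent hquad).trans ?_))
  · by_contra hcon
    simp only [Set.mem_union, Set.mem_ofPred_eq, not_or, not_exists, not_lt] at hcon
    obtain ⟨hc1, hc2⟩ := hcon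
    have hN := (S.isSVDOf (ensembleΦ ω k * Q)).gram_mul_pinv
    refine hω ⟨mul_eq_one_of_gramErr hQ hc2 hN, ?_⟩
    refine frobSq_sketched_projection_le hQ hN hc2 ht0 ?_
    have hGZ : ∀ a b, gramErr (ensembleΦ ω k) Q Z a b ^ 2 ≤ θ₁ ^ 2 * q b := by
      intro a b
      have h1 : gramErr (ensembleΦ ω k) Q Z a b
          = Real.sqrt (q b) * gramErr (ensembleΦ ω k) Q U a b := by
        have h2 : Z.col b = Real.sqrt (q b) • U.col b := by
          ext i
          simp only [Matrix.col, Matrix.transpose_apply, Pi.smul_apply, smul_eq_mul, hU,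
            Matrix.of_apply]
          rcases (hq0 b).eq_or_lt with h0 | hpos
          · have : Z.col b = 0 := dotProduct_self_eq_zero.1 h0.symm
            have : Z i b = 0 := congrFun this i
            rw [this]; simp
          · have := (Real.sqrt_pos.2 hpos).ne'
            field_simp
        rw [gramErr_apply, gramErr_apply, h2, Matrix.mulVec_smul, dotProduct_smul, dotProduct_smul,
          smul_eq_mul, smul_eq_mul, mul_sub]
      rw [h1, mul_pow, Real.sq_sqrt (hq0 b), mul_comm]
      refine mul_le_mul_of_nonneg_right ?_ (hq0 b)
      rw [← sq_abs]
      exact pow_le_pow_left₀ (abs_nonneg _) (hc1 a b) 2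
    have hGsum : frobSq (gramErr (ensembleΦ ω k) Q Z) ≤ r * (θ₁ ^ 2 * frobSq Z) := by
      have hqs : ∑ b, q b = frobSq Z := by
        rw [← frobSq_transpose]
        simp only [frobSq, hq, dotProduct, Matrix.col, sq]
      calc frobSq (gramErr (ensembleΦ ω k) Q Z) ≤ ∑ _a : Fin r, ∑ b, θ₁ ^ 2 * q b :=
            Finset.sum_le_sum fun a _ => Finset.sum_le_sum fun b _ => hGZ a b
        _ = _ := by
            rw [← Finset.mul_sum, hqs]
            simp
    have hZY : frobSq Z ≤ frobSq Y := by
      rw [hZ, frobSq_sub_proj hQ]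
      linarith [frobSq_nonneg (Qᵀ * Y)]
    have hrθ : 4 * (r * θ₁ ^ 2) = t ^ 2 := by
      rw [hθ₁, div_pow, mul_pow, Real.sq_sqrt (Nat.cast_nonneg r)]
      field_simp
      norm_num
    calc 4 * frobSq (gramErr (ensembleΦ ω k) Q Z) ≤ 4 * (r * (θ₁ ^ 2 * frobSq Z)) := by linarith
      _ = t ^ 2 * frobSq Z := by rw [← hrθ]; ring
      _ ≤ _ := by gcongr
  · rw [← ENNReal.ofReal_add (by positivity) (by positivity)]
    exact ENNReal.ofReal_le_ofReal hcount


/-! ## Core recovery with random factors -/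

theorem measurable_modewiseProd {Ω : Type} [MeasurableSpace Ω] {d : ℕ} {s t : Fin d → ℕ}
    {T : Ω → Tensor s} {M : Ω → ∀ i, Matrix (Fin (t i)) (Fin (s i)) ℝ} (hT : Measurable T)
    (hM : ∀ i, MeasurableEntries fun ω => M ω i) :
    Measurable fun ω => modewiseProd (T ω) (M ω) :=
  measurable_pi_lambda _ fun _ => Finset.measurable_sum _ fun x _ =>
    (Finset.measurable_prod _ fun i _ => hM i _ _).mul ((measurable_pi_apply x).comp hT)

theorem MeasurableEntries.solvedFactor (S : SVDRoutine) {Ω κ : Type} [MeasurableSpace Ω] {n : ℕ}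
    (W : ModeSensing n) {B : Ω → Matrix (Fin n) κ ℝ} (hB : MeasurableEntries B) :
    MeasurableEntries fun ω => solvedFactor S W (B ω) := by
  match W with
  | none => exact hB
  | some D => exact (MeasurableEntries.const _).mul hB

section

variable (γ : ℕ) (S : SVDRoutine) {d n m mc r : ℕ} (W : Fin d → ModeSensing n)
  (X : Tensor (fun _ : Fin d => n))

/-- Freezing the factors rests on Tonelli, which needs them to be measurable; this is why the SVD
routine is required to be. -/
theorem measurable_recoveredFactor (hr : r ≤ min n (m ^ (d - 1))) (k : Fin d) :
    MeasurableEntries fun ω : EnsembleIndex d n m mc → ℝ => recoveredFactor γ S W X r ω k := by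
  rw [← card_cols d m k] at hr
  simp only [recoveredFactor, val_recoverFactor γ S _ _ hr]
  refine (MeasurableEntries.svd_U S (MeasurableEntries.submatrix ?_ _ _)).submatrix _ _
  refine MeasurableEntries.solvedFactor S _ ?_
  refine (MeasurableEntries.const _).mul (MeasurableEntries.transpose fun c c' => ?_)
  exact Finset.measurable_prod _ fun j _ => measurable_ensembleΩ k j _ _

/-- The matrix by which mode `i` of the measured tensor is multiplied in the recovery. -/
def modeRecovery (r : ℕ) (ω : EnsembleIndex d n m mc → ℝ) (i : Fin d) :
    Matrix (Fin n) (Fin n) ℝ :=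
  recoveredFactor γ S W X r ω i * corePinv S (ensembleΦ ω) (recoveredFactor γ S W X r ω) i
    * ensembleΦ ω i

theorem measurable_modeRecovery (hr : r ≤ min n (m ^ (d - 1))) (i : Fin d) :
    MeasurableEntries fun ω : EnsembleIndex d n m mc → ℝ => modeRecovery γ S W X r ω i :=
  ((measurable_recoveredFactor γ S W X hr i).mul (MeasurableEntries.svd_pinv S
    ((measurable_ensembleΦ i).mul (measurable_recoveredFactor γ S W X hr i)))).mul
    (measurable_ensembleΦ i)

/-- The error of the higher-order projection on the recovered factors, after the recovery steps in
the first `k` modes. -/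
def stageError (r : ℕ) (ω : EnsembleIndex d n m mc → ℝ) (k : ℕ) : Tensor (fun _ : Fin d => n) :=
  modewiseProd (t := fun _ => n)
    (X - modewiseProd (t := fun _ => n) X fun i =>
      recoveredFactor γ S W X r ω i * (recoveredFactor γ S W X r ω i)ᵀ)
    (firstModes (modeRecovery γ S W X r ω) k)

theorem measurable_stageError (hr : r ≤ min n (m ^ (d - 1))) (k : ℕ) :
    Measurable fun ω : EnsembleIndex d n m mc → ℝ => stageError γ S W X r ω k := by
  refine measurable_modewiseProd (measurable_const.sub
    (measurable_modewiseProd measurable_const fun i => ?_)) fun i => ?_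
  · exact (measurable_recoveredFactor γ S W X hr i).mul
      (measurable_recoveredFactor γ S W X hr i).transpose
  · by_cases h : (i : ℕ) < k
    · simp only [firstModes, h, if_true]
      exact measurable_modeRecovery γ S W X hr i
    · simp only [firstModes, h, if_false]
      exact MeasurableEntries.const _

theorem recoveredFactor_congr {ω ω' : EnsembleIndex d n m mc → ℝ} (k : Fin d)
    (h : ensembleΩ ω k = ensembleΩ ω' k) :
    recoveredFactor γ S W X r ω k = recoveredFactor γ S W X r ω' k := by
  rw [recoveredFactor, recoveredFactor, h]

theorem ensembleΩ_eq_of_eqOn {ω ω' : EnsembleIndex d n m mc → ℝ} {k : Fin d}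
    (h : ∀ e ∈ (Set.range (idxΦ k))ᶜ, ω e = ω' e) (i : Fin d) :
    ensembleΩ ω i = ensembleΩ ω' i := by
  ext j a b
  simp only [ensembleΩ]
  rw [h]
  rintro ⟨ab, hab⟩
  simp [idxΦ] at hab

theorem ensembleΦ_eq_of_eqOn {ω ω' : EnsembleIndex d n m mc → ℝ} {k : Fin d}
    (h : ∀ e ∈ (Set.range (idxΦ k))ᶜ, ω e = ω' e) {i : Fin d} (hi : i ≠ k) :
    ensembleΦ ω i = ensembleΦ ω' i := by
  ext a b
  simp only [ensembleΦ]
  rw [h]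
  rintro ⟨ab, hab⟩
  simp only [idxΦ, Sum.inr.injEq, Prod.mk.injEq] at hab
  exact hi hab.1.symm

/-- Before step `k` the tensor involves all `Ω` but only those `Φ_i` with `i < k`. This is what
makes it independent of `Φ_k`. -/
theorem stageError_congr {ω ω' : EnsembleIndex d n m mc → ℝ} {k : Fin d}
    (h : ∀ e ∈ (Set.range (idxΦ k))ᶜ, ω e = ω' e) :
    stageError γ S W X r ω k = stageError γ S W X r ω' k := by
  have hQ : recoveredFactor γ S W X r ω = recoveredFactor γ S W X r ω' :=
    funext fun i => recoveredFactor_congr γ S W X i (ensembleΩ_eq_of_eqOn h i)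
  have hM : firstModes (modeRecovery γ S W X r ω) k
      = firstModes (modeRecovery γ S W X r ω') k := by
    ext1 i
    by_cases hi : (i : ℕ) < k
    · have hik : i ≠ k := fun e => hi.ne (congrArg Fin.val e)
      simp only [firstModes, hi, if_true, modeRecovery, corePinv, hQ,
        ensembleΦ_eq_of_eqOn h hik]
    · simp only [firstModes, hi, if_false]
  rw [stageError, stageError, hQ, hM]

/-- The random factor and the random stage error read no entry of `Φ_k`, so the estimate for frozen
values carries over. -/
theorem measure_core_bad_le {ν : EnsembleIndex d n m mc → Measure ℝ}
    [∀ e, IsProbabilityMeasure (ν e)] {c : ℝ} (hJL : JLBlocks ν c) (hc : 0 < c) (hd : 2 ≤ d)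
    (hr : 1 ≤ r) (hrn : r ≤ n) (hrm : r ≤ m) (hrmc : r ≤ mc) {ε δ : ℝ} (hε : 0 < ε) (hε1 : ε < 1)
    (hδ : 0 < δ) (hδ1 : δ < 1 / 3)
    (hm1 : 8 * Real.log (d * n ^ d / δ) ≤ c * mc * (ε / (100 * d ^ 2 * r) * ε))
    (hm2 : 8 * (r * Real.log (d * n ^ d / δ)) ≤ c * mc * (ε / (400 * d ^ 2) * ε)) (k : Fin d) :
    Measure.pi ν {ω | ¬ (corePinv S (ensembleΦ ω) (recoveredFactor γ S W X r ω) k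
          * (ensembleΦ ω k * recoveredFactor γ S W X r ω k) = 1 ∧
        frobSq (modeRecovery γ S W X r ω k * unfold k (stageError γ S W X r ω k))
          ≤ (1 + ε / d) ^ 2 * frobSq (unfold k (stageError γ S W X r ω k)))}
      ≤ ENNReal.ofReal (δ / (2 * d)) := by
  have hrc : r ≤ min n (m ^ (d - 1)) :=
    le_min hrn (hrm.trans (Nat.le_self_pow (by omega) m))
  let f : (EnsembleIndex d n m mc → ℝ) → (Fin n → Fin r → ℝ) × Tensor (fun _ : Fin d => n) :=
    fun ω => (recoveredFactor γ S W X r ω k, stageError γ S W X r ω k)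
  let h : (EnsembleIndex d n m mc → ℝ) → (Fin mc → Fin n → ℝ) := fun ω => ensembleΦ ω k
  let Q : ((Fin n → Fin r → ℝ) × Tensor (fun _ : Fin d => n)) × (Fin mc → Fin n → ℝ) →
    Matrix (Fin n) (Fin r) ℝ := fun p => Matrix.of p.1.1
  let Φ : ((Fin n → Fin r → ℝ) × Tensor (fun _ : Fin d => n)) × (Fin mc → Fin n → ℝ) →
    Matrix (Fin mc) (Fin n) ℝ := fun p => Matrix.of p.2
  let Y : ((Fin n → Fin r → ℝ) × Tensor (fun _ : Fin d => n)) × (Fin mc → Fin n → ℝ) →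
    Matrix (Fin n) (Cols (fun _ : Fin d => n) k) ℝ := fun p => unfold k p.1.2
  have hQ : MeasurableEntries Q := fun i j =>
    (measurable_pi_apply j).comp ((measurable_pi_apply i).comp (measurable_fst.comp measurable_fst))
  have hΦ : MeasurableEntries Φ := fun i j =>
    (measurable_pi_apply j).comp ((measurable_pi_apply i).comp measurable_snd)
  have hY : MeasurableEntries Y := fun i j =>
    (measurable_pi_apply _).comp (measurable_snd.comp measurable_fst)
  have hN := MeasurableEntries.svd_pinv S (hΦ.mul hQ)
  -- Matrix equations are written through `frobSq` to make measurability evident. The orthonormality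
  -- clause empties the bad event for frozen values to which the fixed estimate does not apply.
  let B : Set (((Fin n → Fin r → ℝ) × Tensor (fun _ : Fin d => n)) × (Fin mc → Fin n → ℝ)) :=
    {p | frobSq ((Q p)ᵀ * Q p - 1) = 0 ∧ (frobSq ((S.run (Φ p * Q p)).pinv * (Φ p * Q p) - 1) ≠ 0 ∨
      (1 + ε / d) ^ 2 * frobSq (Y p) < frobSq (Q p * (S.run (Φ p * Q p)).pinv * Φ p * Y p))}
  have hB : MeasurableSet B := by
    refine MeasurableSet.inter ?_ (MeasurableSet.union ?_ ?_)
    · exact ((hQ.transpose.mul hQ).sub (MeasurableEntries.const 1)).frobSq (measurableSet_singleton 0)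
    · exact ((hN.mul (hΦ.mul hQ)).sub (MeasurableEntries.const 1)).frobSq
        (measurableSet_singleton 0).compl
    · exact measurableSet_lt (hY.frobSq.const_mul _) (((hQ.mul hN).mul hΦ).mul hY).frobSq
  have hf : Measurable f := (measurable_pi_lambda _ fun i => measurable_pi_lambda _ fun j =>
    measurable_recoveredFactor γ S W X hrc k i j).prodMk (measurable_stageError γ S W X hrc k)
  have hh : Measurable h := measurable_pi_lambda _ fun i => measurable_pi_lambda _ fun j =>
    measurable_ensembleΦ k i j
  have hS : DependsOn f (Set.range (idxΦ k))ᶜ := by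
    intro ω ω' hω
    refine Prod.ext ?_ ?_
    · exact recoveredFactor_congr γ S W X k (ensembleΩ_eq_of_eqOn hω k)
    · exact stageError_congr γ S W X hω
  have hT : DependsOn h (Set.range (idxΦ k)) := by
    intro ω ω' hω
    ext a b
    simp only [h, ensembleΦ]
    rw [show ω (Sum.inr (k, a, b)) = ω' (Sum.inr (k, a, b)) from hω _ ⟨(a, b), rfl⟩]
  refine le_trans (measure_mono fun ω hω => ?_) (measure_bad_le_of_dependsOn ν hf hh hS hT
    disjoint_compl_left hB (p := ENNReal.ofReal (δ / (2 * d))) ?_)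
  · change frobSq ((recoveredFactor γ S W X r ω k)ᵀ * recoveredFactor γ S W X r ω k - 1) = 0 ∧ _
    have hQ1 : (recoveredFactor γ S W X r ω k)ᵀ * recoveredFactor γ S W X r ω k = 1 :=
      recoverFactor_orthonormal γ S _ _ (by rwa [card_cols])
    refine ⟨by rw [hQ1, sub_self, frobSq_eq_zero], ?_⟩
    by_contra hcon
    refine hω ?_
    rw [not_or, not_not, not_lt, frobSq_eq_zero, sub_eq_zero] at hcon
    exact hcon
  · rintro ⟨Q₀, Y₀⟩
    by_cases hQ₀ : (Matrix.of Q₀)ᵀ * Matrix.of Q₀ = 1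
    · refine le_trans (measure_mono fun ω hω => ?_) (measure_core_bad_le_of_fixed hJL hc hd hr hrn
        hrmc hε hε1 hδ hδ1 hm1 hm2 S k hQ₀ (unfold k Y₀))
      rintro ⟨h1, h2⟩
      rcases hω.2 with h3 | h3
      · refine h3 ?_
        rw [frobSq_eq_zero, sub_eq_zero]
        exact h1
      · exact absurd h2 (not_le.2 h3)
    · refine le_of_eq_of_le ?_ zero_le
      rw [← measure_empty (μ := Measure.pi ν)]
      congr 1
      refine Set.eq_empty_of_forall_notMem fun ω hω => hQ₀ ?_
      have := hω.1
      rwa [frobSq_eq_zero, sub_eq_zero] at this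

/-! ## The error of the recovery on the good event -/

theorem one_add_div_pow_le_exp {ε : ℝ} (hε : 0 ≤ ε) {d : ℕ} (hd : 0 < d) :
    (1 + ε / d) ^ d ≤ Real.exp ε := by
  have hd' : (0 : ℝ) < d := by exact_mod_cast hd
  calc (1 + ε / d) ^ d ≤ Real.exp (ε / d) ^ d := by
        refine pow_le_pow_left₀ (by positivity) ?_ d
        rw [add_comm]
        exact Real.add_one_le_exp _
    _ = Real.exp ε := by
        rw [← Real.exp_nat_mul]
        congr 1
        field_simp

theorem tensorNorm_stageError_le {ε : ℝ} (hε : 0 ≤ ε) {ω : EnsembleIndex d n m mc → ℝ}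
    (h : ∀ k : Fin d, frobSq (modeRecovery γ S W X r ω k * unfold k (stageError γ S W X r ω k))
          ≤ (1 + ε / d) ^ 2 * frobSq (unfold k (stageError γ S W X r ω k))) (k : ℕ) (hk : k ≤ d) :
    tensorNorm (stageError γ S W X r ω k)
      ≤ (1 + ε / d) ^ k * tensorNorm (stageError γ S W X r ω 0) := by
  induction k with
  | zero => simp
  | succ k ih =>
    have ih := ih (by omega)
    have hs : tensorNorm (stageError γ S W X r ω (k + 1))
        ≤ (1 + ε / d) * tensorNorm (stageError γ S W X r ω k) := by
      refine abs_le_of_sq_le_sq' ?_ (mul_nonneg (by positivity) (tensorNorm_nonneg _)) |>.2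
      rw [mul_pow, tensorNorm_sq _ (⟨k, hk⟩ : Fin d), tensorNorm_sq _ (⟨k, hk⟩ : Fin d)]
      refine le_of_eq_of_le ?_ (h ⟨k, hk⟩)
      congr 1
      exact unfold_modewiseProd_firstModes_succ _ _ ⟨k, hk⟩
    refine hs.trans ?_
    rw [pow_succ', mul_assoc]
    exact mul_le_mul_of_nonneg_left ih (by positivity)

/-- Split `X` into its projection `X - E` and `E`. The recovery reproduces the first exactly and
multiplies the norm of the second by at most `exp ε`. -/
theorem tensorNorm_sub_sketchAndRecover_le (hd : 0 < d) (hr : r ≤ min n (m ^ (d - 1))) {ε : ℝ}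
    (hε : 0 < ε) (hε1 : ε < 1) {ω : EnsembleIndex d n m mc → ℝ}
    (hfac : ∀ k, (1 - ε) * frobSq (unfold k X - recoveredFactor γ S W X r ω k *
        ((recoveredFactor γ S W X r ω k)ᵀ * unfold k X)) ≤ (1 + ε) * optTuckerError r X ^ 2)
    (hcore : ∀ k, corePinv S (ensembleΦ ω) (recoveredFactor γ S W X r ω) k
          * (ensembleΦ ω k * recoveredFactor γ S W X r ω k) = 1 ∧
        frobSq (modeRecovery γ S W X r ω k * unfold k (stageError γ S W X r ω k))
          ≤ (1 + ε / d) ^ 2 * frobSq (unfold k (stageError γ S W X r ω k))) :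
    tensorNorm (X - (sketchAndRecover γ S r W ω X).toTensor)
      ≤ (1 + Real.exp ε) * Real.sqrt (d * (1 + ε) / (1 - ε)) * optTuckerError r X := by
  have hopt : 0 ≤ optTuckerError r X := Real.iInf_nonneg fun _ => tensorNorm_nonneg _
  have hε' : 0 < 1 - ε := by linarith
  have hQ : ∀ k, (recoveredFactor γ S W X r ω k)ᵀ * recoveredFactor γ S W X r ω k = 1 := fun k =>
    recoverFactor_orthonormal γ S _ _ (by rwa [card_cols])
  set Q := recoveredFactor γ S W X r ω with hQdef
  set E := stageError γ S W X r ω 0 with hE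
  have hE0 : E = X - modewiseProd (t := fun _ => n) X fun i => Q i * (Q i)ᵀ :=
    modewiseProd_firstModes_zero _ _
  have hEle : tensorNorm E ≤ Real.sqrt (d * (1 + ε) / (1 - ε)) * optTuckerError r X := by
    refine abs_le_of_sq_le_sq' ?_ (mul_nonneg (Real.sqrt_nonneg _) hopt) |>.2
    rw [mul_pow, Real.sq_sqrt (by positivity), hE0]
    refine (tensorNorm_sub_modewiseProd_proj_sq_le X hQ).trans ?_
    calc _ ≤ ∑ _k : Fin d, (1 + ε) * optTuckerError r X ^ 2 / (1 - ε) :=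
          Finset.sum_le_sum fun k _ => (le_div_iff₀' hε').2 (hfac k)
      _ = _ := by
          rw [Finset.sum_const, Finset.card_univ, Fintype.card_fin, nsmul_eq_mul]
          ring
  have hlast : stageError γ S W X r ω d
      = modewiseProd (t := fun _ => n) E (modeRecovery γ S W X r ω) := by
    rw [stageError, firstModes_last, hE0]
  have hfix : ∀ i, modeRecovery γ S W X r ω i * (Q i * (Q i)ᵀ) = Q i * (Q i)ᵀ := by
    intro i
    have h1 := (hcore i).1
    calc modeRecovery γ S W X r ω i * (Q i * (Q i)ᵀ)
        = Q i * (corePinv S (ensembleΦ ω) Q i * (ensembleΦ ω i * Q i)) * (Q i)ᵀ := by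
          simp only [modeRecovery, Matrix.mul_assoc, hQdef]
      _ = _ := by rw [h1, Matrix.mul_one]
  have hout : (sketchAndRecover γ S r W ω X).toTensor
      = stageError γ S W X r ω d + (X - E) := by
    rw [hlast, sketchAndRecover_toTensor]
    have h1 : X - E = modewiseProd (t := fun _ => n) X fun i => Q i * (Q i)ᵀ := by
      rw [hE0, sub_sub_cancel]
    have h2 : modewiseProd (t := fun _ => n) (X - E) (modeRecovery γ S W X r ω) = X - E := by
      rw [h1, modewiseProd_modewiseProd]
      simp only [hfix]
    have h3 : E = X - (X - E) := by rw [sub_sub_cancel]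
    conv_rhs => rw [h3, modewiseProd_sub, h2, ← h3]
    rw [sub_add_cancel]
    rfl
  have hst := tensorNorm_stageError_le γ S W X hε.le (fun k => (hcore k).2) d le_rfl
  have hexp := one_add_div_pow_le_exp hε.le hd
  calc tensorNorm (X - (sketchAndRecover γ S r W ω X).toTensor)
      = tensorNorm (E + -stageError γ S W X r ω d) := by
        rw [hout]
        congr 1
        abel
    _ ≤ tensorNorm E + tensorNorm (stageError γ S W X r ω d) := by
        refine (tensorNorm_add_le _ _).trans_eq ?_
        rw [tensorNorm_neg]
    _ ≤ tensorNorm E + Real.exp ε * tensorNorm E := by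
        refine add_le_add le_rfl (hst.trans ?_)
        exact mul_le_mul_of_nonneg_right hexp (tensorNorm_nonneg _)
    _ = (1 + Real.exp ε) * tensorNorm E := by ring
    _ ≤ _ := by
        rw [mul_assoc]
        exact mul_le_mul_of_nonneg_left hEle (by positivity)

theorem measure_sketchAndRecover_ge {ν : EnsembleIndex d n m mc → Measure ℝ}
    [∀ e, IsProbabilityMeasure (ν e)] {c : ℝ} (hJL : JLBlocks ν c) (hc : 0 < c) (hd : 2 ≤ d)
    (hr : 1 ≤ r) (hrn : r ≤ n) (hrm : r ≤ m) (hrmc : r ≤ mc) {ε δ : ℝ} (hε : 0 < ε) (hε1 : ε < 1)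
    (hδ : 0 < δ) (hδ1 : δ < 1 / 3)
    (hm1 : 8 * Real.log (d * n ^ d / δ) ≤ c * m * (ε / (100 * d ^ 2 * r) * ε))
    (hm2 : 8 * (r * Real.log (d * n ^ d / δ)) ≤ c * m * (ε / (400 * d ^ 2) * ε))
    (hmc1 : 8 * Real.log (d * n ^ d / δ) ≤ c * mc * (ε / (100 * d ^ 2 * r) * ε))
    (hmc2 : 8 * (r * Real.log (d * n ^ d / δ)) ≤ c * mc * (ε / (400 * d ^ 2) * ε))
    (hW : ∀ k, IsUnit (W k).toMatrix) :
    ENNReal.ofReal (1 - δ) ≤ Measure.pi ν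
      {ω | tensorNorm (X - (sketchAndRecover γ S r W ω X).toTensor)
        ≤ (1 + Real.exp ε) * Real.sqrt (d * (1 + ε) / (1 - ε)) * optTuckerError r X} := by
  set G := {ω : EnsembleIndex d n m mc → ℝ |
    tensorNorm (X - (sketchAndRecover γ S r W ω X).toTensor)
      ≤ (1 + Real.exp ε) * Real.sqrt (d * (1 + ε) / (1 - ε)) * optTuckerError r X} with hG
  let F : Fin d → Set (EnsembleIndex d n m mc → ℝ) := fun k =>
    {ω | ¬ (1 - ε) * frobSq (unfold k X - recoveredFactor γ S W X r ω k *
        ((recoveredFactor γ S W X r ω k)ᵀ * unfold k X)) ≤ (1 + ε) * optTuckerError r X ^ 2}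
  let H : Fin d → Set (EnsembleIndex d n m mc → ℝ) := fun k =>
    {ω | ¬ (corePinv S (ensembleΦ ω) (recoveredFactor γ S W X r ω) k
          * (ensembleΦ ω k * recoveredFactor γ S W X r ω k) = 1 ∧
        frobSq (modeRecovery γ S W X r ω k * unfold k (stageError γ S W X r ω k))
          ≤ (1 + ε / d) ^ 2 * frobSq (unfold k (stageError γ S W X r ω k)))}
  -- Covering the whole space needs only subadditivity, so measurability of `G` plays no role.
  have hsub : Set.univ ⊆ G ∪ ⋃ k, (F k ∪ H k) := by
    intro ω _
    by_contra hcon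
    simp only [Set.mem_union, Set.mem_iUnion, not_or, not_exists] at hcon
    exact hcon.1 (tensorNorm_sub_sketchAndRecover_le γ S W X (by omega)
      (le_min hrn (hrm.trans (Nat.le_self_pow (by omega) m))) hε hε1
      (fun k => not_not.1 (hcon.2 k).1) fun k => not_not.1 (hcon.2 k).2)
  have hd' : (0 : ℝ) < d := by exact_mod_cast (by omega : 0 < d)
  have hbad : Measure.pi ν (⋃ k, (F k ∪ H k)) ≤ ENNReal.ofReal δ := by
    calc _ ≤ ∑ _k : Fin d, (ENNReal.ofReal (δ / (2 * d)) + ENNReal.ofReal (δ / (2 * d))) :=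
          (measure_iUnion_fintype_le _ _).trans (Finset.sum_le_sum fun k _ =>
            (measure_union_le _ _).trans (add_le_add
              (measure_factor_bad_le hJL hd hr hrn hrm hε hε1 hδ hδ1 hm1 hm2 γ S hW X k)
              (measure_core_bad_le γ S W X hJL hc hd hr hrn hrm hrmc hε hε1 hδ hδ1 hmc1 hmc2 k)))
      _ = ENNReal.ofReal δ := by
          rw [← ENNReal.ofReal_add (by positivity) (by positivity), Finset.sum_const,
            Finset.card_univ, Fintype.card_fin, nsmul_eq_mul, ← ENNReal.ofReal_natCast d,
            ← ENNReal.ofReal_mul hd'.le]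
          congr 1
          field_simp
          ring
  rw [ENNReal.ofReal_sub _ hδ.le, ENNReal.ofReal_one, tsub_le_iff_right]
  calc (1 : ℝ≥0∞) = Measure.pi ν Set.univ := measure_univ.symm
    _ ≤ Measure.pi ν G + Measure.pi ν (⋃ k, (F k ∪ H k)) :=
        (measure_mono hsub).trans (measure_union_le _ _)
    _ ≤ _ := add_le_add le_rfl hbad

end

/-! ## Measurement budget and running time -/

theorem numMeasurements_eq (d n m mc : ℕ) :
    numMeasurements d n m mc = d * (n * m ^ (d - 1)) + mc ^ d := by
  rw [numMeasurements, Fintype.card_sum, Fintype.card_sigma, Fintype.card_fun]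
  simp only [Fintype.card_prod, card_cols, Fintype.card_fin, Finset.sum_const, Finset.card_univ,
    smul_eq_mul]

theorem numMeasurements_le_budget {C : ℝ} {r d n : ℕ} {ε δ : ℝ} {m mc : ℕ} (hd : 0 < d)
    (hm : (m : ℝ) ≤ sketchBound C r d n ε δ) (hmc : (mc : ℝ) ≤ sketchBound C r d n ε δ) :
    (numMeasurements d n m mc : ℝ) ≤ measurementBudget C r d n ε δ := by
  have hL : 0 ≤ sketchBound C r d n ε δ := (Nat.cast_nonneg m).trans hm
  rw [numMeasurements_eq, measurementBudget]
  push_cast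
  have h1 : (m : ℝ) ^ (d - 1) ≤ sketchBound C r d n ε δ ^ (d - 1) := by gcongr
  have h2 : (mc : ℝ) ^ d ≤ sketchBound C r d n ε δ * sketchBound C r d n ε δ ^ (d - 1) := by
    rw [mul_pow_sub_one hd.ne']
    gcongr
  calc (d : ℝ) * (n * m ^ (d - 1)) + mc ^ d
      ≤ d * (n * sketchBound C r d n ε δ ^ (d - 1))
        + sketchBound C r d n ε δ * sketchBound C r d n ε δ ^ (d - 1) := by gcongr
    _ = _ := by ring

theorem exists_steps_onePassRecovery_le_isLittleO (s : ℕ → ℕ) {d r : ℕ} (hd : 2 ≤ d)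
    (hs : (fun n => (s n : ℝ)) =O[Filter.atTop] fun n : ℕ => Real.log n)
    (hrs : ∀ n, r ≤ n → r ≤ s n) (γ : ℕ) :
    ∃ T : ℕ → ℕ, (fun n => (T n : ℝ)) =o[Filter.atTop] (fun n => (n : ℝ) ^ d) ∧
      ∀ n : ℕ, r ≤ n → ∀ (S : SVDRoutine) (W : Fin d → ModeSensing n),
        ((∀ k, W k = none) ∨ 4 ≤ d) → ∀ (Φ : Fin d → Matrix (Fin (s n)) (Fin n) ℝ)
        (B : ∀ k : Fin d, Matrix (Fin n) (Cols (fun _ => s n) k) ℝ)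
        (Bc : Tensor (fun _ : Fin d => s n)), (onePassRecovery γ S r W Φ B Bc).steps ≤ T n := by
  -- The exponent is 3 only when `d ≥ 4`; otherwise all matrices are the identity and 1 suffices.
  -- Either way it is below `d`.
  refine ⟨fun n => d * (3 * γ + r + 20) * ((n + 1) ^ (if 4 ≤ d then 3 else 1) * ((s n + 1) ^ d) ^ 3),
    isLittleO_pow_of_isBigO_log hs d _ _ (by split <;> omega), ?_⟩
  intro n hn S W hW Φ B Bc
  have h1 : s n ^ (d - 1) ≤ (s n + 1) ^ d :=
    (Nat.pow_le_pow_left (Nat.le_succ _) _).trans (Nat.pow_le_pow_right (Nat.succ_pos _) (by omega))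
  have h2 : s n ≤ (s n + 1) ^ d := (Nat.le_succ _).trans (Nat.le_self_pow (by omega) _)
  refine steps_onePassRecovery_le γ S r (hrs n hn) W Φ B Bc (Nat.one_le_pow _ _ (Nat.succ_pos _))
    h1 h2 h1 (by split <;> omega) ?_
  rcases hW with hW | hW
  · exact Or.inl hW
  · exact Or.inr (by rw [if_pos hW])

end

/-! ### The main theorem -/

theorem mainTheorem1 (K : ℝ≥0) :
    ∃ C : ℝ, 0 < C ∧
      -- the sketching dimensions, as functions of `d`, `n`, `r`, `ε`, `δ`
      ∃ m mc : ℕ → ℕ → ℕ → ℝ → ℝ → ℕ,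
        ∀ (d r : ℕ) (ε δ : ℝ), 2 ≤ d → 1 ≤ r → 0 < ε → ε < 1 → 0 < δ → δ < 1 / 3 →
          -- measurement budget and error guarantee
          (∀ n : ℕ, r ≤ n →
            (r ≤ m d n r ε δ ∧ (m d n r ε δ : ℝ) ≤ sketchBound C r d n ε δ) ∧
            (r ≤ mc d n r ε δ ∧ (mc d n r ε δ : ℝ) ≤ sketchBound C r d n ε δ) ∧
            (numMeasurements d n (m d n r ε δ) (mc d n r ε δ) : ℝ)
              ≤ measurementBudget C r d n ε δ ∧
            ∀ (ν : EnsembleIndex d n (m d n r ε δ) (mc d n r ε δ) → Measure ℝ)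
              [∀ e, IsProbabilityMeasure (ν e)], (∀ e, IsStdSubgaussian K (ν e)) →
            ∀ (γ : ℕ) (S : SVDRoutine) (W : Fin d → ModeSensing n),
              (∀ k, IsUnit (W k).toMatrix) →
            ∀ X : Tensor (fun _ : Fin d => n),
              (∀ ω : EnsembleIndex d n (m d n r ε δ) (mc d n r ε δ) → ℝ,
                (sketchAndRecover γ S r W ω X).Orthonormal) ∧
              ENNReal.ofReal (1 - δ) ≤ Measure.pi ν
                {ω | tensorNorm (X - (sketchAndRecover γ S r W ω X).toTensor)
                  ≤ (1 + Real.exp ε) * Real.sqrt (d * (1 + ε) / (1 - ε))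
                    * optTuckerError r X}) ∧
          -- worst-case running time of the recovery algorithm
          (∀ γ : ℕ, ∃ T : ℕ → ℕ,
            (fun n => (T n : ℝ)) =o[Filter.atTop] (fun n => (n : ℝ) ^ d) ∧
            ∀ n : ℕ, r ≤ n →
            ∀ (S : SVDRoutine) (W : Fin d → ModeSensing n), ((∀ k, W k = none) ∨ 4 ≤ d) →
            ∀ (Φ : Fin d → Matrix (Fin (mc d n r ε δ)) (Fin n) ℝ)
              (B : ∀ k : Fin d, Matrix (Fin n) (Cols (fun _ => m d n r ε δ) k) ℝ)
              (Bc : Tensor (fun _ : Fin d => mc d n r ε δ)),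
              (onePassRecovery γ S r W Φ B Bc).steps ≤ T n) := by
  obtain ⟨c, hc, hJL⟩ := exists_measure_frobSq_distortion_le K
  have hC : 0 < 6400 / c + 2 := by positivity
  refine ⟨6400 / c + 2, hC, fun d n r ε δ => ⌊sketchBound (6400 / c + 2) r d n ε δ⌋₊,
    fun d n r ε δ => ⌊sketchBound (6400 / c + 2) r d n ε δ⌋₊, ?_⟩
  intro d r ε δ hd hr hε hε1 hδ hδ1
  -- The logarithm is at least 1 because its argument is at least `6 > e`.
  have hkey : ∀ n, r ≤ n → _ := fun n hn => sketch_exponent_bounds hc rfl hr hd hε hε1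
    (by
      rw [Real.le_log_iff_exp_le (by linarith [(ratio_bounds hd hr hn hδ hδ1).1])]
      linarith [(ratio_bounds hd hr hn hδ hδ1).1, Real.exp_one_lt_d9] :
      (1 : ℝ) ≤ Real.log (d * n ^ d / δ))
    (rfl : sketchBound (6400 / c + 2) r d n ε δ = _) rfl
  refine ⟨fun n hn => ?_, fun γ => ?_⟩
  · obtain ⟨hrs, hsL, h1, h2⟩ := hkey n hn
    have hrs' : r ≤ ⌊sketchBound (6400 / c + 2) r d n ε δ⌋₊ := by exact_mod_cast hrs
    refine ⟨⟨hrs', hsL⟩, ⟨hrs', hsL⟩, numMeasurements_le_budget (by omega) hsL hsL, ?_⟩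
    intro ν _ hν γ S W hW X
    refine ⟨fun ω k => recoverFactor_orthonormal γ S _ _ ?_, ?_⟩
    · rw [card_cols]
      exact le_min hn (hrs'.trans (Nat.le_self_pow (by omega) _))
    · exact measure_sketchAndRecover_ge γ S W X (fun hs he _ _ Y η => hJL ν hν hs he Y η) hc hd hr hn
        hrs' hrs' hε hε1 hδ hδ1 h1 h2 h1 h2 hW
  · refine exists_steps_onePassRecovery_le_isLittleO
      (fun n => ⌊sketchBound (6400 / c + 2) r d n ε δ⌋₊) hd ?_
      (fun n hn => by exact_mod_cast (hkey n hn).1) γ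
    refine IsBigO.trans (IsBigO.of_bound 1 ?_)
      (sketchBound_isBigO_log (6400 / c + 2) r (by omega : 0 < d) ε hδ)
    filter_upwards [Filter.eventually_ge_atTop r] with n hn
    have h := (hkey n hn).2.1
    rw [one_mul, Real.norm_of_nonneg (Nat.cast_nonneg _)]
    exact h.trans (le_abs_self _)
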